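/- A (finite normal-form) game $\Gamma=(\mathcal N,(A^i)_{i\in\mathcal N},(u^i)_{i\in\mathcal N})$ consists of a finite non-empty player set $\mathcal N$, finite non-empty pairwise disjoint action sets $A^i$, and payoff functions $u^i : A=\prod_{j\in\mathcal N} A^j\to\mathbb Q$. A game isomorphism $\Gamma\to\Gamma'$ is a bijection $\phi:\bigcup_i A^i\to\bigcup_j A'^j$ together with a bijection $\pi:\mathcal N\to\mathcal N'$ such that $\phi(A^i)\subseteq A'^{\pi(i)}$ for all $i$ and $u^i(\mathbf a)=u'^{\pi(i)}(\phi(\mathbf a))$ for all $i\in\mathcal N$ and $\mathbf a\in A$, where $\phi(\mathbf a)=(\phi(\mathbf a_{\pi^{-1}(j)}))_{j\in\mathcal N'}$. The game isomorphism problem asks, given two games in explicit form (a table listing the payoffs of all players, as fractions in binary, at every action profile), whether there is a game isomorphism between them. The graph isomorphism problem asks whether two given finite simple undirected graphs are isomorphic. The class $\mathsf{GI}$ consists of all decision problems that reduce to it by a polynomial-time many-one reduction, and a problem is $\mathsf{GI}$-complete if it lies in $\mathsf{GI}$ and every problem in $\mathsf{GI}$ reduces to it by a polynomial-time many-one reduction.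 (Decision problems are given with a binary encoding of their instances; reductions map instances to instances.) **Theorem.** The game isomorphism problem is $\mathsf{GI}$-complete. It remains $\mathsf{GI}$-complete when both input games are required to be two-player zero-sum games ($|\mathcal N|=2$ and the two payoffs sum to $0$ at every action profile), and also when both input games are required to be two-player team games ($|\mathcal N|=2$ and the two players receive the same payoff at every action profile). -/

import Mathlib

namespace GameIsoGI

/-! ### Decision problems, polynomial-time reductions, and the class GI -/

/-- A decision problem: a type of instances, an injective binary encoding of the instances
(with respect to which running times are measured), and the set of yes-instances. -/
structure DecisionProblem where
  Inst : Type
  encode : Inst → List Bool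
  encode_injective : Function.Injective encode
  Yes : Inst → Prop

/-- Polynomial-time many-one (Karp) reducibility: some map of instances that preserves and
reflects yes-instances is computed by a multi-stack Turing machine within a number of steps that
is polynomial in the length of the encoded input. -/
def PolyTimeReduces (P Q : DecisionProblem) : Prop :=
  ∃ f : P.Inst → Q.Inst,
    Nonempty (Turing.TM2ComputableInPolyTime P.encode Q.encode f) ∧
      ∀ x, P.Yes x ↔ Q.Yes (f x)

/-! ### Prefix-free binary codes -/

/-- A code whose words can be read off unambiguously from the front of a longer string. -/
def PrefixDecodable {α : Type} (c : α → List Bool) : Prop :=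
  ∀ x y s t, c x ++ s = c y ++ t → x = y ∧ s = t

theorem PrefixDecodable.injective {α : Type} {c : α → List Bool} (h : PrefixDecodable c) :
    Function.Injective c := fun x y hxy => (h x y [] [] (by rw [hxy])).1

/-- Concatenation of the code words of two objects. -/
def encodePair {α β : Type} (c : α → List Bool) (d : β → List Bool) (p : α × β) : List Bool :=
  c p.1 ++ d p.2

theorem PrefixDecodable.pair {α β : Type} {c : α → List Bool} {d : β → List Bool}
    (hc : PrefixDecodable c) (hd : PrefixDecodable d) : PrefixDecodable (encodePair c d) := by
  rintro ⟨a, b⟩ ⟨a', b'⟩ s t h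
  simp only [encodePair, List.append_assoc] at h
  obtain ⟨h1, h2⟩ := hc _ _ _ _ h
  obtain ⟨h3, h4⟩ := hd _ _ _ _ h2
  exact ⟨Prod.ext h1 h3, h4⟩

/-- Concatenation of the code words of the entries of a finite sequence of known length. -/
def encodeFun {α : Type} (c : α → List Bool) {n : ℕ} (f : Fin n → α) : List Bool :=
  (List.ofFn fun i => c (f i)).flatten

theorem PrefixDecodable.func {α : Type} {c : α → List Bool} (hc : PrefixDecodable c) (n : ℕ) :
    PrefixDecodable (fun f : Fin n → α => encodeFun c f) := by
  induction n with
  | zero =>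
    intro f g s t h
    exact ⟨Subsingleton.elim _ _, by simpa [encodeFun] using h⟩
  | succ n ih =>
    intro f g s t h
    simp only [encodeFun, List.ofFn_succ, List.flatten_cons, List.append_assoc] at h
    obtain ⟨h0, h⟩ := hc _ _ _ _ h
    obtain ⟨h1, h⟩ := ih (fun i => f i.succ) (fun i => g i.succ) s t h
    refine ⟨funext fun i => ?_, h⟩
    refine Fin.cases h0 (fun j => congrFun h1 j) i

/-- One bit. -/
def encodeBit (b : Bool) : List Bool := [b]

theorem prefixDecodable_bit : PrefixDecodable encodeBit := by
  intro x y s t h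
  simpa [encodeBit] using h

/-- Unary code of a natural number, with an end marker. -/
def encodeUnary (n : ℕ) : List Bool := List.replicate n true ++ [false]

theorem prefixDecodable_unary : PrefixDecodable encodeUnary := by
  intro x
  induction x with
  | zero =>
    intro y s t h
    cases y with
    | zero => simpa [encodeUnary] using h
    | succ y => simp [encodeUnary, List.replicate_succ] at h
  | succ x ih =>
    intro y s t h
    cases y with
    | zero => simp [encodeUnary, List.replicate_succ] at h
    | succ y =>
      obtain ⟨h1, h2⟩ := ih y s t (by simpa [encodeUnary, List.replicate_succ] using h)
      exact ⟨congrArg Nat.succ h1, h2⟩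

/-- A bit string, made self-delimiting: every bit is announced by a `true`, and a `false`
marks the end. -/
def encodeBits (l : List Bool) : List Bool := (l.flatMap fun b => [true, b]) ++ [false]

theorem prefixDecodable_bits : PrefixDecodable encodeBits := by
  intro x
  induction x with
  | nil =>
    intro y s t h
    cases y with
    | nil => simpa [encodeBits] using h
    | cons b y => simp [encodeBits] at h
  | cons a x ih =>
    intro y s t h
    cases y with
    | nil => simp [encodeBits] at h
    | cons b y =>
      have h' : a = b ∧ encodeBits x ++ s = encodeBits y ++ t := by
        simpa [encodeBits] using h
      obtain ⟨h1, h2⟩ := ih y s t h'.2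
      exact ⟨by rw [h'.1, h1], h2⟩

/-- Binary code of a natural number (least significant bit first). -/
def encodeNat (n : ℕ) : List Bool := encodeBits n.bits

theorem prefixDecodable_nat : PrefixDecodable encodeNat := by
  intro x y s t h
  obtain ⟨h1, h2⟩ := prefixDecodable_bits _ _ _ _ h
  refine ⟨?_, h2⟩
  have hinv : ∀ n : ℕ, Nat.ofDigits 2 (n.bits.map fun b => cond b 1 0) = n := fun n => by
    rw [← Nat.digits_two_eq_bits, Nat.ofDigits_digits]
  rw [← hinv x, ← hinv y, h1]

/-- Code of a rational number in lowest terms: sign, absolute value of the numerator and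
denominator, both in binary. -/
def encodeRat (q : ℚ) : List Bool :=
  decide (q.num < 0) :: (encodeNat q.num.natAbs ++ encodeNat q.den)

theorem prefixDecodable_rat : PrefixDecodable encodeRat := by
  intro x y s t h
  simp only [encodeRat, List.cons_append, List.append_assoc, List.cons.injEq,
    decide_eq_decide] at h
  obtain ⟨h1, h⟩ := h
  obtain ⟨h2, h⟩ := prefixDecodable_nat _ _ _ _ h
  obtain ⟨h3, h⟩ := prefixDecodable_nat _ _ _ _ h
  exact ⟨Rat.ext (by omega) h3, h⟩

/-! ### Graph isomorphism -/

/-- A finite simple graph, with vertices numbered from `0`. -/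
structure FinGraph where
  order : ℕ
  graph : SimpleGraph (Fin order)

open Classical in
/-- Code of a graph: the number of vertices in unary, then the adjacency matrix row by row. -/
noncomputable def encodeGraph (G : FinGraph) : List Bool :=
  encodeUnary G.order ++
    encodeFun (fun row : Fin G.order → Bool => encodeFun encodeBit row)
      (fun x y => decide (G.graph.Adj x y))

theorem prefixDecodable_graph : PrefixDecodable encodeGraph := by
  rintro ⟨n, G⟩ ⟨n', G'⟩ s t h
  simp only [encodeGraph, List.append_assoc] at h
  obtain ⟨rfl, h⟩ := prefixDecodable_unary _ _ _ _ h
  obtain ⟨h1, h⟩ := (prefixDecodable_bit.func n).func n _ _ _ _ h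
  refine ⟨?_, h⟩
  congr 1
  ext x y
  simpa using congrFun (congrFun h1 x) y

/-- The graph isomorphism problem: given two finite simple graphs, are they isomorphic? -/
noncomputable def graphIsoProblem : DecisionProblem where
  Inst := FinGraph × FinGraph
  encode := encodePair encodeGraph encodeGraph
  encode_injective := (prefixDecodable_graph.pair prefixDecodable_graph).injective
  Yes p := Nonempty (p.1.graph ≃g p.2.graph)

/-- The complexity class GI: all decision problems that reduce in polynomial time to graph
isomorphism. -/
def ClassGI : Set DecisionProblem := {P | PolyTimeReduces P graphIsoProblem}

/-- GI-completeness: membership in GI, and every problem in GI reduces to the problem in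
polynomial time. -/
def GIComplete (P : DecisionProblem) : Prop :=
  P ∈ ClassGI ∧ ∀ Q ∈ ClassGI, PolyTimeReduces Q P

/-! ### Games -/

/-- A finite normal-form game with rational payoffs. Players and the actions of each player are
numbered from `0`. -/
structure Game where
  numPlayers : ℕ
  numPlayers_pos : 0 < numPlayers
  numActions : Fin numPlayers → ℕ
  numActions_pos : ∀ i, 0 < numActions i
  payoff : Fin numPlayers → (∀ i, Fin (numActions i)) → ℚ

namespace Game

/-- The players of a game. -/
abbrev Player (Γ : Game) : Type := Fin Γ.numPlayers

/-- The action profiles of a game. -/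
abbrev Profile (Γ : Game) : Type := ∀ i : Γ.Player, Fin (Γ.numActions i)

/-- The disjoint union of the action sets of a game. -/
abbrev Action (Γ : Game) : Type := Σ i : Γ.Player, Fin (Γ.numActions i)

end Game

/-- A bijection between the actions of two games that maps the actions of each player `i` to
actions of the player `player i`, where `player` is a bijection between the players. -/
structure ActionMap (Γ Γ' : Game) where
  action : Γ.Action ≃ Γ'.Action
  player : Γ.Player ≃ Γ'.Player
  action_player : ∀ a : Γ.Action, (action a).1 = player a.1

/-- The induced map on profiles: in the image of `s`, player `j` plays the image of the action
that player `player⁻¹ j` plays in `s`. -/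
def ActionMap.profile {Γ Γ' : Game} (φ : ActionMap Γ Γ') (s : Γ.Profile) : Γ'.Profile :=
  fun j =>
    Fin.cast
      (congrArg Γ'.numActions ((φ.action_player _).trans (φ.player.apply_symm_apply j)))
      (φ.action ⟨φ.player.symm j, s (φ.player.symm j)⟩).2

/-- A game isomorphism: an action map that leaves the payoffs invariant. -/
structure GameIso (Γ Γ' : Game) extends ActionMap Γ Γ' where
  payoff_eq : ∀ (i : Γ.Player) (s : Γ.Profile),
    Γ.payoff i s = Γ'.payoff (player i) (toActionMap.profile s)

/-- Two-player zero-sum games: there are two players, whose payoffs always sum to zero. -/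
def Game.IsTwoPlayerZeroSum (Γ : Game) : Prop :=
  Γ.numPlayers = 2 ∧ ∀ s : Γ.Profile, ∑ i : Γ.Player, Γ.payoff i s = 0

/-- Two-player team games: there are two players, who always receive the same payoff. -/
def Game.IsTwoPlayerTeam (Γ : Game) : Prop :=
  Γ.numPlayers = 2 ∧ ∀ (s : Γ.Profile) (i j : Γ.Player), Γ.payoff i s = Γ.payoff j s

/-- Code of a game in explicit form: the number of players and the numbers of actions in unary,
then the table that lists, for every action profile (in the order of `finPiFinEquiv`, where the
action of player `0` varies fastest), the payoffs of all players. -/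
def encodeGame (Γ : Game) : List Bool :=
  encodeUnary Γ.numPlayers ++ (encodeFun encodeUnary Γ.numActions ++
    encodeFun (fun row : Γ.Player → ℚ => encodeFun encodeRat row)
      (fun k i => Γ.payoff i (finPiFinEquiv.symm k)))

theorem prefixDecodable_game : PrefixDecodable encodeGame := by
  rintro ⟨n, hn, m, hm, u⟩ ⟨n', hn', m', hm', u'⟩ s t h
  simp only [encodeGame, List.append_assoc] at h
  obtain ⟨rfl, h⟩ := prefixDecodable_unary _ _ _ _ h
  obtain ⟨rfl, h⟩ := prefixDecodable_unary.func n _ _ _ _ h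
  obtain ⟨h1, h⟩ := (prefixDecodable_rat.func n).func _ _ _ _ _ h
  refine ⟨?_, h⟩
  congr 1
  funext i p
  simpa using congrFun (congrFun h1 (finPiFinEquiv p)) i

/-- The game isomorphism problem, restricted to games with the property `C`: given two such games
in explicit form, are they isomorphic? -/
def gameIsoProblemOn (C : Game → Prop) : DecisionProblem where
  Inst := {Γ : Game // C Γ} × {Γ : Game // C Γ}
  encode := encodePair (fun Γ => encodeGame Γ.1) (fun Γ => encodeGame Γ.1)
  encode_injective := by
    have h : PrefixDecodable (fun Γ : {Γ : Game // C Γ} => encodeGame Γ.1) := fun x y s t h =>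
      ⟨Subtype.ext (prefixDecodable_game _ _ _ _ h).1, (prefixDecodable_game _ _ _ _ h).2⟩
    exact (h.pair h).injective
  Yes p := Nonempty (GameIso p.1.1 p.2.1)

/-- The game isomorphism problem for arbitrary games. -/
def gameIsoProblem : DecisionProblem := gameIsoProblemOn fun _ => True

end GameIsoGI

/-! Hardness: a graph with `n` vertices becomes a two-player game. Rows are the vertices and one
dummy, columns are numbered pairs. Player `0` receives `1` if the row vertex lies in the pair of the
column and that pair is an edge or a repeated vertex, and `-1` otherwise. The other player receives
the same or the opposite payoff, so one construction serves team, zero-sum and arbitrary games. The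
numbers of actions differ, so the players cannot be exchanged. Repeated-vertex columns separate true
rows from the dummy (`incident_lt`), and edge columns return adjacency (`incident_map`). This gives
`incidenceGame_iso_iff`.

Membership: a game becomes a coloured graph on its players, actions, profiles and pairs (player,
profile), the last kind coloured by payoffs. Its colour-preserving isomorphisms are the game
isomorphisms (`Vertex.gameIso_of_equiv`, `Vertex.equiv_of_gameIso`). Payoffs may be huge, so each is
replaced by the position where its code first occurs in the input word. This word contains both
games, hence equal labels mean equal payoffs (`occurrence_injective`). Both graphs are placed on one
vertex set of polynomial size, and colours are replaced by numbers of pendant vertices, read off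
from degrees (`pendantGraph_iso_iff`).

Complexity: both maps must be computed by actual stack machines. Every quantity involved (positions,
lengths, counts, labels) is polynomially bounded in value, so it may be kept in unary. `PF` collects
functions obtained by iteration with polynomially bounded intermediate values, `OutF` the words
printed by nested loops over them. Both are turned into register programs (`PF.computed`,
`OutF.printed`), and these into machines (`Runs.stepsTo`). Hardness for all of GI then needs only
transitivity of reductions, that is, composition of machines (`TM2ComputableInPolyTime.comp`). -/

namespace GameIsoGI

open Turing Function

/-! ### Counting steps of a partial transition function -/

/-- `StepsTo f n a b`: iterating the partial function `f` leads from `a` to `b` in `n` steps. -/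
inductive StepsTo {S : Type*} (f : S → Option S) : ℕ → S → S → Prop
  | refl (a : S) : StepsTo f 0 a a
  | head {n : ℕ} {a b c : S} : f a = some b → StepsTo f n b c → StepsTo f (n + 1) a c

namespace StepsTo

variable {S T : Type*} {f : S → Option S} {g : T → Option T}

theorem trans {m n : ℕ} {a b c : S} (h₁ : StepsTo f m a b) (h₂ : StepsTo f n b c) :
    StepsTo f (m + n) a c := by
  induction h₁ with
  | refl => simpa using h₂
  | head h _ ih => rw [Nat.add_right_comm]; exact .head h (ih h₂)

theorem single {a b : S} (h : f a = some b) : StepsTo f 1 a b := .head h (.refl b)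

theorem tail {n : ℕ} {a b c : S} (h₁ : StepsTo f n a b) (h₂ : f b = some c) :
    StepsTo f (n + 1) a c := h₁.trans (.single h₂)

theorem map {e : S → T} (he : ∀ a b, f a = some b → g (e a) = some (e b)) {n : ℕ} {a b : S}
    (h : StepsTo f n a b) : StepsTo g n (e a) (e b) := by
  induction h with
  | refl => exact .refl _
  | head h _ ih => exact .head (he _ _ h) ih

/-- `StateTransition.EvalsToInTime` counts steps by iterating the Kleisli extension; the inductive
form is the one that composes. Once the iteration reaches `none` it stays there. -/
theorem iff_iterate {n : ℕ} {a b : S} :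
    StepsTo f n a b ↔ (flip bind f)^[n] (some a) = some b := by
  have hnone : ∀ n : ℕ, (flip bind f)^[n] none = none := fun n => by
    induction n with
    | zero => rfl
    | succ n ih => rw [Function.iterate_succ_apply]; exact ih
  constructor
  · intro h
    induction h with
    | refl => rfl
    | head h _ ih => rw [Function.iterate_succ_apply, ← ih]; exact congrArg _ h
  · induction n generalizing a with
    | zero => intro h; cases h; exact .refl _
    | succ n ih =>
      intro h
      rw [Function.iterate_succ_apply] at h
      change (flip bind f)^[n] (f a) = some b at h
      cases hfa : f a with
      | none => rw [hfa, hnone] at h; cases h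
      | some a' => exact .head hfa (ih (hfa ▸ h))

theorem evalsToInTime {n m : ℕ} {a b : S} (h : StepsTo f n a b) (hn : n ≤ m) :
    Nonempty (StateTransition.EvalsToInTime f a (some b) m) :=
  ⟨⟨⟨n, iff_iterate.1 h⟩, hn⟩⟩

end StepsTo

/-- Written with `Function.update`, the initial stacks can be handled by the same rewriting as the
effect of pushes and pops. -/
theorem initList_eq (tm : FinTM2) (s : List (tm.Γ tm.k₀)) :
    initList tm s = ⟨some tm.main, tm.initialState, Function.update (fun _ => []) tm.k₀ s⟩ := by
  unfold initList
  congr 1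
  funext k
  by_cases h : k = tm.k₀
  · subst h; simp
  · simp [h]

theorem haltList_eq (tm : FinTM2) (s : List (tm.Γ tm.k₁)) :
    haltList tm s = ⟨none, tm.initialState, Function.update (fun _ => []) tm.k₁ s⟩ := by
  unfold haltList
  congr 1
  funext k
  by_cases h : k = tm.k₁
  · subst h; simp
  · simp [h]

/-! ### Composition of machines -/

namespace CompMachine

variable (M N : FinTM2)

/-- The stacks of the composite: those of both machines and one for the transfer. -/
abbrev K : Type := M.K ⊕ (N.K ⊕ Unit)

/-- The stack alphabets of the composite. -/
abbrev Alph : K M N → Type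
  | .inl k => M.Γ k
  | .inr (.inl k) => N.Γ k
  | .inr (.inr _) => Bool

/-- The labels of the composite: those of both machines and two for the transfer. -/
abbrev Lab : Type := M.Λ ⊕ (N.Λ ⊕ Bool)

/-- The internal states of the composite. -/
abbrev Var : Type := M.σ × N.σ × Option Bool

/-- The stacks of the composite, from those of its parts. -/
def stk (S : ∀ k, List (M.Γ k)) (T : ∀ k, List (N.Γ k)) (u : List Bool) :
    ∀ k, List (Alph M N k)
  | .inl k => S k
  | .inr (.inl k) => T k
  | .inr (.inr _) => u

variable {M N}

theorem update_left (S : ∀ k, List (M.Γ k)) (T : ∀ k, List (N.Γ k)) (u : List Bool) (k : M.K)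
    (x : List (M.Γ k)) :
    Function.update (stk M N S T u) (.inl k) x = stk M N (Function.update S k x) T u := by
  funext j
  rcases j with j | j | j
  · by_cases h : j = k
    · subst h; simp [stk]
    · simp [stk, h]
  all_goals simp [stk]

theorem update_right (S : ∀ k, List (M.Γ k)) (T : ∀ k, List (N.Γ k)) (u : List Bool) (k : N.K)
    (x : List (N.Γ k)) :
    Function.update (stk M N S T u) (.inr (.inl k)) x =
      stk M N S (Function.update T k x) u := by
  funext j
  rcases j with j | j | j
  · simp [stk]
  · by_cases h : j = k
    · subst h; simp [stk]
    · simp [stk, h]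
  · simp [stk]

theorem update_mid (S : ∀ k, List (M.Γ k)) (T : ∀ k, List (N.Γ k)) (u : List Bool)
    (x : List Bool) :
    Function.update (stk M N S T u) (.inr (.inr ())) x = stk M N S T x := by
  funext j
  rcases j with j | j | j <;> simp [stk]

/-- A statement of the first machine, run inside the composite; halting starts the transfer. -/
def left : TM2.Stmt M.Γ M.Λ M.σ → TM2.Stmt (Alph M N) (Lab M N) (Var M N)
  | .push k f q => .push (.inl k) (fun v => f v.1) (left q)
  | .peek k f q => .peek (.inl k) (fun v x => (f v.1 x, v.2)) (left q)
  | .pop k f q => .pop (.inl k) (fun v x => (f v.1 x, v.2)) (left q)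
  | .load f q => .load (fun v => (f v.1, v.2)) (left q)
  | .branch f q r => .branch (fun v => f v.1) (left q) (left r)
  | .goto f => .goto fun v => .inl (f v.1)
  | .halt => .goto fun _ => .inr (.inr false)

/-- A statement of the second machine, run inside the composite. -/
def right : TM2.Stmt N.Γ N.Λ N.σ → TM2.Stmt (Alph M N) (Lab M N) (Var M N)
  | .push k f q => .push (.inr (.inl k)) (fun v => f v.2.1) (right q)
  | .peek k f q => .peek (.inr (.inl k)) (fun v x => (v.1, f v.2.1 x, v.2.2)) (right q)
  | .pop k f q => .pop (.inr (.inl k)) (fun v x => (v.1, f v.2.1 x, v.2.2)) (right q)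
  | .load f q => .load (fun v => (v.1, f v.2.1, v.2.2)) (right q)
  | .branch f q r => .branch (fun v => f v.2.1) (right q) (right r)
  | .goto f => .goto fun v => .inr (.inl (f v.2.1))
  | .halt => .halt

/-- A configuration of the first machine, inside the composite. -/
def leftCfg (c : M.Cfg) : TM2.Cfg (Alph M N) (Lab M N) (Var M N) :=
  ⟨some (c.l.elim (.inr (.inr false)) .inl), (c.var, N.initialState, none),
    stk M N c.stk (fun _ => []) []⟩

/-- A configuration of the second machine, inside the composite. -/
def rightCfg (c : N.Cfg) : TM2.Cfg (Alph M N) (Lab M N) (Var M N) :=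
  ⟨c.l.map fun l => .inr (.inl l), (M.initialState, c.var, none),
    stk M N (fun _ => []) c.stk []⟩

/-- The embedding of configurations is a simulation. A halted configuration of the first machine is
sent to the start of the transfer, which is why `halt` is translated into a jump there. -/
theorem stepAux_left (q : TM2.Stmt M.Γ M.Λ M.σ) (v : M.σ) (S : ∀ k, List (M.Γ k)) :
    TM2.stepAux (left (N := N) q) (v, N.initialState, none) (stk M N S (fun _ => []) []) =
      leftCfg (TM2.stepAux q v S) := by
  induction q generalizing v S with
  | push k f q ih =>
    simp only [left, TM2.stepAux, update_left]
    exact ih _ _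
  | peek k f q ih => exact ih _ _
  | pop k f q ih =>
    simp only [left, TM2.stepAux, update_left]
    exact ih _ _
  | load f q ih => exact ih _ _
  | branch f q r ih₁ ih₂ =>
    simp only [left, TM2.stepAux]
    cases f v
    · exact ih₂ _ _
    · exact ih₁ _ _
  | goto f => rfl
  | halt => rfl

theorem stepAux_right (q : TM2.Stmt N.Γ N.Λ N.σ) (v : N.σ) (S : ∀ k, List (N.Γ k)) :
    TM2.stepAux (right (M := M) q) (M.initialState, v, none) (stk M N (fun _ => []) S []) =
      rightCfg (TM2.stepAux q v S) := by
  induction q generalizing v S with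
  | push k f q ih =>
    simp only [right, TM2.stepAux, update_right]
    exact ih _ _
  | peek k f q ih => exact ih _ _
  | pop k f q ih =>
    simp only [right, TM2.stepAux, update_right]
    exact ih _ _
  | load f q ih => exact ih _ _
  | branch f q r ih₁ ih₂ =>
    simp only [right, TM2.stepAux]
    cases f v
    · exact ih₂ _ _
    · exact ih₁ _ _
  | goto f => rfl
  | halt => rfl

/-- The composite program. The output of the first machine is moved to the input stack of the
second one through an intermediate stack, so that its order is kept. -/
def program (out : M.Γ M.k₁ ≃ Bool) (inp : N.Γ N.k₀ ≃ Bool) :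
    Lab M N → TM2.Stmt (Alph M N) (Lab M N) (Var M N)
  | .inl l => left (M.m l)
  | .inr (.inl l) => right (N.m l)
  | .inr (.inr false) =>
    .pop (.inl M.k₁) (fun v x => (v.1, v.2.1, x.map out)) <|
      .branch (fun v => v.2.2.isSome)
        (.push (.inr (.inr ())) (fun v => v.2.2.getD false) <|
          .load (fun v => (v.1, v.2.1, none)) <| .goto fun _ => .inr (.inr false))
        (.goto fun _ => .inr (.inr true))
  | .inr (.inr true) =>
    .pop (.inr (.inr ())) (fun v x => (v.1, v.2.1, x)) <|
      .branch (fun v => v.2.2.isSome)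
        (.push (.inr (.inl N.k₀)) (fun v => inp.symm (v.2.2.getD false)) <|
          .load (fun v => (v.1, v.2.1, none)) <| .goto fun _ => .inr (.inr true))
        (.goto fun _ => .inr (.inl N.main))

/-- One step per symbol and one more to notice the empty stack. The word arrives reversed;
`transfer_in` reverses it back. -/
theorem transfer_out (out : M.Γ M.k₁ ≃ Bool) (inp : N.Γ N.k₀ ≃ Bool) (v : M.σ × N.σ)
    (T : ∀ k, List (N.Γ k)) (x u : List Bool) :
    StepsTo (TM2.step (program out inp)) (x.length + 1)
      ⟨some (.inr (.inr false)), (v.1, v.2, none),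
        stk M N (Function.update (fun _ => []) M.k₁ (x.map out.symm)) T u⟩
      ⟨some (.inr (.inr true)), (v.1, v.2, none),
        stk M N (fun _ => []) T (x.reverse ++ u)⟩ := by
  induction x generalizing u with
  | nil =>
    refine .single ?_
    simp [program, update_left, stk]
  | cons b x ih =>
    refine .head ?_ (by simpa using ih (b :: u))
    simp [program, update_left, update_mid, stk]

theorem transfer_in (out : M.Γ M.k₁ ≃ Bool) (inp : N.Γ N.k₀ ≃ Bool) (v : M.σ × N.σ)
    (S : ∀ k, List (M.Γ k)) {x y z : List Bool} (hz : x.reverse ++ y = z) :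
    StepsTo (TM2.step (program out inp)) (x.length + 1)
      ⟨some (.inr (.inr true)), (v.1, v.2, none),
        stk M N S (Function.update (fun _ => []) N.k₀ (y.map inp.symm)) x⟩
      ⟨some (.inr (.inl N.main)), (v.1, v.2, none),
        stk M N S (Function.update (fun _ => []) N.k₀ (z.map inp.symm)) []⟩ := by
  induction x generalizing y with
  | nil =>
    refine .single ?_
    simp_all [program, update_mid, stk]
  | cons b x ih =>
    refine .head ?_ (ih (y := b :: y) (by simpa using hz))
    simp [program, update_right, update_mid, stk]

/-- The composite machine. -/
def machine (M N : FinTM2) (out : M.Γ M.k₁ ≃ Bool) (inp : N.Γ N.k₀ ≃ Bool) : FinTM2 :=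
  letI := M.kFin
  letI := N.kFin
  letI := M.ΛFin
  letI := N.ΛFin
  letI := M.σFin
  letI := N.σFin
  letI := M.Γk₀Fin
  { K := K M N
    k₀ := .inl M.k₀
    k₁ := .inr (.inl N.k₁)
    Γ := Alph M N
    Λ := Lab M N
    main := .inl M.main
    σ := Var M N
    initialState := (M.initialState, N.initialState, none)
    Γk₀Fin := M.Γk₀Fin
    m := program out inp }

/-- A machine must halt with all other stacks empty and its internal state reset. Hence after the
first run nothing of it is left but the output word, and the second run starts from a genuine
initial configuration. -/
theorem machine_outputs {out : M.Γ M.k₁ ≃ Bool} {inp : N.Γ N.k₀ ≃ Bool} {m n : ℕ}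
    {x : List (M.Γ M.k₀)} {y : List Bool} {z : List (N.Γ N.k₁)}
    (h₁ : StepsTo M.step m (initList M x) (haltList M (y.map out.symm)))
    (h₂ : StepsTo N.step n (initList N (y.map inp.symm)) (haltList N z)) :
    StepsTo (machine M N out inp).step (m + 2 * y.length + 2 + n)
      (initList (machine M N out inp) x) (haltList (machine M N out inp) z) := by
  have e₁ : StepsTo (machine M N out inp).step m _ _ := h₁.map (e := leftCfg) (by
    rintro ⟨_ | l, v, S⟩ b hb
    · simp at hb
    · obtain rfl := Option.some.inj hb
      exact congrArg some (stepAux_left _ _ _))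
  have e₂ : StepsTo (machine M N out inp).step n _ _ := h₂.map (e := rightCfg) (by
    rintro ⟨_ | l, v, S⟩ b hb
    · simp at hb
    · obtain rfl := Option.some.inj hb
      exact congrArg some (stepAux_right _ _ _))
  have e₃ := transfer_out out inp (M.initialState, N.initialState) (fun _ => []) y []
  have e₄ := transfer_in out inp (M.initialState, N.initialState) (fun _ => [])
    (x := y.reverse ++ []) (y := []) (z := y) (by simp)
  rw [initList_eq, haltList_eq] at e₁ e₂
  have hi : (Function.update (fun _ => []) (.inl M.k₀) x : ∀ k, List (Alph M N k)) =
      stk M N (Function.update (fun _ => []) M.k₀ x) (fun _ => []) [] := by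
    rw [← update_left]; congr 1; funext k; rcases k with k | k | k <;> rfl
  have ho : (Function.update (fun _ => []) (.inr (.inl N.k₁)) z : ∀ k, List (Alph M N k)) =
      stk M N (fun _ => []) (Function.update (fun _ => []) N.k₁ z) [] := by
    rw [← update_right]; congr 1; funext k; rcases k with k | k | k <;> rfl
  have hn : (Function.update (fun _ => []) N.k₀ (List.map inp.symm []) : ∀ k, List (N.Γ k)) =
      fun _ => [] := by
    funext k
    by_cases h : k = N.k₀
    · subst h; simp
    · simp [h]
  rw [hn] at e₄
  have hx := (initList_eq (machine M N out inp) x).trans (congrArg (TM2.Cfg.mk _ _) hi)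
  have hz := (haltList_eq (machine M N out inp) z).trans (congrArg (TM2.Cfg.mk _ _) ho)
  refine (congrArg₂ (StepsTo (machine M N out inp).step _) hx hz).mpr ?_
  have h := ((e₁.trans e₃).trans e₄).trans e₂
  have hn : m + (y.length + 1) + ((y.reverse ++ []).length + 1) + n = m + 2 * y.length + 2 + n := by
    simp only [List.append_nil, List.length_reverse]
    ring
  exact hn ▸ h

end CompMachine

/-! ### Output lengths and transitivity of reductions -/

/-- The number of push instructions in a statement. -/
def pushCount {K : Type} {Γ : K → Type} {Λ σ : Type} : TM2.Stmt Γ Λ σ → ℕ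
  | .push _ _ q => pushCount q + 1
  | .peek _ _ q => pushCount q
  | .pop _ _ q => pushCount q
  | .load _ q => pushCount q
  | .branch _ q r => pushCount q + pushCount r
  | .goto _ => 0
  | .halt => 0

theorem length_stepAux_le {K : Type} [DecidableEq K] {Γ : K → Type} {Λ σ : Type}
    (q : TM2.Stmt Γ Λ σ) (v : σ) (S : ∀ k, List (Γ k)) (k : K) :
    ((TM2.stepAux q v S).stk k).length ≤ (S k).length + pushCount q := by
  induction q generalizing v S with
  | push j f q ih =>
    refine (ih _ _).trans ?_
    by_cases h : k = j
    · subst h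
      simp only [Function.update_self, List.length_cons, pushCount]
      omega
    · simp only [ne_eq, h, not_false_eq_true, Function.update_of_ne, pushCount]
      omega
  | peek j f q ih => exact ih _ _
  | pop j f q ih =>
    refine (ih _ _).trans ?_
    by_cases h : k = j
    · subst h; simp [pushCount]
    · simp [pushCount, h]
  | load f q ih => exact ih _ _
  | branch f q r ih₁ ih₂ =>
    simp only [TM2.stepAux, pushCount]
    cases f v
    · exact (ih₂ _ _).trans (by omega)
    · exact (ih₁ _ _).trans (by omega)
  | goto f => simp [pushCount]
  | halt => simp [pushCount]

/-- A step executes a single statement, and a statement pushes only boundedly often. The sum over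
all labels bounds every one of them. -/
theorem exists_length_le (M : FinTM2) : ∃ C : ℕ, ∀ (n : ℕ) (a b : M.Cfg), StepsTo M.step n a b →
    ∀ k, (b.stk k).length ≤ (a.stk k).length + C * n := by
  let _ := M.ΛFin
  refine ⟨∑ l, pushCount (M.m l), fun n a b h k => ?_⟩
  induction h with
  | refl => simp
  | @head n a b c h _ ih =>
    obtain ⟨_ | l, v, S⟩ := a
    · cases h
    · obtain rfl := Option.some.inj h
      have h₁ := length_stepAux_le (M.m l) v S k
      have h₂ := Finset.single_le_sum (f := fun l => pushCount (M.m l)) (fun _ _ => Nat.zero_le _)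
        (Finset.mem_univ l)
      rw [mul_add_one]
      dsimp only at h₂ ih ⊢
      omega

theorem exists_length_output_le (M : FinTM2) : ∃ C : ℕ, ∀ (n : ℕ) (x : List (M.Γ M.k₀))
    (y : List (M.Γ M.k₁)), StepsTo M.step n (initList M x) (haltList M y) →
      y.length ≤ x.length + C * n := by
  obtain ⟨C, hC⟩ := exists_length_le M
  refine ⟨C, fun n x y h => ?_⟩
  rw [initList_eq, haltList_eq] at h
  have h₁ := hC _ _ _ h M.k₁
  have h₂ : ((Function.update (fun _ => []) M.k₀ x : ∀ k, List (M.Γ k)) M.k₁).length ≤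
      x.length := by
    by_cases hk : M.k₁ = M.k₀
    -- The types of the stacks depend on the index, so the two stacks are identified by substitution
    -- rather than rewriting.
    · generalize M.k₁ = j at hk
      subst hk
      simp
    · simp [hk]
  simp only [Function.update_self] at h₁
  omega

theorem polynomial_eval_mono (P : Polynomial ℕ) {a b : ℕ} (h : a ≤ b) : P.eval a ≤ P.eval b := by
  rw [Polynomial.eval_eq_sum_range, Polynomial.eval_eq_sum_range]
  gcongr

/-- The second machine is measured on the output of the first, whose length is at most the input
length plus a constant times the running time. Polynomials over `ℕ` are monotone, so the two bounds
may be composed. -/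
theorem TM2ComputableInPolyTime.comp {α β γ : Type} {ea : α → List Bool} {eb : β → List Bool}
    {ec : γ → List Bool} {f : α → β} {g : β → γ} (h₁ : TM2ComputableInPolyTime ea eb f)
    (h₂ : TM2ComputableInPolyTime eb ec g) :
    Nonempty (TM2ComputableInPolyTime ea ec (g ∘ f)) := by
  obtain ⟨⟨M, i₁, o₁⟩, t₁, r₁⟩ := h₁
  obtain ⟨⟨N, i₂, o₂⟩, t₂, r₂⟩ := h₂
  obtain ⟨C, hC⟩ := exists_length_output_le M
  let L : Polynomial ℕ := Polynomial.X + Polynomial.C C * t₁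
  refine ⟨⟨⟨CompMachine.machine M N o₁ i₂, i₁, o₂⟩, t₁ + 2 * L + 2 + t₂.comp L, fun a => ?_⟩⟩
  have s₁ := StepsTo.iff_iterate.2 (r₁ a).evals_in_steps
  have s₂ := StepsTo.iff_iterate.2 (r₂ (f a)).evals_in_steps
  have hlen : (eb (f a)).length ≤ L.eval (ea a).length := by
    have h := hC _ _ _ s₁
    have h'' := Nat.mul_le_mul_left C (r₁ a).steps_le_m
    simp only [List.length_map] at h
    simp only [L, Polynomial.eval_add, Polynomial.eval_mul, Polynomial.eval_X, Polynomial.eval_C]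
    omega
  refine (StepsTo.evalsToInTime (CompMachine.machine_outputs s₁ s₂) ?_).some
  have h₁ := (r₁ a).steps_le_m
  have h₂ := (r₂ (f a)).steps_le_m.trans (polynomial_eval_mono t₂ hlen)
  simp only [Polynomial.eval_add, Polynomial.eval_mul, Polynomial.eval_comp,
    Polynomial.eval_ofNat]
  omega

theorem PolyTimeReduces.trans {P Q R : DecisionProblem} (h₁ : PolyTimeReduces P Q)
    (h₂ : PolyTimeReduces Q R) : PolyTimeReduces P R := by
  obtain ⟨f, ⟨hf⟩, hf'⟩ := h₁
  obtain ⟨g, ⟨hg⟩, hg'⟩ := h₂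
  exact ⟨g ∘ f, TM2ComputableInPolyTime.comp hf hg, fun x => (hf' x).trans (hg' _)⟩

/-! ### A structured language for stack machines -/

/-- Structured programs over registers that hold bit strings. -/
inductive Prog
  | skip : Prog
  | push (k : ℕ) (b : Bool) : Prog
  | pop (k : ℕ) : Prog
  | seq (p q : Prog) : Prog
  /-- Three cases: the top of `k` is `true`, it is `false`, or `k` is empty. -/
  | case (k : ℕ) (p q r : Prog) : Prog
  /-- Repeat as long as `k` is not empty. -/
  | loop (k : ℕ) (p : Prog) : Prog

/-- The contents of the registers. -/
abbrev Store : Type := ℕ → List Bool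

/-- `Runs p s t n`: the program `p` turns the store `s` into `t` in `n` steps. -/
inductive Runs : Prog → Store → Store → ℕ → Prop
  | skip (s : Store) : Runs .skip s s 1
  | push (k : ℕ) (b : Bool) (s : Store) :
      Runs (.push k b) s (Function.update s k (b :: s k)) 1
  | pop (k : ℕ) (s : Store) : Runs (.pop k) s (Function.update s k (s k).tail) 1
  | seq {p q : Prog} {s t u : Store} {m n : ℕ} :
      Runs p s t m → Runs q t u n → Runs (.seq p q) s u (m + n)
  | case_true {k : ℕ} {p q r : Prog} {s t : Store} {n : ℕ} :
      (s k).head? = some true → Runs p s t n → Runs (.case k p q r) s t (n + 1)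
  | case_false {k : ℕ} {p q r : Prog} {s t : Store} {n : ℕ} :
      (s k).head? = some false → Runs q s t n → Runs (.case k p q r) s t (n + 1)
  | case_nil {k : ℕ} {p q r : Prog} {s t : Store} {n : ℕ} :
      s k = [] → Runs r s t n → Runs (.case k p q r) s t (n + 1)
  | loop_nil {k : ℕ} {p : Prog} {s : Store} : s k = [] → Runs (.loop k p) s s 1
  | loop_cons {k : ℕ} {p : Prog} {s t u : Store} {m n : ℕ} :
      s k ≠ [] → Runs p s t m → Runs (.loop k p) t u n → Runs (.loop k p) s u (m + n + 1)

namespace Prog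

/-- The largest register that occurs in a program. -/
def maxReg : Prog → ℕ
  | skip => 0
  | push k _ => k
  | pop k => k
  | seq p q => max p.maxReg q.maxReg
  | case k p q r => max k (max p.maxReg (max q.maxReg r.maxReg))
  | loop k p => max k p.maxReg

/-- The control points of a program. -/
def Lab : Prog → Type
  | skip => Unit
  | push _ _ => Unit
  | pop _ => Unit
  | seq p q => p.Lab ⊕ q.Lab
  | case _ p q r => Option (p.Lab ⊕ (q.Lab ⊕ r.Lab))
  | loop _ p => Option p.Lab

/-- A program has finitely many control points. -/
instance labFintype : ∀ p : Prog, Fintype p.Lab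
  | skip => inferInstanceAs (Fintype Unit)
  | push _ _ => inferInstanceAs (Fintype Unit)
  | pop _ => inferInstanceAs (Fintype Unit)
  | seq p q =>
    letI := labFintype p
    letI := labFintype q
    inferInstanceAs (Fintype (p.Lab ⊕ q.Lab))
  | case _ p q r =>
    letI := labFintype p
    letI := labFintype q
    letI := labFintype r
    inferInstanceAs (Fintype (Option (p.Lab ⊕ (q.Lab ⊕ r.Lab))))
  | loop _ p =>
    letI := labFintype p
    inferInstanceAs (Fintype (Option p.Lab))

/-- The first control point. -/
def entry : ∀ p : Prog, p.Lab
  | skip => ()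
  | push _ _ => ()
  | pop _ => ()
  | seq p _ => .inl p.entry
  | case _ _ _ _ => none
  | loop _ _ => none

/-- The stack of the machine that holds register `k`. -/
def reg (N k : ℕ) : Fin (N + 1) := Fin.ofNat (N + 1) k

/-- Statements of the machine that runs a program. -/
abbrev MStmt (N : ℕ) (Λ : Type) : Type :=
  TM2.Stmt (fun _ : Fin (N + 1) => Bool) Λ (Option Bool)

/-- The statement at a control point of a program whose control points are renamed by `e` and
that continues at `x` when it is finished. -/
def stmt (N : ℕ) {Λ : Type} : ∀ (p : Prog) (_ : p.Lab → Λ) (_ : Λ) (_ : p.Lab), MStmt N Λ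
  | skip, _, x, _ => .goto fun _ => x
  | push k b, _, x, _ => .push (reg N k) (fun _ => b) <| .goto fun _ => x
  | pop k, _, x, _ => .pop (reg N k) (fun v _ => v) <| .goto fun _ => x
  | seq p q, e, _, .inl l => p.stmt N (fun l => e (.inl l)) (e (.inr q.entry)) l
  | seq _ q, e, x, .inr l => q.stmt N (fun l => e (.inr l)) x l
  | case k p q r, e, _, none =>
    .peek (reg N k) (fun _ v => v) <|
      .branch (fun v => v == some true)
        (.load (fun _ => none) <| .goto fun _ => e (some (.inl p.entry)))
        (.branch (fun v => v == some false)
          (.load (fun _ => none) <| .goto fun _ => e (some (.inr (.inl q.entry))))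
          -- No reset is needed here: the two failed tests leave only the state `none`.
          (.goto fun _ => e (some (.inr (.inr r.entry)))))
  | case _ p _ _, e, x, some (.inl l) => p.stmt N (fun l => e (some (.inl l))) x l
  | case _ _ q _, e, x, some (.inr (.inl l)) => q.stmt N (fun l => e (some (.inr (.inl l)))) x l
  | case _ _ _ r, e, x, some (.inr (.inr l)) => r.stmt N (fun l => e (some (.inr (.inr l)))) x l
  | loop k p, e, x, none =>
    .peek (reg N k) (fun _ v => v) <|
      .branch (fun v => v.isSome)
        (.load (fun _ => none) <| .goto fun _ => e (some p.entry))
        (.goto fun _ => x)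
  | loop _ p, e, _, some l => p.stmt N (fun l => e (some l)) (e none) l

end Prog

/-! ### Compiling structured programs to stack machines -/

/-- The first registers of a store, as the stacks of a machine. -/
def Store.restrict (N : ℕ) (s : Store) : Fin (N + 1) → List Bool := fun k => s k

theorem Store.restrict_reg {N k : ℕ} (h : k ≤ N) (s : Store) :
    s.restrict N (Prog.reg N k) = s k := by
  simp [Store.restrict, Prog.reg, Nat.mod_eq_of_lt (Nat.lt_succ_of_le h)]

theorem Store.update_restrict {N k : ℕ} (h : k ≤ N) (s : Store) (x : List Bool) :
    Function.update (s.restrict N) (Prog.reg N k) x =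
      Store.restrict N (Function.update s k x) := by
  funext j
  by_cases hj : (j : ℕ) = k
  · have : j = Prog.reg N k := by
      ext
      simp [hj, Prog.reg, Nat.mod_eq_of_lt (Nat.lt_succ_of_le h)]
    subst this
    rw [Function.update_self, Store.restrict, hj, Function.update_self]
  · have : j ≠ Prog.reg N k := by
      rintro rfl
      simp [Prog.reg, Nat.mod_eq_of_lt (Nat.lt_succ_of_le h)] at hj
    rw [Function.update_of_ne this, Store.restrict, Store.restrict, Function.update_of_ne hj]

/-- Induction on the run, with the continuation and the renaming of control points left free. The
invariant is that the internal state is `none` on entering and on leaving a program; the body of a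
loop has the loop head as its continuation. -/
theorem Runs.stepsTo {N : ℕ} {Λ : Type} {M : Λ → Prog.MStmt N Λ} {p : Prog} {s t : Store} {n : ℕ}
    (h : Runs p s t n) (hp : p.maxReg ≤ N) (e : p.Lab → Λ) (x : Λ)
    (hM : ∀ l, M (e l) = p.stmt N e x l) :
    StepsTo (TM2.step M) n ⟨some (e p.entry), none, s.restrict N⟩ ⟨some x, none, t.restrict N⟩ := by
  induction h generalizing x with
  | skip s => exact .single (by simp [hM, Prog.stmt])
  | push k b s =>
    have hk : k ≤ N := hp
    refine .single ?_
    simp only [TM2.step, hM, Prog.stmt, TM2.stepAux]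
    rw [Store.update_restrict hk, Store.restrict_reg hk]
  | pop k s =>
    have hk : k ≤ N := hp
    refine .single ?_
    simp only [TM2.step, hM, Prog.stmt, TM2.stepAux]
    rw [Store.update_restrict hk, Store.restrict_reg hk]
  | seq _ _ ih₁ ih₂ =>
    simp only [Prog.maxReg, max_le_iff] at hp
    exact (ih₁ hp.1 _ _ fun l => hM (.inl l)).trans (ih₂ hp.2 _ _ fun l => hM (.inr l))
  | case_true hk _ ih =>
    simp only [Prog.maxReg, max_le_iff] at hp
    refine .head ?_ (ih hp.2.1 _ _ fun l => hM (some (.inl l)))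
    rw [TM2.step, hM]
    simp [Prog.entry, Prog.stmt, Store.restrict_reg hp.1, hk]
  | case_false hk _ ih =>
    simp only [Prog.maxReg, max_le_iff] at hp
    refine .head ?_ (ih hp.2.2.1 _ _ fun l => hM (some (.inr (.inl l))))
    rw [TM2.step, hM]
    simp [Prog.entry, Prog.stmt, Store.restrict_reg hp.1, hk]
  | case_nil hk _ ih =>
    simp only [Prog.maxReg, max_le_iff] at hp
    refine .head ?_ (ih hp.2.2.2 _ _ fun l => hM (some (.inr (.inr l))))
    rw [TM2.step, hM]
    simp [Prog.entry, Prog.stmt, Store.restrict_reg hp.1, hk]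
  | loop_nil hk =>
    simp only [Prog.maxReg, max_le_iff] at hp
    refine .single ?_
    rw [TM2.step, hM]
    simp [Prog.entry, Prog.stmt, Store.restrict_reg hp.1, hk]
  | @loop_cons k p s t u m n hk _ _ ih₁ ih₂ =>
    have hp' := hp
    simp only [Prog.maxReg, max_le_iff] at hp
    refine .head ?_ ((ih₁ hp.2 _ _ fun l => hM (some l)).trans (ih₂ hp' _ _ hM))
    obtain ⟨b, l, hb⟩ := List.exists_cons_of_ne_nil hk
    rw [TM2.step, hM]
    simp [Prog.entry, Prog.stmt, Store.restrict_reg hp.1, hb]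

/-- The machine that runs a program and halts; register `0` holds the input and register `1` the
output. -/
def Prog.machine (p : Prog) : FinTM2 where
  -- One stack beyond the largest register, so that stacks `0` and `1` are distinct even if only
  -- register `0` occurs.
  K := Fin (p.maxReg + 1 + 1)
  k₀ := 0
  k₁ := 1
  Γ _ := Bool
  Λ := Option p.Lab
  main := some p.entry
  σ := Option Bool
  initialState := none
  Γk₀Fin := inferInstanceAs (Fintype Bool)
  m l := l.elim .halt (p.stmt (p.maxReg + 1) some none)

theorem Prog.machine_outputs {p : Prog} {x y : List Bool} {n : ℕ}
    (h : Runs p (Function.update (fun _ => []) 0 x) (Function.update (fun _ => []) 1 y) n) :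
    StepsTo p.machine.step (n + 1) (initList p.machine x) (haltList p.machine y) := by
  have h₁ := Runs.stepsTo (M := p.machine.m) h (Nat.le_succ _) some none fun _ => rfl
  rw [← Store.update_restrict (by omega), ← Store.update_restrict (by omega)] at h₁
  refine (congrArg₂ (StepsTo p.machine.step _) (initList_eq p.machine x)
    (haltList_eq p.machine y)).mpr (h₁.tail ?_)
  rfl

theorem Prog.computableInPolyTime {α β : Type} {ea : α → List Bool} {eb : β → List Bool}
    {f : α → β} (p : Prog) (T : Polynomial ℕ)
    (h : ∀ a, ∃ n ≤ T.eval (ea a).length, Runs p (Function.update (fun _ => []) 0 (ea a))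
      (Function.update (fun _ => []) 1 (eb (f a))) n) :
    Nonempty (TM2ComputableInPolyTime ea eb f) := by
  refine ⟨⟨⟨p.machine, Equiv.refl _, Equiv.refl _⟩, T + 1, fun a => ?_⟩⟩
  refine Nonempty.some ?_
  obtain ⟨n, hn, hr⟩ := h a
  have := (Prog.machine_outputs hr).evalsToInTime (m := (T + 1).eval (ea a).length) (by simpa)
  change Nonempty (TM2OutputsInTime p.machine ((ea a).map id) (some ((eb (f a)).map id)) _)
  exact (congrArg₂ (fun x y => Nonempty (TM2OutputsInTime p.machine x (some y) _))
    (List.map_id (ea a)) (List.map_id (eb (f a)))).mpr this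

/-! ### Running programs within a time bound -/

/-- `RunsIn p s t N`: the program `p` turns the store `s` into `t` in at most `N` steps. -/
def RunsIn (p : Prog) (s t : Store) (N : ℕ) : Prop := ∃ n ≤ N, Runs p s t n

namespace RunsIn

theorem mono {p : Prog} {s t : Store} {M N : ℕ} (h : RunsIn p s t M) (hMN : M ≤ N) :
    RunsIn p s t N := let ⟨n, hn, hr⟩ := h; ⟨n, hn.trans hMN, hr⟩

theorem skip (s : Store) : RunsIn .skip s s 1 := ⟨1, le_rfl, .skip s⟩

theorem seq {p q : Prog} {s t u : Store} {M N : ℕ} (h₁ : RunsIn p s t M) (h₂ : RunsIn q t u N) :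
    RunsIn (.seq p q) s u (M + N) :=
  let ⟨m, hm, hp⟩ := h₁
  let ⟨n, hn, hq⟩ := h₂
  ⟨m + n, add_le_add hm hn, hp.seq hq⟩

theorem case_true {k : ℕ} {p q r : Prog} {s t : Store} {N : ℕ} (hk : (s k).head? = some true)
    (h : RunsIn p s t N) : RunsIn (.case k p q r) s t (N + 1) :=
  let ⟨n, hn, hp⟩ := h; ⟨n + 1, by omega, .case_true hk hp⟩

theorem case_false {k : ℕ} {p q r : Prog} {s t : Store} {N : ℕ} (hk : (s k).head? = some false)
    (h : RunsIn q s t N) : RunsIn (.case k p q r) s t (N + 1) :=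
  let ⟨n, hn, hp⟩ := h; ⟨n + 1, by omega, .case_false hk hp⟩

theorem case_nil {k : ℕ} {p q r : Prog} {s t : Store} {N : ℕ} (hk : s k = [])
    (h : RunsIn r s t N) : RunsIn (.case k p q r) s t (N + 1) :=
  let ⟨n, hn, hp⟩ := h; ⟨n + 1, by omega, .case_nil hk hp⟩

/-- The trajectory `S` of stores is supplied in advance. A pass costs the body and one test, and the
last test finds the register empty. -/
theorem loop {k : ℕ} {p : Prog} {c : ℕ} (S : ℕ → Store) (n : ℕ)
    (h : ∀ i < n, S i k ≠ [] ∧ RunsIn p (S i) (S (i + 1)) c) (hn : S n k = []) :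
    RunsIn (.loop k p) (S 0) (S n) (n * (c + 1) + 1) := by
  induction n generalizing S with
  | zero => exact ⟨1, by omega, .loop_nil hn⟩
  | succ n ih =>
    obtain ⟨m, hm, h₁⟩ := ih (fun i => S (i + 1)) (fun i hi => h (i + 1) (by omega)) hn
    obtain ⟨h0, l, hl, h₂⟩ := h 0 (by omega)
    exact ⟨l + m + 1, by rw [add_mul]; omega, .loop_cons h0 h₂ h₁⟩

end RunsIn

/-- A step lengthens a register by at most one symbol. This later bounds the printed word by the
time spent on printing it. -/
theorem Runs.length_le {p : Prog} {s t : Store} {n : ℕ} (h : Runs p s t n) (k : ℕ) :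
    (t k).length ≤ (s k).length + n := by
  induction h with
  | skip => omega
  | push j b s =>
    by_cases h : k = j
    · subst h; simp
    · simp [h]
  | pop j s =>
    by_cases h : k = j
    · subst h; simp; omega
    · simp [h]
  | seq | case_true | case_false | case_nil | loop_nil | loop_cons => omega

/-- Move the top element of `x` to `y`. -/
def moveOne (x y : ℕ) : Prog :=
  .case x (.seq (.pop x) (.push y true)) (.seq (.pop x) (.push y false)) .skip

theorem runs_moveOne {x y : ℕ} (hxy : y ≠ x) (s : Store) {b : Bool} {l : List Bool}
    (h : s x = b :: l) : RunsIn (moveOne x y) s (update (update s x l) y (b :: s y)) 3 := by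
  have hr : ∀ c, RunsIn (.seq (.pop x) (.push y c)) s (update (update s x l) y (c :: s y)) 2 := by
    intro c
    refine ⟨2, le_rfl, ?_⟩
    have h₁ := Runs.pop x s
    have h₂ := Runs.push y c (update s x l)
    rw [h, List.tail_cons] at h₁
    rw [update_of_ne hxy] at h₂
    exact h₁.seq h₂
  cases b
  · exact .case_false (by simp [h]) (hr false)
  · exact .case_true (by simp [h]) (hr true)

/-- Move the contents of `x` to `y`, which reverses them. -/
abbrev moveAll (x y : ℕ) : Prog := .loop x (moveOne x y)

theorem runs_moveAll {x y : ℕ} (hxy : y ≠ x) (s : Store) {l : List Bool} (h : s x = l) :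
    RunsIn (moveAll x y) s (update (update s x []) y (l.reverse ++ s y)) (l.length * 4 + 1) := by
  induction l generalizing s with
  | nil =>
    refine ⟨1, by omega, ?_⟩
    have hs : update (update s x []) y ([].reverse ++ s y) = s := by
      rw [← h, update_eq_self, h, List.reverse_nil, List.nil_append, update_eq_self]
    exact hs.symm ▸ Runs.loop_nil h
  | cons b l ih =>
    obtain ⟨m, hm, h₁⟩ := runs_moveOne hxy s h
    obtain ⟨n, hn, h₂⟩ := ih (update (update s x l) y (b :: s y)) (by simp [hxy.symm])
    refine ⟨m + n + 1, by simp only [List.length_cons]; omega, ?_⟩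
    refine .loop_cons (by simp [h]) h₁ ?_
    convert h₂ using 1
    funext j
    simp only [update_apply]
    split_ifs <;> simp_all

/-- Empty the register `x`. -/
abbrev clear (x : ℕ) : Prog := .loop x (.pop x)

theorem runs_clear {x : ℕ} (s : Store) {l : List Bool} (h : s x = l) :
    RunsIn (clear x) s (update s x []) (l.length * 2 + 1) := by
  induction l generalizing s with
  | nil =>
    refine ⟨1, by omega, ?_⟩
    have hs : update s x [] = s := by simp [← h]
    exact hs.symm ▸ Runs.loop_nil h
  | cons b l ih =>
    obtain ⟨n, hn, h₂⟩ := ih (update s x l) (by simp)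
    refine ⟨1 + n + 1, by simp only [List.length_cons]; omega, ?_⟩
    have h₁ := Runs.pop x s
    rw [h, List.tail_cons] at h₁
    refine .loop_cons (by simp [h]) h₁ ?_
    simpa using h₂

/-! ### Stores with counters -/

/-- The store with input word `w`, auxiliary word `a`, output word `o`, and counters `s` held in
unary by the other registers. -/
def st (w a o : List Bool) (s : ℕ → ℕ) : Store
  | 0 => w
  | 1 => a
  | 2 => o
  | n + 3 => List.replicate (s n) true

section

variable (w a o x : List Bool) (s : ℕ → ℕ) (r n : ℕ)

theorem update_st_word : update (st w a o s) 0 x = st x a o s := by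
  funext j
  rcases j with _ | _ | _ | j <;> rfl

theorem update_st_aux : update (st w a o s) 1 x = st w x o s := by
  funext j
  rcases j with _ | _ | _ | j <;> rfl

theorem update_st_out : update (st w a o s) 2 x = st w a x s := by
  funext j
  rcases j with _ | _ | _ | j <;> rfl

theorem update_st_counter :
    update (st w a o s) (r + 3) (List.replicate n true) = st w a o (update s r n) := by
  funext j
  rcases j with _ | _ | _ | j
  · rfl
  · rfl
  · rfl
  · by_cases h : j = r
    · subst h; simp [st]
    · simp [st, h]

/-- Increment a counter. -/
def inc (r : ℕ) : Prog := .push (r + 3) true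

/-- Decrement a counter. -/
def dec (r : ℕ) : Prog := .pop (r + 3)

variable {s r}

theorem runs_inc {s' : ℕ → ℕ} (h : s' = update s r (s r + 1)) :
    RunsIn (inc r) (st w a o s) (st w a o s') 1 := by
  subst h
  refine ⟨1, le_rfl, ?_⟩
  rw [← update_st_counter, List.replicate_succ]
  exact .push _ _ _

theorem runs_dec {s' : ℕ → ℕ} (h : s' = update s r (s r - 1)) :
    RunsIn (dec r) (st w a o s) (st w a o s') 1 := by
  subst h
  refine ⟨1, le_rfl, ?_⟩
  rw [← update_st_counter, ← List.tail_replicate]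
  exact .pop _ _

theorem runs_clear_counter {s' : ℕ → ℕ} (h : s' = update s r 0) :
    RunsIn (clear (r + 3)) (st w a o s) (st w a o s') (s r * 2 + 1) := by
  subst h
  have := runs_clear (x := r + 3) (st w a o s) rfl
  rw [← List.replicate_zero (a := true), update_st_counter] at this
  exact this.mono (by simp [st])

/-- Repeat a program as often as the counter `r` says, decrementing it to zero. -/
abbrev repeatCounter (r : ℕ) (p : Prog) : Prog := .loop (r + 3) (.seq (dec r) p)

/-- The counter `r` is decremented before the body runs, so the body sees `n - (i + 1)` in it and
must leave it so. Besides the body, a pass costs one test and one decrement. -/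
theorem runs_repeatCounter {p : Prog} {c : ℕ} (W A O : ℕ → List Bool) (S : ℕ → ℕ → ℕ)
    (hr : ∀ i ≤ n, S i r = n - i)
    (h : ∀ i < n, RunsIn p (st (W i) (A i) (O i) (update (S i) r (n - (i + 1))))
      (st (W (i + 1)) (A (i + 1)) (O (i + 1)) (S (i + 1))) c) :
    RunsIn (repeatCounter r p) (st (W 0) (A 0) (O 0) (S 0)) (st (W n) (A n) (O n) (S n))
      (n * (c + 2) + 1) := by
  refine (RunsIn.loop (c := c + 1) (fun i => st (W i) (A i) (O i) (S i)) n (fun i hi => ⟨?_, ?_⟩)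
    ?_).mono le_rfl
  · simp [st, hr i hi.le]
    omega
  · refine ((runs_dec _ _ _ ?_).seq (h i hi)).mono (by omega)
    rw [hr i hi.le]
    rfl
  · simp [st, hr]

/-- Add the counter `x` to `y`, clearing `x`. -/
abbrev addInto (x y : ℕ) : Prog := repeatCounter x (inc y)

theorem runs_addInto {x y : ℕ} (hxy : y ≠ x) {s' : ℕ → ℕ}
    (h : s' = update (update s x 0) y (s y + s x)) :
    RunsIn (addInto x y) (st w a o s) (st w a o s') (s x * 3 + 1) := by
  subst h
  have := runs_repeatCounter (r := x) (p := inc y) (c := 1) (s x) (fun _ => w) (fun _ => a)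
    (fun _ => o) (fun i => update (update s x (s x - i)) y (s y + i))
    (fun i _ => by simp [hxy.symm]) (fun i _ => runs_inc _ _ _ (by
      funext j
      simp only [update_apply]
      split_ifs <;> simp_all; omega))
  simpa using this

/-- Copy the counter `x` to `y`, with the help of `z`. -/
abbrev copyTo (x y z : ℕ) : Prog :=
  .seq (repeatCounter x (.seq (inc y) (inc z))) (addInto z x)

/-- Reading a counter destroys it: `x` is drained into `y` and `z` at once, then `z` is poured back
into `x`. -/
theorem runs_copyTo {x y z : ℕ} (hxy : y ≠ x) (hxz : z ≠ x) (hyz : z ≠ y) (hy : s y = 0)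
    (hz : s z = 0) :
    RunsIn (copyTo x y z) (st w a o s) (st w a o (update s y (s x))) (s x * 7 + 2) := by
  have h₁ := runs_repeatCounter (r := x) (p := .seq (inc y) (inc z)) (c := 2) (s x) (fun _ => w)
    (fun _ => a) (fun _ => o) (fun i => update (update (update s x (s x - i)) y i) z i)
    (fun i _ => by simp [hxy.symm, hxz.symm]) (fun i _ =>
      (runs_inc _ _ _ rfl).seq (runs_inc _ _ _ (by
      funext j
      simp only [update_apply]
      split_ifs <;> simp_all)))
  have h₂ := runs_addInto w a o hxz.symm (s := update (update (update s x (s x - s x)) y (s x)) z (s x)) (s' := update s y (s x)) (by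
    funext j
    simp only [update_apply]
    split_ifs <;> simp_all)
  have h₀ : update (update (update s x (s x - 0)) y 0) z 0 = s := by
    funext j
    simp only [update_apply]
    split_ifs <;> simp_all
  rw [h₀] at h₁
  refine (h₁.seq h₂).mono ?_
  simp
  omega

end


/-! ### Polynomially bounded functions -/

/-- Environments: an input word and numerical variables, the variable bound last being number
`0`. -/
structure Env where
  /-- The input word. -/
  word : List Bool
  /-- The values of the variables. -/
  val : ℕ → ℕ

namespace Env

/-- Bind a new variable. -/
def cons (x : ℕ) (e : Env) : Env := ⟨e.word, fun n => Nat.casesOn n x e.val⟩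

/-- Rename the variables. -/
def ren (r : ℕ → ℕ) (e : Env) : Env := ⟨e.word, fun n => e.val (r n)⟩

/-- The word and all variables are bounded by `M`. -/
def Le (e : Env) (M : ℕ) : Prop := e.word.length ≤ M ∧ ∀ i, e.val i ≤ M

end Env

/-- Functions of the environment bounded by a polynomial in the environment. -/
def PB (f : Env → ℕ) : Prop := ∃ P : Polynomial ℕ, ∀ e M, e.Le M → f e ≤ P.eval M

/-- Functions built from the input word by composition and by iterations with polynomially
bounded intermediate results. -/
inductive PF : (Env → ℕ) → Prop
  | var (i : ℕ) : PF fun e => e.val i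
  | zero : PF fun _ => 0
  | succ {f : Env → ℕ} : PF f → PF fun e => f e + 1
  | length : PF fun e => e.word.length
  | bit {f : Env → ℕ} : PF f → PF fun e => (e.word[f e]?.getD false).toNat
  | ren (r : ℕ → ℕ) {f : Env → ℕ} : PF f → PF fun e => f (e.ren r)
  /-- In the step of an iteration, variable `0` is the value so far and variable `1` the
  number of steps done. -/
  | iter {t a f g : Env → ℕ} : PF t → PF a → PF f → PB g →
      (∀ e, ∀ i ≤ t e, Nat.rec (a e) (fun i y => f ((e.cons i).cons y)) i ≤ g e) →
      PF fun e => Nat.rec (a e) (fun i y => f ((e.cons i).cons y)) (t e)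

/-- Only iteration could grow faster than a polynomial, and its constructor carries a bound. -/
theorem PF.bounded {f : Env → ℕ} (h : PF f) : PB f := by
  induction h with
  | var i => exact ⟨.X, fun e M h => by simpa using h.2 i⟩
  | zero => exact ⟨0, fun _ _ _ => Nat.zero_le _⟩
  | succ _ ih =>
    obtain ⟨P, hP⟩ := ih
    exact ⟨P + 1, fun e M h => by simpa using hP e M h⟩
  | length => exact ⟨.X, fun e M h => by simpa using h.1⟩
  | bit _ _ => exact ⟨1, fun e M _ => by simpa using Bool.toNat_le _⟩
  | ren r _ ih =>
    obtain ⟨P, hP⟩ := ih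
    exact ⟨P, fun e M h => hP _ M ⟨h.1, fun i => h.2 _⟩⟩
  | iter _ _ _ hg hb _ _ _ =>
    obtain ⟨P, hP⟩ := hg
    exact ⟨P, fun e M h => (hb e _ le_rfl).trans (hP e M h)⟩

/-! ### Programs for polynomially bounded functions -/

/-- The function `f` is computed by programs in polynomial time: for every number `m` of
counters in use and every assignment `ρ` of counters in use to the variables, some program
stores the value of `f` in counter `m`, and changes nothing else. -/
def Computed (f : Env → ℕ) : Prop :=
  ∀ (m : ℕ) (ρ : ℕ → ℕ), (∀ i, ρ i < m) → ∃ (p : Prog) (T : Polynomial ℕ),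
    ∀ (w o : List Bool) (s : ℕ → ℕ) (M : ℕ), w.length ≤ M → (∀ i, s i ≤ M) →
      (∀ i, m ≤ i → s i = 0) →
      RunsIn p (st w [] o s) (st w [] o (update s m (f ⟨w, fun n => s (ρ n)⟩))) (T.eval M)

theorem Computed.var (i : ℕ) : Computed fun e => e.val i := by
  intro m ρ hρ
  refine ⟨copyTo (ρ i) m (m + 1), 7 * .X + 2, fun w o s M hw hM hs => ?_⟩
  have := hρ i
  refine (runs_copyTo w [] o (by omega) (by omega) (by omega) (hs _ le_rfl) (hs _ (by omega))).mono
    ?_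
  have := hM (ρ i)
  simp
  omega

theorem Computed.zero : Computed fun _ => 0 := by
  intro m ρ _
  refine ⟨.skip, 1, fun w o s M _ _ hs => ?_⟩
  rw [← hs m le_rfl, update_eq_self]
  simpa using RunsIn.skip _

theorem Computed.succ {f : Env → ℕ} (hf : Computed f) : Computed fun e => f e + 1 := by
  intro m ρ hρ
  obtain ⟨p, T, h⟩ := hf m ρ hρ
  refine ⟨.seq p (inc m), T + 1, fun w o s M hw hM hs => ?_⟩
  simpa using (h w o s M hw hM hs).seq (runs_inc _ _ _ (by simp))

theorem Computed.ren (r : ℕ → ℕ) {f : Env → ℕ} (hf : Computed f) :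
    Computed fun e => f (e.ren r) :=
  fun m ρ hρ => hf m (fun n => ρ (r n)) fun _ => hρ _

/-- Registers `0` and `1` act as a tape with its head at position `i`: the rest of the word ahead,
the part already read reversed behind. Beyond the end nothing moves, so every `i` is allowed. -/
theorem runs_advance (w o : List Bool) (s : ℕ → ℕ) (i : ℕ) :
    RunsIn (moveOne 0 1) (st (w.drop i) (w.take i).reverse o s)
      (st (w.drop (i + 1)) (w.take (i + 1)).reverse o s) 3 := by
  by_cases hi : i < w.length
  · have := runs_moveOne (x := 0) (y := 1) (by simp) (st (w.drop i) (w.take i).reverse o s)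
      (List.drop_eq_getElem_cons hi)
    rw [update_st_word, update_st_aux] at this
    convert this using 2
    rw [List.take_add_one, List.getElem?_eq_getElem hi]
    simp [st]
  · rw [List.drop_of_length_le (by omega), List.drop_of_length_le (by omega),
      List.take_of_length_le (by omega), List.take_of_length_le (by omega)]
    exact (RunsIn.case_nil rfl (RunsIn.skip _)).mono (by omega)

theorem runs_rewind (w o : List Bool) (s : ℕ → ℕ) (i : ℕ) :
    RunsIn (moveAll 1 0) (st (w.drop i) (w.take i).reverse o s) (st w [] o s)
      (w.length * 4 + 1) := by
  have := runs_moveAll (x := 1) (y := 0) (by simp) (st (w.drop i) (w.take i).reverse o s) rfl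
  rw [update_st_aux, update_st_word] at this
  simp only [st, List.reverse_reverse, List.take_append_drop, List.length_reverse,
    List.length_take] at this
  exact this.mono (by omega)

theorem Computed.length : Computed fun e => e.word.length := by
  intro m ρ _
  refine ⟨.seq (.loop 0 (.seq (moveOne 0 1) (inc m))) (moveAll 1 0), 9 * .X + 2,
    fun w o s M hw hM hs => ?_⟩
  have h₁ := RunsIn.loop (k := 0) (p := .seq (moveOne 0 1) (inc m)) (c := 4)
    (fun i => st (w.drop i) (w.take i).reverse o (update s m i)) w.length
    (fun i hi => ⟨by simpa [st] using hi, (runs_advance _ _ _ _).seq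
      (runs_inc _ _ _ (by simp))⟩) (by simp [st])
  have h₂ := runs_rewind w o (update s m w.length) w.length
  have h₀ : update s m 0 = s := by rw [← hs m le_rfl, update_eq_self]
  rw [h₀] at h₁
  refine (h₁.seq h₂).mono ?_
  simp
  omega

/-- The head advances `f e` times while counter `m` runs down to zero; the bit under the head then
decides whether `m` is incremented. An exhausted word leaves `m` at zero, which is the default value
`false`. -/
theorem Computed.bit {f : Env → ℕ} (hf : Computed f) (hb : PB f) :
    Computed fun e => (e.word[f e]?.getD false).toNat := by
  intro m ρ hρ
  obtain ⟨p, T, h⟩ := hf m ρ hρ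
  obtain ⟨P, hP⟩ := hb
  refine ⟨.seq p (.seq (repeatCounter m (moveOne 0 1))
    (.seq (.case 0 (inc m) .skip .skip) (moveAll 1 0))), T + (5 * P + 1 + (2 + (4 * .X + 1))),
    fun w o s M hw hM hs => ?_⟩
  have hle := hP ⟨w, fun n => s (ρ n)⟩ M ⟨hw, fun _ => hM _⟩
  have h₁ := h w o s M hw hM hs
  change RunsIn _ _ (st w [] o (update s m (w[f ⟨w, fun n => s (ρ n)⟩]?.getD false).toNat)) _
  generalize f ⟨w, fun n => s (ρ n)⟩ = n at h₁ hle
  have h₂ := runs_repeatCounter (r := m) (p := moveOne 0 1) (c := 3) n (fun i => w.drop i)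
    (fun i => (w.take i).reverse) (fun _ => o) (fun i => update s m (n - i)) (by simp)
    (fun i _ => by simpa using runs_advance w o (update s m (n - (i + 1))) i)
  have h₃ : RunsIn (.case 0 (inc m) .skip .skip)
      (st (w.drop n) (w.take n).reverse o (update s m (n - n)))
      (st (w.drop n) (w.take n).reverse o (update s m (w[n]?.getD false).toNat)) 2 := by
    by_cases hn : n < w.length
    · rw [List.getElem?_eq_getElem hn]
      cases hw : w[n]
      · exact .case_false (by simp [st, hn, hw]) (by simpa using .skip _)
      · exact .case_true (by simp [st, hn, hw]) (runs_inc _ _ _ (by simp))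
    · refine .case_nil (by simpa [st] using hn) ?_
      rw [List.getElem?_eq_none (by omega)]
      simpa using .skip _
  have h₄ := runs_rewind w o (update s m (w[n]?.getD false).toNat) n
  refine (h₁.seq (RunsIn.seq (by simpa using h₂) (h₃.seq h₄))).mono ?_
  simp
  omega

/-- Counter `m` holds the remaining number of passes, `m + 1` the current value, `m + 2` the passes
done, and `m + 3` receives the next value. Counters are unary, so the bound on intermediate values
is exactly what makes each pass polynomial. -/
theorem Computed.iter {t a f g : Env → ℕ} (ht : Computed t) (ha : Computed a) (hf : Computed f)
    (tb : PB t) (gb : PB g)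
    (hg : ∀ e, ∀ i ≤ t e, Nat.rec (a e) (fun i y => f ((e.cons i).cons y)) i ≤ g e) :
    Computed fun e => Nat.rec (a e) (fun i y => f ((e.cons i).cons y)) (t e) := by
  intro m ρ hρ
  obtain ⟨p, Tp, hp⟩ := ht m ρ hρ
  obtain ⟨q, Tq, hq⟩ := ha (m + 1) ρ fun i => (hρ i).trans (by omega)
  let ρ' : ℕ → ℕ := fun n => Nat.casesOn n (m + 1) fun n => Nat.casesOn n (m + 2) ρ
  obtain ⟨r, Tr, hr⟩ := hf (m + 3) ρ' (by
    rintro (_ | _ | i)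
    · change m + 1 < m + 3
      omega
    · change m + 2 < m + 3
      omega
    · exact (hρ i).trans (by omega))
  obtain ⟨P, hP⟩ := tb
  obtain ⟨G, hG⟩ := gb
  let B : Polynomial ℕ := .X + P + G
  let body : Prog := .seq r (.seq (clear (m + 1 + 3)) (.seq (addInto (m + 3) (m + 1)) (inc (m + 2))))
  let Tb : Polynomial ℕ := Tr.comp B + ((2 * B + 1) + ((3 * B + 1) + 1))
  refine ⟨.seq p (.seq q (.seq (repeatCounter m body)
    (.seq (clear (m + 2 + 3)) (addInto (m + 1) m)))),
    Tp + (Tq.comp B + ((P * (Tb + 2) + 1) + ((2 * B + 1) + (3 * B + 1)))),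
    fun w o s M hw hM hs => ?_⟩
  let e : Env := ⟨w, fun n => s (ρ n)⟩
  let R : ℕ → ℕ := fun i => Nat.rec (a e) (fun i y => f ((e.cons i).cons y)) i
  let S : ℕ → ℕ → ℕ := fun i => update (update (update s m (t e - i)) (m + 1) (R i)) (m + 2) i
  have he : e.Le M := ⟨hw, fun _ => hM _⟩
  have hB : B.eval M = M + P.eval M + G.eval M := by simp [B]
  have htP : t e ≤ P.eval M := hP e M he
  have htB : t e ≤ B.eval M := by omega
  have hR : ∀ i ≤ t e, R i ≤ B.eval M := fun i hi => by
    have : R i ≤ G.eval M := (hg e i hi).trans (hG e M he)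
    omega
  have hMB : M ≤ B.eval M := by omega
  have hρm : ∀ n, ρ n ≠ m := fun n => (hρ n).ne
  have hρm1 : ∀ n, ρ n ≠ m + 1 := fun n => ((hρ n).trans (by omega)).ne
  have hρm2 : ∀ n, ρ n ≠ m + 2 := fun n => ((hρ n).trans (by omega)).ne
  have h₁ : RunsIn p (st w [] o s) (st w [] o (update s m (t e))) (Tp.eval M) := hp w o s M hw hM hs
  have h₂ : RunsIn q (st w [] o (update s m (t e))) (st w [] o (S 0)) (Tq.eval (B.eval M)) := by
    convert hq w o (update s m (t e)) (B.eval M) (hw.trans hMB) (fun i => ?_) (fun i hi => ?_)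
      using 2
    · have : (⟨w, fun n => update s m (t e) (ρ n)⟩ : Env) = e := by simp [hρm, e]
      rw [this]
      funext j
      have := hs j
      simp only [S, R, update_apply]
      split_ifs <;> first | rfl | omega
    · simp only [update_apply]
      split_ifs
      · exact htB
      · exact (hM i).trans hMB
    · rw [update_of_ne (by omega), hs i (by omega)]
  have hb : ∀ i < t e, RunsIn body (st w [] o (update (S i) m (t e - (i + 1))))
      (st w [] o (S (i + 1))) (Tb.eval M) := by
    intro i hi
    have k₁ := hr w o (update (S i) m (t e - (i + 1))) (B.eval M) (hw.trans hMB) (fun j => by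
      have h₁ := hR i hi.le
      have h₂ := hM j
      simp only [S, update_apply]
      split_ifs <;> omega) (fun j hj => by
      have := hs j
      simp only [S, update_apply]
      split_ifs <;> omega)
    have henv : (⟨w, fun n => update (S i) m (t e - (i + 1)) (ρ' n)⟩ : Env) =
        (e.cons i).cons (R i) := by
      refine congrArg (Env.mk w) (funext fun n => ?_)
      rcases n with _ | _ | n
      · change update (S i) m (t e - (i + 1)) (m + 1) = R i
        simp [S]
      · change update (S i) m (t e - (i + 1)) (m + 2) = i
        simp [S]
      · change update (S i) m (t e - (i + 1)) (ρ n) = s (ρ n)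
        simp [S, hρm, hρm1, hρm2]
    rw [henv] at k₁
    have hR' : f ((e.cons i).cons (R i)) = R (i + 1) := rfl
    rw [hR'] at k₁
    refine (k₁.seq ((runs_clear_counter _ _ _ rfl).seq ((runs_addInto _ _ _ (by omega) rfl).seq
      (runs_inc _ _ _ ?_)))).mono ?_
    · funext j
      have := hs j
      have := hs (m + 3)
      simp only [S, update_apply]
      split_ifs <;> omega
    · have k₂ := hR i hi.le
      have k₃ := hR (i + 1) hi
      simp [S, Tb]
      omega
  have h₃ := runs_repeatCounter (r := m) (t e) (fun _ => w) (fun _ => []) (fun _ => o) S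
    (fun i _ => by simp [S]) hb
  refine (h₁.seq (h₂.seq (h₃.seq ((runs_clear_counter _ _ _ rfl).seq
    (runs_addInto _ _ _ (by omega) ?_))))).mono ?_
  · change update s m (R (t e)) = _
    funext j
    have := hs j
    simp only [S, update_apply]
    split_ifs <;> omega
  · have k₁ := hR (t e) le_rfl
    have k₂ : t e * (Tb.eval M + 2) ≤ P.eval M * (Tb.eval M + 2) := Nat.mul_le_mul_right _ htP
    simp [S]
    omega

theorem PF.computed {f : Env → ℕ} (h : PF f) : Computed f := by
  induction h with
  | var i => exact .var i
  | zero => exact .zero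
  | succ _ ih => exact ih.succ
  | length => exact .length
  | bit h ih => exact ih.bit h.bounded
  | ren r _ ih => exact ih.ren r
  | iter ht _ _ hg hb iht iha ihf => exact .iter iht iha ihf ht.bounded hg hb

/-! ### Output words -/

/-- Words built from bits by concatenation and loops. -/
inductive OutF : (Env → List Bool) → Prop
  | bit {f : Env → ℕ} : PF f → OutF fun e => [decide (f e ≠ 0)]
  | append {F G : Env → List Bool} : OutF F → OutF G → OutF fun e => F e ++ G e
  | loop {t : Env → ℕ} {F : Env → List Bool} : PF t → OutF F →
      OutF fun e => (List.range (t e)).flatMap fun i => F (e.cons i)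

/-- The word-valued function `F` is printed, in reverse order, by programs in polynomial time. -/
def Printed (F : Env → List Bool) : Prop :=
  ∀ (m : ℕ) (ρ : ℕ → ℕ), (∀ i, ρ i < m) → ∃ (p : Prog) (T : Polynomial ℕ),
    ∀ (w o : List Bool) (s : ℕ → ℕ) (M : ℕ), w.length ≤ M → (∀ i, s i ≤ M) →
      (∀ i, m ≤ i → s i = 0) →
      RunsIn p (st w [] o s) (st w [] ((F ⟨w, fun n => s (ρ n)⟩).reverse ++ o) s) (T.eval M)

theorem Printed.bit {f : Env → ℕ} (hf : Computed f) (hb : PB f) :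
    Printed fun e => [decide (f e ≠ 0)] := by
  intro m ρ hρ
  obtain ⟨p, T, h⟩ := hf m ρ hρ
  obtain ⟨P, hP⟩ := hb
  -- Counters consist of `true` only, so the middle case never arises.
  refine ⟨.seq p (.seq (.case (m + 3) (.push 2 true) .skip (.push 2 false)) (clear (m + 3))),
    T + (2 + (2 * P + 1)), fun w o s M hw hM hs => ?_⟩
  have hle := hP ⟨w, fun n => s (ρ n)⟩ M ⟨hw, fun _ => hM _⟩
  have h₁ := h w o s M hw hM hs
  change RunsIn _ _ (st w [] ([decide (f ⟨w, fun n => s (ρ n)⟩ ≠ 0)].reverse ++ o) s) _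
  generalize f ⟨w, fun n => s (ρ n)⟩ = n at h₁ hle
  have hpush : ∀ b, RunsIn (.push 2 b) (st w [] o (update s m n))
      (st w [] (b :: o) (update s m n)) 1 := fun b => by
    have := Runs.push 2 b (st w [] o (update s m n))
    rw [update_st_out] at this
    exact ⟨1, le_rfl, this⟩
  have h₂ : RunsIn (.case (m + 3) (.push 2 true) .skip (.push 2 false))
      (st w [] o (update s m n)) (st w [] (decide (n ≠ 0) :: o) (update s m n)) 2 := by
    rcases n with _ | n
    · exact .case_nil (by simp [st]) (by simpa using hpush false)
    · exact .case_true (by simp [st, List.replicate_succ]) (by simpa using hpush true)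
  have h₃ := runs_clear_counter w [] (decide (n ≠ 0) :: o) (s := update s m n) (r := m) (s' := s)
    (by simp [← hs m le_rfl])
  refine (h₁.seq (h₂.seq h₃)).mono ?_
  simp
  omega

theorem Printed.append {F G : Env → List Bool} (hF : Printed F) (hG : Printed G) :
    Printed fun e => F e ++ G e := by
  intro m ρ hρ
  obtain ⟨p, T, hp⟩ := hF m ρ hρ
  obtain ⟨q, U, hq⟩ := hG m ρ hρ
  refine ⟨.seq p q, T + U, fun w o s M hw hM hs => ?_⟩
  have := (hp w o s M hw hM hs).seq (hq w _ s M hw hM hs)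
  rw [Polynomial.eval_add, List.reverse_append, List.append_assoc]
  exact this

/-- Counter `m` counts down to control the loop, and `m + 1` counts up to serve as the bound
variable. The output only grows, so no bound on its length is needed here. -/
theorem Printed.loop {t : Env → ℕ} {F : Env → List Bool} (ht : Computed t) (tb : PB t)
    (hF : Printed F) : Printed fun e => (List.range (t e)).flatMap fun i => F (e.cons i) := by
  intro m ρ hρ
  obtain ⟨p, Tp, hp⟩ := ht m ρ hρ
  let ρ' : ℕ → ℕ := fun n => Nat.casesOn n (m + 1) ρ
  obtain ⟨r, Tr, hr⟩ := hF (m + 2) ρ' (by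
    rintro (_ | i)
    · change m + 1 < m + 2
      omega
    · exact (hρ i).trans (by omega))
  obtain ⟨P, hP⟩ := tb
  let B : Polynomial ℕ := .X + P
  refine ⟨.seq p (.seq (repeatCounter m (.seq r (inc (m + 1)))) (clear (m + 1 + 3))),
    Tp + ((P * (Tr.comp B + 1 + 2) + 1) + (2 * B + 1)), fun w o s M hw hM hs => ?_⟩
  let e : Env := ⟨w, fun n => s (ρ n)⟩
  let S : ℕ → ℕ → ℕ := fun i => update (update s m (t e - i)) (m + 1) i
  let O : ℕ → List Bool := fun n => ((List.range n).flatMap fun i => F (e.cons i)).reverse ++ o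
  have hB : B.eval M = M + P.eval M := by simp [B]
  have htP : t e ≤ P.eval M := hP e M ⟨hw, fun _ => hM _⟩
  have hρm : ∀ n, ρ n ≠ m := fun n => (hρ n).ne
  have hρm1 : ∀ n, ρ n ≠ m + 1 := fun n => ((hρ n).trans (by omega)).ne
  have h₁ : RunsIn p (st w [] o s) (st w [] o (update s m (t e))) (Tp.eval M) := hp w o s M hw hM hs
  have hb : ∀ i < t e, RunsIn (.seq r (inc (m + 1)))
      (st w [] (O i) (update (S i) m (t e - (i + 1)))) (st w [] (O (i + 1)) (S (i + 1)))
      (Tr.eval (B.eval M) + 1) := by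
    intro i hi
    have k₁ := hr w (O i) (update (S i) m (t e - (i + 1))) (B.eval M) (by omega) (fun j => by
      have h₂ := hM j
      simp only [S, update_apply]
      split_ifs <;> omega) (fun j hj => by
      have := hs j
      simp only [S, update_apply]
      split_ifs <;> omega)
    have henv : (⟨w, fun n => update (S i) m (t e - (i + 1)) (ρ' n)⟩ : Env) = e.cons i := by
      refine congrArg (Env.mk w) (funext fun n => ?_)
      rcases n with _ | n
      · change update (S i) m (t e - (i + 1)) (m + 1) = i
        simp [S]
      · change update (S i) m (t e - (i + 1)) (ρ n) = s (ρ n)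
        simp [S, hρm, hρm1]
    rw [henv] at k₁
    have hO : (F (e.cons i)).reverse ++ O i = O (i + 1) := by
      simp [O, List.range_succ]
    rw [hO] at k₁
    refine k₁.seq (runs_inc _ _ _ ?_)
    funext j
    simp only [S, update_apply]
    split_ifs <;> omega
  have h₂ := runs_repeatCounter (r := m) (t e) (fun _ => w) (fun _ => []) O S
    (fun i _ => by simp [S]) hb
  have h₀ : st w [] (O 0) (S 0) = st w [] o (update s m (t e)) := by
    congr 1
    funext j
    have := hs j
    simp only [S, update_apply]
    split_ifs <;> omega
  rw [h₀] at h₂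
  refine (h₁.seq (h₂.seq (runs_clear_counter _ _ _ ?_))).mono ?_
  · funext j
    have := hs j
    simp only [S, update_apply]
    split_ifs <;> omega
  · have k₂ : t e * (Tr.eval (B.eval M) + 1 + 2) ≤ P.eval M * (Tr.eval (B.eval M) + 1 + 2) :=
      Nat.mul_le_mul_right _ htP
    simp [S]
    omega

theorem OutF.printed {F : Env → List Bool} (h : OutF F) : Printed F := by
  induction h with
  | bit hf => exact .bit hf.computed hf.bounded
  | append _ _ ih₁ ih₂ => exact ih₁.append ih₂
  | loop ht _ ih => exact .loop ht.computed ht.bounded ih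

/-- A function whose encoded values are given by a word-valued function in the sense of `OutF`
is computable in polynomial time. -/
theorem OutF.computableInPolyTime {F : Env → List Bool} (hF : OutF F) {α β : Type}
    {ea : α → List Bool} {eb : β → List Bool} {f : α → β}
    (h : ∀ a, eb (f a) = F ⟨ea a, fun _ => 0⟩) : Nonempty (TM2ComputableInPolyTime ea eb f) := by
  -- All variables share counter `0`, which holds `0`; the program may use the counters from `1` on.
  obtain ⟨p, T, hp⟩ := hF.printed 1 (fun _ => 0) fun _ => Nat.one_pos
  -- Moving the reversed output from register `2` to the output register `1` restores its order.
  refine Prog.computableInPolyTime (.seq p (.seq (clear 0) (moveAll 2 1)))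
    (T + ((2 * .X + 1) + (4 * T + 1))) fun a => ?_
  obtain ⟨n, hn, hr⟩ := hp (ea a) [] (fun _ => 0) (ea a).length le_rfl (by simp) (by simp)
  have hlen := hr.length_le 2
  rw [List.append_nil, ← h a] at hr hlen
  have h₂ := runs_clear (x := 0) (st (ea a) [] (eb (f a)).reverse fun _ => 0) rfl
  rw [update_st_word] at h₂
  have h₃ := runs_moveAll (x := 2) (y := 1) (by simp) (st [] [] (eb (f a)).reverse fun _ => 0) rfl
  rw [update_st_out, update_st_aux] at h₃
  have hst₀ : update (fun _ => []) 0 (ea a) = st (ea a) [] [] fun _ => 0 := by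
    funext j
    rcases j with _ | _ | _ | j <;> simp [st]
  have hst₁ : update (fun _ => []) 1 (eb (f a)) = st [] (eb (f a)) [] fun _ => 0 := by
    funext j
    rcases j with _ | _ | _ | j <;> simp [st]
  rw [hst₀, hst₁]
  have := (RunsIn.seq ⟨n, hn, hr⟩ (h₂.seq h₃))
  simp only [st, List.reverse_reverse, List.append_nil] at this
  refine this.mono ?_
  simp [st] at hlen ⊢
  omega

/-! ### Closure properties of polynomially bounded functions -/

namespace Env

/-- Forget the variable bound last. -/
def tail (e : Env) : Env := ⟨e.word, fun n => e.val (n + 1)⟩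

end Env

/-- Truth values as numbers. -/
noncomputable def ind (p : Prop) : ℕ := by
  classical exact if p then 1 else 0

theorem ind_true {p : Prop} (h : p) : ind p = 1 := by simp [ind, h]

theorem ind_false {p : Prop} (h : ¬p) : ind p = 0 := by simp [ind, h]

theorem ind_le_one (p : Prop) : ind p ≤ 1 := by
  by_cases h : p
  · rw [ind_true h]
  · simp [ind_false h]

/-- Predicates whose truth values are a polynomially bounded function. -/
def PP (p : Env → Prop) : Prop := PF fun e => ind (p e)

namespace PF

variable {f g h : Env → ℕ}

theorem tail (hf : PF f) : PF fun e => f e.tail := hf.ren Nat.succ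

/-- The step of an iteration binds two variables, so parameters of the surrounding environment are
read below them, through `tail.tail`. -/
theorem iterate {t a g : Env → ℕ} {f : Env → ℕ → ℕ → ℕ} (ht : PF t) (ha : PF a)
    (hf : PF fun e => f e.tail.tail (e.val 1) (e.val 0)) (hg : PF g)
    (hb : ∀ e, ∀ i ≤ t e, Nat.rec (a e) (f e) i ≤ g e) :
    PF fun e => Nat.rec (a e) (f e) (t e) :=
  PF.iter ht ha hf hg.bounded hb

theorem const : ∀ n : ℕ, PF fun _ => n
  | 0 => .zero
  | n + 1 => (const n).succ

/-- The bound on intermediate values is given as `PB` rather than as a function already in `PF`,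
since it is the sum that is being constructed. -/
theorem add (hf : PF f) (hg : PF g) : PF fun e => f e + g e := by
  have hrec : ∀ a n : ℕ, (Nat.rec a (fun _ y => y + 1) n : ℕ) = a + n := fun a n => by
    induction n with
    | zero => rfl
    | succ n ih => exact congrArg (· + 1) ih
  obtain ⟨P, hP⟩ := hf.bounded
  obtain ⟨Q, hQ⟩ := hg.bounded
  have : PF fun e => (Nat.rec (f e) (fun _ y => y + 1) (g e) : ℕ) :=
    PF.iter (f := fun e => e.val 0 + 1) (g := fun e => f e + g e) hg hf (PF.var 0).succ
      ⟨P + Q, fun e M h => by simpa using add_le_add (hP e M h) (hQ e M h)⟩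
      (fun e i hi => (hrec _ _).trans_le (by omega))
  simpa only [hrec] using this

theorem iterate_le_add {a b t i : ℕ} {f : ℕ → ℕ → ℕ} (h : ∀ i y, f i y ≤ y + b) (hi : i ≤ t) :
    (Nat.rec a f i : ℕ) ≤ a + t * b := by
  have : ∀ n : ℕ, (Nat.rec a f n : ℕ) ≤ a + n * b := fun n => by
    induction n with
    | zero => simp
    | succ n ih =>
      refine (h n (Nat.rec a f n)).trans ?_
      rw [add_mul]
      omega
  exact (this i).trans (by gcongr)

theorem mul (hf : PF f) (hg : PF g) : PF fun e => f e * g e := by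
  have hrec : ∀ a n : ℕ, (Nat.rec 0 (fun _ y => y + a) n : ℕ) = a * n := fun a n => by
    induction n with
    | zero => rfl
    | succ n ih => exact (congrArg (· + a) ih).trans (Nat.mul_succ a n).symm
  obtain ⟨P, hP⟩ := hf.bounded
  obtain ⟨Q, hQ⟩ := hg.bounded
  have : PF fun e => (Nat.rec 0 (fun _ y => y + f e) (g e) : ℕ) :=
    PF.iter (f := fun e => e.val 0 + f e.tail.tail) (g := fun e => f e * g e) hg .zero
      ((PF.var 0).add hf.tail.tail)
      ⟨P * Q, fun e M h => by simpa using Nat.mul_le_mul (hP e M h) (hQ e M h)⟩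
      (fun e i hi => (hrec (f e) i).trans_le (Nat.mul_le_mul_left _ hi))
  simpa only [hrec] using this

/-- An iteration in which every step adds a bounded amount. -/
theorem iterate_add {t a b : Env → ℕ} {f : Env → ℕ → ℕ → ℕ} (ht : PF t) (ha : PF a)
    (hf : PF fun e => f e.tail.tail (e.val 1) (e.val 0)) (hb : PF b)
    (h : ∀ e i y, f e i y ≤ y + b e) : PF fun e => Nat.rec (a e) (f e) (t e) :=
  iterate ht ha hf (ha.add (ht.mul hb)) fun e _ hi => iterate_le_add (h e) hi

theorem pred (hf : PF f) : PF fun e => f e - 1 := by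
  have hrec : ∀ n : ℕ, (Nat.rec 0 (fun i _ => i) n : ℕ) = n - 1 := fun n => by cases n <;> rfl
  have := iterate (f := fun _ i _ => i) hf .zero (.var 1) hf fun e i hi =>
    (hrec i).trans_le (by omega)
  simpa only [hrec] using this

theorem sub (hf : PF f) (hg : PF g) : PF fun e => f e - g e := by
  have hrec : ∀ a n : ℕ, (Nat.rec a (fun _ y => y - 1) n : ℕ) = a - n := fun a n => by
    induction n with
    | zero => rfl
    | succ n ih => exact congrArg (· - 1) ih
  have := iterate (f := fun _ _ y => y - 1) hg hf (PF.var 0).pred hf fun e i hi =>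
    (hrec _ i).trans_le (by omega)
  simpa only [hrec] using this

theorem min (hf : PF f) (hg : PF g) : PF fun e => min (f e) (g e) := by
  have : (fun e => Min.min (f e) (g e)) = fun e => f e - (f e - g e) := by
    funext e
    omega
  rw [this]
  exact hf.sub (hf.sub hg)

end PF

namespace PP

variable {p q : Env → Prop} {f g t : Env → ℕ}

theorem congr (h : ∀ e, p e ↔ q e) (hq : PP q) : PP p := by
  have : p = q := funext fun e => propext (h e)
  rwa [this]

theorem of_pos (hf : PF f) : PP fun e => 0 < f e := by
  have : (fun e => ind (0 < f e)) = fun e => Min.min (f e) 1 := by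
    funext e
    by_cases h : 0 < f e
    · rw [ind_true h]
      omega
    · rw [ind_false h]
      omega
  rw [PP, this]
  exact hf.min (.const 1)

theorem not (hp : PP p) : PP fun e => ¬p e := by
  have : (fun e => ind (¬p e)) = fun e => 1 - ind (p e) := by
    funext e
    by_cases h : p e
    · rw [ind_true h, ind_false (by simpa)]
    · rw [ind_false h, ind_true h]
  rw [PP, this]
  exact (PF.const 1).sub hp

theorem lt (hf : PF f) (hg : PF g) : PP fun e => f e < g e :=
  (of_pos (hg.sub hf)).congr fun e => by omega

theorem le (hf : PF f) (hg : PF g) : PP fun e => f e ≤ g e :=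
  (lt hg hf).not.congr fun e => by omega

theorem and (hp : PP p) (hq : PP q) : PP fun e => p e ∧ q e :=
  (of_pos (PF.mul hp hq)).congr fun e => by
    by_cases h₁ : p e <;> by_cases h₂ : q e <;> simp [ind, h₁, h₂]

theorem or (hp : PP p) (hq : PP q) : PP fun e => p e ∨ q e :=
  (of_pos (PF.add hp hq)).congr fun e => by
    by_cases h₁ : p e <;> by_cases h₂ : q e <;> simp [ind, h₁, h₂]

theorem imp (hp : PP p) (hq : PP q) : PP fun e => p e → q e :=
  (hp.not.or hq).congr fun _ => imp_iff_not_or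

theorem iff (hp : PP p) (hq : PP q) : PP fun e => p e ↔ q e :=
  ((hp.imp hq).and (hq.imp hp)).congr fun _ => iff_iff_implies_and_implies

theorem eq (hf : PF f) (hg : PF g) : PP fun e => f e = g e :=
  ((le hf hg).and (le hg hf)).congr fun _ => le_antisymm_iff

theorem ite [∀ e, Decidable (p e)] (hp : PP p) (hf : PF f) (hg : PF g) :
    PF fun e => if p e then f e else g e := by
  have : (fun e => if p e then f e else g e) =
      fun e => ind (p e) * f e + (1 - ind (p e)) * g e := by
    funext e
    by_cases h : p e <;> simp [ind, h]
  rw [this]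
  exact (PF.mul hp hf).add (PF.mul ((PF.const 1).sub hp) hg)

/-- Bounded search is an iteration that keeps the maximum of the truth values so far; it never
exceeds `1`. The maximum of `y` and `z` is expressed as `y + (z - y)`. -/
theorem exists_lt {p : Env → ℕ → Prop} (ht : PF t) (hp : PP fun e => p e.tail (e.val 0)) :
    PP fun e => ∃ i < t e, p e i := by
  have hrec : ∀ (e : Env) (n : ℕ),
      0 < (Nat.rec 0 (fun i y => Max.max y (ind (p e i))) n : ℕ) ↔ ∃ i < n, p e i := fun e n => by
    induction n with
    | zero => simp
    | succ n ih =>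
      rw [show (Nat.rec 0 (fun i y => Max.max y (ind (p e i))) (n + 1) : ℕ) =
        Max.max (Nat.rec 0 (fun i y => Max.max y (ind (p e i))) n) (ind (p e n)) from rfl,
        lt_max_iff, ih]
      have : 0 < ind (p e n) ↔ p e n := by by_cases h : p e n <;> simp [ind, h]
      rw [this]
      constructor
      · rintro (⟨i, hi, h⟩ | h)
        · exact ⟨i, by omega, h⟩
        · exact ⟨n, by omega, h⟩
      · rintro ⟨i, hi, h⟩
        rcases Nat.lt_succ_iff_lt_or_eq.1 hi with hi | rfl
        · exact .inl ⟨i, hi, h⟩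
        · exact .inr h
  refine (of_pos (PF.iterate (f := fun e i y => Max.max y (ind (p e i))) (g := fun _ => 1) ht .zero
    ?_ (.const 1) fun e i _ => ?_)).congr fun e => (hrec e (t e)).symm
  · have hp' : PF fun e => ind (p e.tail.tail (e.val 1)) := hp.ren Nat.succ
    have : (fun e : Env => Max.max (e.val 0) (ind (p e.tail.tail (e.val 1)))) =
        fun e => e.val 0 + (ind (p e.tail.tail (e.val 1)) - e.val 0) := by
      funext e
      omega
    rw [this]
    exact (PF.var 0).add (hp'.sub (.var 0))
  · induction i with
    | zero => exact Nat.zero_le _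
    | succ i ih => exact max_le (ih (by omega)) (ind_le_one _)

theorem forall_lt {p : Env → ℕ → Prop} (ht : PF t) (hp : PP fun e => p e.tail (e.val 0)) :
    PP fun e => ∀ i < t e, p e i :=
  (exists_lt (p := fun e i => ¬p e i) ht hp.not).not.congr fun e => by simp

/-- The bit of the input word at the position `f` is `true`. -/
theorem bitAt (hf : PF f) : PP fun e => e.word[f e]? = some true :=
  (of_pos (PF.bit hf)).congr fun e => by
    rcases e.word[f e]? with _ | _ | _ <;> simp

end PP

/-! ### Bounded minimisation, division and remainder -/

/-- The least number below `t` with the property `p`, or `t` if there is none. -/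
noncomputable def least (p : ℕ → Prop) (t : ℕ) : ℕ :=
  Nat.rec 0 (fun i y => by classical exact if y = i ∧ ¬p i then i + 1 else y) t

theorem least_succ (p : ℕ → Prop) (t : ℕ) [Decidable (least p t = t ∧ ¬p t)] :
    least p (t + 1) = if least p t = t ∧ ¬p t then t + 1 else least p t := by
  by_cases h : least p t = t ∧ ¬p t
  · rw [if_pos h]
    exact if_pos h
  · rw [if_neg h]
    exact if_neg h

theorem least_le (p : ℕ → Prop) (t : ℕ) : least p t ≤ t := by
  classical
  induction t with
  | zero => exact le_rfl
  | succ t ih =>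
    rw [least_succ]
    split_ifs <;> omega

/-- While all candidates have failed, the value keeps pace with the step number; after the first
success it falls behind and is frozen. The case `k = t` covers an unsuccessful search. -/
theorem least_eq {p : ℕ → Prop} {t k : ℕ} (hk : k ≤ t) (h : ∀ i < k, ¬p i) (hp : k < t → p k) :
    least p t = k := by
  classical
  induction t with
  | zero => exact (Nat.le_zero.1 hk).symm
  | succ t ih =>
    rw [least_succ]
    rcases Nat.lt_or_ge t k with htk | htk
    · obtain rfl : k = t + 1 := by omega
      have : least p t = t := by
        clear ih hp
        have : ∀ n ≤ t, least p n = n := fun n => by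
          induction n with
          | zero => exact fun _ => rfl
          | succ n ih =>
            intro hn
            rw [least_succ, if_pos ⟨ih (by omega), h n (by omega)⟩]
        exact this t le_rfl
      rw [if_pos ⟨this, h t (by omega)⟩]
    · have := ih htk fun hkt => hp (by omega)
      rw [this, if_neg]
      rintro ⟨rfl, h'⟩
      exact h' (hp (by omega))

theorem least_spec {p : ℕ → Prop} {t : ℕ} (h : ∃ i < t, p i) :
    p (least p t) ∧ least p t < t := by
  classical
  have h₁ := Nat.find_spec h
  have h₂ : least p t = Nat.find h := least_eq h₁.1.le
    (fun i hi hpi => Nat.find_min h hi ⟨hi.trans h₁.1, hpi⟩) fun _ => h₁.2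
  rw [h₂]
  exact h₁.symm

namespace PF

theorem least {t : Env → ℕ} {p : Env → ℕ → Prop} (ht : PF t)
    (hp : PP fun e => p e.tail (e.val 0)) : PF fun e => least (p e) (t e) := by
  classical
  have hp' : PP fun e => p e.tail.tail (e.val 1) := PF.ren Nat.succ hp
  refine iterate ht .zero ?_ ht fun e i hi => (least_le (p e) i).trans hi
  exact (((PP.eq (.var 0) (.var 1)).and hp'.not).ite (PF.var 1).succ (.var 0) :)

/-- The quotient is the first `q` with `a < (q + 1) * b`, and it is at most `a`, so searching below
`a` suffices. -/
theorem div_mod_aux (a b : ℕ) (hb : 0 < b) : GameIsoGI.least (fun q => a < (q + 1) * b) a = a / b := by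
  refine least_eq (Nat.div_le_self a b) (fun i hi => ?_) fun _ => ?_
  · have := (Nat.le_div_iff_mul_le hb).1 (Nat.succ_le_of_lt hi)
    simpa using this
  · exact (Nat.div_lt_iff_lt_mul hb).1 (Nat.lt_succ_self _)

variable {f g : Env → ℕ}

theorem div (hf : PF f) (hg : PF g) : PF fun e => f e / g e := by
  classical
  have : (fun e => f e / g e) = fun e =>
      if 0 < g e then GameIsoGI.least (fun q => f e < (q + 1) * g e) (f e) else 0 := by
    funext e
    split_ifs with h
    · exact (div_mod_aux _ _ h).symm
    · simp [Nat.eq_zero_of_not_pos h]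
  rw [this]
  exact (PP.of_pos hg).ite (least hf (PP.lt hf.tail ((PF.var 0).succ.mul hg.tail))) .zero

theorem mod (hf : PF f) (hg : PF g) : PF fun e => f e % g e := by
  have : (fun e => f e % g e) = fun e => f e - g e * (f e / g e) := by
    funext e
    have := Nat.div_add_mod (f e) (g e)
    omega
  rw [this]
  exact hf.sub (hg.mul (hf.div hg))

end PF

namespace OutF

variable {f : Env → ℕ} {p : Env → Prop}

theorem ofPP (hp : PP p) [∀ e, Decidable (p e)] : OutF fun e => [decide (p e)] := by
  have : (fun e => [decide (p e)]) = fun e => [decide (ind (p e) ≠ 0)] := by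
    funext e
    by_cases h : p e <;> simp [ind, h]
  rw [this]
  exact .bit hp

theorem true : OutF fun _ => [true] := OutF.bit (.const 1)

theorem false : OutF fun _ => [false] := OutF.bit (.const 0)

theorem range {t : Env → ℕ} {F : Env → ℕ → List Bool} (ht : PF t)
    (hF : OutF fun e => F e.tail (e.val 0)) :
    OutF fun e => (List.range (t e)).flatMap (F e) :=
  OutF.loop ht hF

theorem unary (hf : PF f) : OutF fun e => encodeUnary (f e) := by
  have : (fun e => encodeUnary (f e)) =
      fun e => ((List.range (f e)).flatMap fun _ => [Bool.true]) ++ [Bool.false] := by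
    funext e
    rw [encodeUnary, List.flatMap, List.map_const', List.length_range,
      List.flatten_replicate_singleton]
  rw [this]
  exact (range hf true).append false

end OutF

theorem encodeFun_eq_flatMap_range {α : Type} (c : α → List Bool) {n : ℕ} (f : Fin n → α)
    (g : ℕ → List Bool) (h : ∀ i : Fin n, c (f i) = g i) :
    encodeFun c f = (List.range n).flatMap g := by
  rw [encodeFun, List.flatMap, ← List.map_coe_finRange_eq_range, List.map_map, List.ofFn_eq_map]
  congr 1
  exact List.map_congr_left fun i _ => h i

/-! ### Action maps -/

section

variable {Γ Γ' : Game}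

/-- The action map on the actions of a single player. -/
noncomputable def ActionMap.fiber (φ : ActionMap Γ Γ') (i : Γ.Player) :
    Fin (Γ.numActions i) ≃ Fin (Γ'.numActions (φ.player i)) :=
  Equiv.ofBijective
    (fun a => Fin.cast (congrArg Γ'.numActions (φ.action_player ⟨i, a⟩)) (φ.action ⟨i, a⟩).2) <| by
    constructor
    · intro a b hab
      have h : φ.action ⟨i, a⟩ = φ.action ⟨i, b⟩ := by
        refine Sigma.ext ((φ.action_player _).trans (φ.action_player ⟨i, b⟩).symm) ?_
        exact (Fin.heq_ext_iff (congrArg Γ'.numActions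
          ((φ.action_player ⟨i, a⟩).trans (φ.action_player ⟨i, b⟩).symm))).2
            (congrArg Fin.val hab)
      simpa using φ.action.injective h
    · intro b
      obtain ⟨⟨j, a⟩, h⟩ := φ.action.surjective ⟨φ.player i, b⟩
      have hj : φ.player j = φ.player i := by
        rw [← φ.action_player ⟨j, a⟩, h]
      obtain rfl := φ.player.injective hj
      refine ⟨a, Fin.ext ?_⟩
      exact congrArg (fun x : Γ'.Action => (x.2 : ℕ)) h

theorem ActionMap.val_fiber (φ : ActionMap Γ Γ') (i : Γ.Player) (a : Fin (Γ.numActions i)) :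
    (φ.fiber i a : ℕ) = (φ.action ⟨i, a⟩).2 := rfl

/-- Evaluating at an image `player i` cancels the inverse in the definition of `profile`; all later
arguments use this form. -/
theorem ActionMap.profile_player (φ : ActionMap Γ Γ') (s : Γ.Profile) (i : Γ.Player) :
    φ.profile s (φ.player i) = φ.fiber i (s i) := by
  apply Fin.ext
  exact congrArg (fun j => ((φ.action ⟨j, s j⟩).2 : ℕ)) (φ.player.symm_apply_apply i)

theorem ActionMap.numActions_eq (φ : ActionMap Γ Γ') (i : Γ.Player) :
    Γ.numActions i = Γ'.numActions (φ.player i) := by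
  simpa using Fintype.card_congr (φ.fiber i)

/-- The action map given by a bijection of the players and bijections of their actions. -/
def ActionMap.ofFibers (π : Γ.Player ≃ Γ'.Player)
    (τ : ∀ i, Fin (Γ.numActions i) ≃ Fin (Γ'.numActions (π i))) : ActionMap Γ Γ' where
  action := Equiv.sigmaCongr π τ
  player := π
  action_player _ := rfl

end

/-- An equivalence that maps the range of one embedding onto the range of another one. -/
theorem exists_equiv_of_forall {X X' A A' : Type*} (e : X ≃ X') {f : A → X} {f' : A' → X'}
    (hf : Injective f) (hf' : Injective f') (h : ∀ a, ∃ a', e (f a) = f' a')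
    (h' : ∀ a', ∃ a, e (f a) = f' a') : ∃ g : A ≃ A', ∀ a, e (f a) = f' (g a) := by
  choose g hg using h
  refine ⟨Equiv.ofBijective g ⟨fun a b hab => hf (e.injective ?_), fun a' => ?_⟩, hg⟩
  · rw [hg, hg, hab]
  · obtain ⟨a, ha⟩ := h' a'
    exact ⟨a, hf' ((hg a).symm.trans ha)⟩

/-! ### Games of graphs -/

/-- Adjacency of vertices given by their numbers. -/
def adjN {n : ℕ} (G : SimpleGraph (Fin n)) (a b : ℕ) : Prop :=
  ∃ x y : Fin n, (x : ℕ) = a ∧ (y : ℕ) = b ∧ G.Adj x y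

theorem adjN_coe {n : ℕ} (G : SimpleGraph (Fin n)) (x y : Fin n) : adjN G x y ↔ G.Adj x y :=
  ⟨fun ⟨x', y', hx, hy, h⟩ => by rwa [← Fin.ext hx, ← Fin.ext hy], fun h => ⟨x, y, rfl, rfl, h⟩⟩

/-- Incidence of the vertices `x < n` with the vertices and edges of a graph; the column with
number `k` stands for the pair of `k % (n + 1)` and `k / (n + 1)`. -/
def Incident (n : ℕ) (adj : ℕ → ℕ → Prop) (x k : ℕ) : Prop :=
  (k % (n + 1) < n ∧ k / (n + 1) < n) ∧
    (k % (n + 1) = k / (n + 1) ∨ adj (k % (n + 1)) (k / (n + 1))) ∧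
      (x = k % (n + 1) ∨ x = k / (n + 1))

open Classical in
/-- The payoffs `1` and `-1`. -/
noncomputable def signOf (p : Prop) : ℚ := if p then 1 else -1

theorem signOf_injective {p q : Prop} (h : signOf p = signOf q) : p ↔ q := by
  by_cases hp : p <;> by_cases hq : q <;> simp [signOf, hp, hq] at h ⊢ <;> norm_num at h

/-- The two-player game of a graph: one player chooses a vertex (or a dummy), the other one
a pair of vertices. The players have the same payoffs if `team` is true, and opposite ones if it
is false. -/
noncomputable def incidenceGame (team : Bool) (G : FinGraph) : Game where
  numPlayers := 2
  numPlayers_pos := by norm_num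
  numActions := ![G.order + 1, (G.order + 2) * (G.order + 1)]
  numActions_pos i := by fin_cases i <;> simp
  payoff i s := signOf
    (Incident G.order (adjN G.graph) (s 0) (s 1) ↔ (i = 0 ∨ team = true))

theorem incidenceGame_zeroSum (G : FinGraph) : (incidenceGame false G).IsTwoPlayerZeroSum := by
  refine ⟨rfl, fun s => ?_⟩
  refine (Fin.sum_univ_two (f := fun i => (incidenceGame false G).payoff i s)).trans ?_
  by_cases h : Incident G.order (adjN G.graph) (s (0 : Fin 2)) (s (1 : Fin 2)) <;>
    simp [incidenceGame, signOf, h]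

theorem incidenceGame_team (G : FinGraph) : (incidenceGame true G).IsTwoPlayerTeam :=
  ⟨rfl, fun s i j => by simp [incidenceGame]⟩

/-- The column of the edge `(a, b)` meets exactly the rows `a` and `b`. Its image therefore meets
the distinct rows `σ a` and `σ b`, so these are the two entries of its pair; being distinct, they
must be adjacent. -/
theorem incident_map {n : ℕ} {adj adj' : ℕ → ℕ → Prop} (hadj : ∀ a b, adj a b → a ≠ b)
    (hsymm : ∀ a b, adj' a b → adj' b a) (σ : Fin (n + 1) ≃ Fin (n + 1))
    (τ : Fin ((n + 2) * (n + 1)) ≃ Fin ((n + 2) * (n + 1)))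
    (h : ∀ (x : Fin (n + 1)) (k : Fin ((n + 2) * (n + 1))),
      Incident n adj x k → Incident n adj' (σ x) (τ k)) {a b : Fin (n + 1)}
    (ha : (a : ℕ) < n) (hb : (b : ℕ) < n) (hab : adj a b) : adj' (σ a) (σ b) := by
  let k : Fin ((n + 2) * (n + 1)) := finProdFinEquiv (⟨b, by omega⟩, a)
  have hk : (k : ℕ) = a + (n + 1) * b := rfl
  have hk₁ : (k : ℕ) % (n + 1) = a := by
    rw [hk, Nat.add_mul_mod_self_left, Nat.mod_eq_of_lt a.2]
  have hk₂ : (k : ℕ) / (n + 1) = b := by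
    rw [hk, Nat.add_mul_div_left _ _ (Nat.succ_pos n), Nat.div_eq_of_lt a.2, zero_add]
  have h₁ := h a k ⟨by omega, by rw [hk₁, hk₂]; exact .inr hab, by omega⟩
  have h₂ := h b k ⟨by omega, by rw [hk₁, hk₂]; exact .inr hab, by omega⟩
  have hne : (σ a : ℕ) ≠ σ b := fun he =>
    hadj _ _ hab (congrArg Fin.val (σ.injective (Fin.ext he)))
  obtain ⟨-, hc, h₁⟩ := h₁
  obtain ⟨-, -, h₂⟩ := h₂
  rcases h₁ with h₁ | h₁ <;> rcases h₂ with h₂ | h₂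
  · exact absurd (h₁.trans h₂.symm) hne
  · rw [← h₁, ← h₂] at hc
    exact hc.resolve_left hne
  · rw [← h₁, ← h₂] at hc
    exact hsymm _ _ (hc.resolve_left fun h => hne h.symm)
  · exact absurd (h₁.trans h₂.symm) hne

/-- A true vertex meets the column in which it is repeated, whereas the dummy meets no column.
Isolated vertices are thus also told apart from the dummy. -/
theorem incident_lt {n : ℕ} {adj adj' : ℕ → ℕ → Prop} (σ : Fin (n + 1) ≃ Fin (n + 1))
    (τ : Fin ((n + 2) * (n + 1)) ≃ Fin ((n + 2) * (n + 1)))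
    (h : ∀ (x : Fin (n + 1)) (k : Fin ((n + 2) * (n + 1))),
      Incident n adj (σ x) (τ k) → Incident n adj' x k) {x : Fin (n + 1)}
    (hx : (σ x : ℕ) < n) : (x : ℕ) < n := by
  let k : Fin ((n + 2) * (n + 1)) := finProdFinEquiv (⟨σ x, by omega⟩, σ x)
  have hk : (k : ℕ) = σ x + (n + 1) * σ x := rfl
  have hk₁ : (k : ℕ) % (n + 1) = σ x := by
    rw [hk, Nat.add_mul_mod_self_left, Nat.mod_eq_of_lt (σ x).2]
  have hk₂ : (k : ℕ) / (n + 1) = σ x := by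
    rw [hk, Nat.add_mul_div_left _ _ (Nat.succ_pos n), Nat.div_eq_of_lt (σ x).2, zero_add]
  have h₁ := h x (τ.symm k) (by
    rw [τ.apply_symm_apply]
    exact ⟨by omega, by rw [hk₁, hk₂]; exact .inl rfl, by omega⟩)
  obtain ⟨⟨h₁, h₂⟩, -, h₃⟩ := h₁
  omega

theorem iso_of_incident_iff {n : ℕ} {G G' : SimpleGraph (Fin n)} (σ : Fin (n + 1) ≃ Fin (n + 1))
    (τ : Fin ((n + 2) * (n + 1)) ≃ Fin ((n + 2) * (n + 1)))
    (h : ∀ (x : Fin (n + 1)) (k : Fin ((n + 2) * (n + 1))),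
      Incident n (adjN G) x k ↔ Incident n (adjN G') (σ x) (τ k)) :
    Nonempty (G ≃g G') := by
  have h' : ∀ (x : Fin (n + 1)) (k : Fin ((n + 2) * (n + 1))),
      Incident n (adjN G') x k ↔ Incident n (adjN G) (σ.symm x) (τ.symm k) :=
    fun x k => by rw [h, σ.apply_symm_apply, τ.apply_symm_apply]
  have hne : ∀ (H : SimpleGraph (Fin n)) (a b : ℕ), adjN H a b → a ≠ b := by
    rintro H _ _ ⟨x, y, rfl, rfl, hxy⟩ he
    exact hxy.ne (Fin.ext he)
  have hsymm : ∀ (H : SimpleGraph (Fin n)) (a b : ℕ), adjN H a b → adjN H b a := by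
    rintro H _ _ ⟨x, y, rfl, rfl, hxy⟩
    exact ⟨y, x, rfl, rfl, hxy.symm⟩
  obtain ⟨e, he⟩ := exists_equiv_of_forall σ (f := Fin.castSucc (n := n))
    (f' := Fin.castSucc (n := n)) (Fin.castSucc_injective n) (Fin.castSucc_injective n)
    (fun a => by
      have hlt := incident_lt σ.symm τ.symm (fun x k => (h' x k).2) (x := σ a.castSucc) (by simp)
      exact ⟨⟨_, hlt⟩, rfl⟩)
    (fun a => by
      have hlt := incident_lt σ τ (fun x k => (h x k).2) (x := σ.symm a.castSucc) (by simp)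
      exact ⟨⟨_, hlt⟩, σ.apply_symm_apply _⟩)
  refine ⟨⟨e, fun {a b} => ⟨fun hab => ?_, fun hab => ?_⟩⟩⟩
  · have := incident_map (hne G') (hsymm G) σ.symm τ.symm (fun x k => (h' x k).1)
      (a := (e a).castSucc) (b := (e b).castSucc) (by simp) (by simp) ((adjN_coe G' _ _).2 hab)
    rw [← he, ← he, σ.symm_apply_apply, σ.symm_apply_apply] at this
    exact (adjN_coe G _ _).1 this
  · have := incident_map (hne G) (hsymm G') σ τ (fun x k => (h x k).1)
      (a := a.castSucc) (b := b.castSucc) (by simp) (by simp) ((adjN_coe G _ _).2 hab)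
    rw [he, he] at this
    exact (adjN_coe G' _ _).1 this

/-- Extended by the identity to all of `ℕ`, the isomorphism preserves `< n`, equality and adjacency,
and these are all that `Incident` refers to. It acts on rows directly and on columns componentwise.
-/
theorem incident_iff_of_iso {n : ℕ} {G G' : SimpleGraph (Fin n)} (e : G ≃g G') :
    ∃ (σ : Fin (n + 1) ≃ Fin (n + 1)) (τ : Fin ((n + 2) * (n + 1)) ≃ Fin ((n + 2) * (n + 1))),
      ∀ (x : Fin (n + 1)) (k : Fin ((n + 2) * (n + 1))),
        Incident n (adjN G) x k ↔ Incident n (adjN G') (σ x) (τ k) := by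
  let ε : Equiv.Perm ℕ := Equiv.Perm.extendDomain e.toEquiv Fin.equivSubtype
  have hε : ∀ x : Fin n, ε x = e x := fun x =>
    Equiv.Perm.extendDomain_apply_image e.toEquiv Fin.equivSubtype x
  have hε' : ∀ x, ¬x < n → ε x = x := fun x hx =>
    Equiv.Perm.extendDomain_apply_not_subtype e.toEquiv Fin.equivSubtype hx
  have hlt : ∀ x, ε x < n ↔ x < n := fun x => by
    by_cases hx : x < n
    · have := hε ⟨x, hx⟩
      simp only at this
      simp [this, hx]
    · rw [hε' x hx]
  have hm : ∀ m, n ≤ m → ∀ x, ε x < m ↔ x < m := fun m hm x => by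
    by_cases hx : x < n
    · have := (hlt x).2 hx
      omega
    · rw [hε' x hx]
  have hadj : ∀ a b, adjN G' (ε a) (ε b) ↔ adjN G a b := by
    intro a b
    constructor
    · rintro ⟨x, y, hx, hy, h⟩
      have ha : a < n := (hlt a).1 (by omega)
      have hb : b < n := (hlt b).1 (by omega)
      refine ⟨⟨a, ha⟩, ⟨b, hb⟩, rfl, rfl, e.map_adj_iff.1 ?_⟩
      convert h
      · exact Fin.ext ((hε ⟨a, ha⟩).symm.trans hx.symm)
      · exact Fin.ext ((hε ⟨b, hb⟩).symm.trans hy.symm)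
    · rintro ⟨x, y, rfl, rfl, h⟩
      exact ⟨e x, e y, (hε x).symm, (hε y).symm, e.map_adj_iff.2 h⟩
  let ρ : ∀ m, n ≤ m → (Fin m ≃ Fin m) := fun m h =>
    ⟨fun x => ⟨ε x, (hm m h x).2 x.2⟩, fun x => ⟨ε.symm x, (hm m h _).1 (by simp)⟩,
      fun x => by simp, fun x => by simp⟩
  refine ⟨ρ (n + 1) (by omega), finProdFinEquiv.symm.trans
    (((ρ (n + 2) (by omega)).prodCongr (ρ (n + 1) (by omega))).trans finProdFinEquiv), ?_⟩
  intro x k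
  obtain ⟨⟨b, a⟩, rfl⟩ := finProdFinEquiv.surjective k
  have key : ∀ (b : Fin (n + 2)) (a : Fin (n + 1)),
      ((finProdFinEquiv (b, a) : Fin _) : ℕ) % (n + 1) = a ∧
        ((finProdFinEquiv (b, a) : Fin _) : ℕ) / (n + 1) = b := fun b a => by
    rw [finProdFinEquiv_apply_val]
    rw [Nat.add_mul_mod_self_left, Nat.mod_eq_of_lt a.2,
      Nat.add_mul_div_left _ _ (Nat.succ_pos n), Nat.div_eq_of_lt a.2, zero_add]
    exact ⟨rfl, rfl⟩
  simp only [Incident, Equiv.trans_apply, Equiv.symm_apply_apply, Equiv.prodCongr_apply,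
    Prod.map_apply, (key _ _).1, (key _ _).2]
  simp only [ρ, Equiv.coe_fn_mk, hlt, hadj, ε.injective.eq_iff]

/-- A column factor of `n + 2` makes the second player have strictly more actions than the first in
either game; an exchange would give `n + 1 > n' + 1 > n + 1`. -/
theorem eq_refl_of_numActions {n n' : ℕ} (π : Fin 2 ≃ Fin 2)
    (h₀ : n + 1 = ![n' + 1, (n' + 2) * (n' + 1)] (π 0))
    (h₁ : (n + 2) * (n + 1) = ![n' + 1, (n' + 2) * (n' + 1)] (π 1)) : π = Equiv.refl (Fin 2) := by
  have hne : π 0 ≠ π 1 := π.injective.ne (by decide)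
  have h : π 0 = 0 ∧ π 1 = 1 := by
    rcases Fin.exists_fin_two.1 ⟨π 0, rfl⟩ with h | h <;>
      rcases Fin.exists_fin_two.1 ⟨π 1, rfl⟩ with h' | h' <;> rw [h, h'] at hne
    · exact absurd rfl hne
    · exact ⟨h, h'⟩
    · rw [h] at h₀
      rw [h'] at h₁
      simp only [Matrix.cons_val_zero, Matrix.cons_val_one] at h₀ h₁
      nlinarith
    · exact absurd rfl hne
  refine Equiv.ext fun i => ?_
  fin_cases i
  exacts [h.1, h.2]

/-- The payoff of player `0` alone already determines incidence. The payoff of player `1` is a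
function of it that is the same for both games, so it adds no condition. -/
theorem incidenceGame_iso_iff (team : Bool) (G G' : FinGraph) :
    Nonempty (G.graph ≃g G'.graph) ↔
      Nonempty (GameIso (incidenceGame team G) (incidenceGame team G')) := by
  obtain ⟨n, G⟩ := G
  obtain ⟨n', G'⟩ := G'
  constructor
  · rintro ⟨e⟩
    obtain rfl : n = n' := by simpa using Fintype.card_congr e.toEquiv
    obtain ⟨σ, τ, h⟩ := incident_iff_of_iso e
    let φ : ActionMap (incidenceGame team ⟨n, G⟩) (incidenceGame team ⟨n, G'⟩) :=
      .ofFibers (Equiv.refl _) fun i => Fin.cases σ (fun i => Fin.cases τ (fun i => i.elim0) i) i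
    refine ⟨⟨φ, fun i s => ?_⟩⟩
    have h₀ : φ.profile s (0 : Fin 2) = σ (s (0 : Fin 2)) := φ.profile_player s (0 : Fin 2)
    have h₁ : φ.profile s (1 : Fin 2) = τ (s (1 : Fin 2)) := φ.profile_player s (1 : Fin 2)
    change signOf (Incident n (adjN G) (s (0 : Fin 2)) (s (1 : Fin 2)) ↔ _) =
      signOf (Incident n (adjN G') (φ.profile s (0 : Fin 2)) (φ.profile s (1 : Fin 2)) ↔ _)
    rw [h₀, h₁]
    exact congrArg signOf (propext (iff_congr (h (s (0 : Fin 2)) (s (1 : Fin 2))) Iff.rfl))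
  · rintro ⟨⟨φ, hφ⟩⟩
    obtain ⟨act, π, hact⟩ := φ
    have hnum := ActionMap.numActions_eq ⟨act, π, hact⟩
    have hπ : π = Equiv.refl (Fin 2) :=
      eq_refl_of_numActions (n := n) (n' := n') π (hnum (0 : Fin 2)) (hnum (1 : Fin 2))
    subst hπ
    have h0 : n + 1 = n' + 1 := hnum (0 : Fin 2)
    obtain rfl : n = n' := by omega
    set φ : ActionMap (incidenceGame team ⟨n, G⟩) (incidenceGame team ⟨n, G'⟩) :=
      ⟨act, Equiv.refl (Fin 2), hact⟩
    refine iso_of_incident_iff (φ.fiber (0 : Fin 2)) (φ.fiber (1 : Fin 2)) fun x k => ?_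
    let s : (incidenceGame team ⟨n, G⟩).Profile := fun i =>
      Fin.cases x (fun i => Fin.cases k (fun i => i.elim0) i) i
    have h₀ : φ.profile s (0 : Fin 2) = φ.fiber (0 : Fin 2) x := φ.profile_player s (0 : Fin 2)
    have h₁ : φ.profile s (1 : Fin 2) = φ.fiber (1 : Fin 2) k := φ.profile_player s (1 : Fin 2)
    have h := signOf_injective (hφ (0 : Fin 2) s)
    change (Incident n (adjN G) x k ↔ (0 : Fin 2) = 0 ∨ _) ↔
      (Incident n (adjN G') (φ.profile s (0 : Fin 2)) (φ.profile s (1 : Fin 2)) ↔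
        (0 : Fin 2) = 0 ∨ _) at h
    rw [h₀, h₁] at h
    have ht : (0 : Fin 2) = 0 ∨ team = true := .inl rfl
    exact (iff_true_right ht).symm.trans (h.trans (iff_true_right ht))

/-! ### Reading codes from a word -/

/-- The number of consecutive bits `true` from position `p` on. -/
noncomputable def unaryAt (w : List Bool) (p : ℕ) : ℕ :=
  least (fun j => ¬w[p + j]? = some true) w.length

theorem PF.unaryAt {f : Env → ℕ} (hf : PF f) : PF fun e => unaryAt e.word (f e) :=
  PF.least (p := fun e j => ¬e.word[f e + j]? = some true) .length
    (PP.bitAt (hf.tail.add (.var 0))).not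

theorem unaryAt_le (w : List Bool) (p : ℕ) : unaryAt w p ≤ w.length := least_le _ _

theorem getElem?_of_drop {w u : List Bool} {p : ℕ} (h : w.drop p = u) (j : ℕ) :
    w[p + j]? = u[j]? := by
  rw [← h, List.getElem?_drop]

theorem length_le_of_drop {w u : List Bool} {p : ℕ} (h : w.drop p = u) : u.length ≤ w.length := by
  rw [← h, List.length_drop]
  exact Nat.sub_le _ _

theorem drop_add_of_drop {w u t : List Bool} {p : ℕ} (h : w.drop p = u ++ t) :
    w.drop (p + u.length) = t := by
  rw [← List.drop_drop, h, List.drop_left]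

theorem length_encodeUnary (n : ℕ) : (encodeUnary n).length = n + 1 := by simp [encodeUnary]

theorem unaryAt_eq {w t : List Bool} {p n : ℕ} (h : w.drop p = encodeUnary n ++ t) :
    unaryAt w p = n := by
  have hlen := length_le_of_drop h
  rw [List.length_append, length_encodeUnary] at hlen
  refine least_eq (by omega) (fun i hi => ?_) fun _ => ?_
  · rw [getElem?_of_drop h]
    simp [encodeUnary, List.getElem?_append, hi]
  · rw [getElem?_of_drop h]
    simp [encodeUnary]

/-- Parsing by iteration: `nx` need only jump correctly where a code word really starts, and then
`i` jumps skip `i` entries. Its values elsewhere are irrelevant. -/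
theorem drop_iterate {α : Type} {c : α → List Bool} {nx : ℕ → ℕ} {w t : List Bool} {n q : ℕ}
    {f : Fin n → α} (hnx : ∀ q x t, w.drop q = c x ++ t → nx q = q + (c x).length)
    (h : w.drop q = encodeFun c f ++ t) {i : ℕ} (hi : i ≤ n) :
    w.drop (Nat.rec q (fun _ y => nx y) i) =
      ((List.ofFn fun i => c (f i)).drop i).flatten ++ t := by
  induction i with
  | zero => exact h
  | succ i ih =>
    have h₁ := ih (by omega)
    rw [List.drop_eq_getElem_cons (l := List.ofFn fun i => c (f i)) (i := i) (by simpa using hi),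
      List.flatten_cons, List.append_assoc, List.getElem_ofFn] at h₁
    have h₂ := hnx _ _ _ h₁
    change w.drop (nx (Nat.rec q (fun _ y => nx y) i)) = _
    rw [h₂]
    exact drop_add_of_drop h₁

theorem exists_drop_iterate {α : Type} {c : α → List Bool} {nx : ℕ → ℕ} {w t : List Bool} {n q : ℕ}
    {f : Fin n → α} (hnx : ∀ q x t, w.drop q = c x ++ t → nx q = q + (c x).length)
    (h : w.drop q = encodeFun c f ++ t) (i : Fin n) :
    ∃ t', w.drop (Nat.rec q (fun _ y => nx y) (i : ℕ)) = c (f i) ++ t' := by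
  refine ⟨((List.ofFn fun i => c (f i)).drop (i + 1)).flatten ++ t, ?_⟩
  rw [drop_iterate hnx h i.2.le, List.drop_eq_getElem_cons (by simp), List.flatten_cons,
    List.append_assoc, List.getElem_ofFn]

theorem drop_iterate_end {α : Type} {c : α → List Bool} {nx : ℕ → ℕ} {w t : List Bool} {n q : ℕ}
    {f : Fin n → α} (hnx : ∀ q x t, w.drop q = c x ++ t → nx q = q + (c x).length)
    (h : w.drop q = encodeFun c f ++ t) : w.drop (Nat.rec q (fun _ y => nx y) n) = t := by
  rw [drop_iterate hnx h le_rfl, List.drop_of_length_le (by simp)]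
  rfl

theorem rec_add (q L i : ℕ) : (Nat.rec q (fun _ y => y + L) i : ℕ) = q + i * L := by
  induction i with
  | zero => simp
  | succ i ih =>
    rw [add_mul, one_mul, ← add_assoc, ← ih]

theorem length_encodeFun_bit {n : ℕ} (f : Fin n → Bool) : (encodeFun encodeBit f).length = n := by
  simp [encodeFun, encodeBit, List.length_flatten, List.map_ofFn, comp_def]

/-! ### Graph isomorphism reduces to the isomorphism of games of graphs -/

/-- Adjacency in the graph whose code starts at position `p`. -/
def adjAt (w : List Bool) (p a b : ℕ) : Prop :=
  -- Rows have the length of the vertex count and entries have length `1`; the factor `1` keeps the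
  -- form of `rec_add`.
  w[p + (unaryAt w p + 1) + a * unaryAt w p + b * 1]? = some true

/-- The end of the graph code that starts at position `p`. -/
noncomputable def graphEnd (w : List Bool) (p : ℕ) : ℕ :=
  p + (unaryAt w p + 1) + unaryAt w p * unaryAt w p

theorem unaryAt_graph {w t : List Bool} {p : ℕ} {G : FinGraph} (h : w.drop p = encodeGraph G ++ t) :
    unaryAt w p = G.order := by
  rw [encodeGraph, List.append_assoc] at h
  exact unaryAt_eq h

theorem drop_graph {w t : List Bool} {p : ℕ} {G : FinGraph} (h : w.drop p = encodeGraph G ++ t) :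
    w.drop (graphEnd w p) = t ∧ ∀ x y : Fin G.order, adjAt w p x y ↔ G.graph.Adj x y := by
  have hn := unaryAt_graph h
  rw [encodeGraph, List.append_assoc] at h
  have h₁ := drop_add_of_drop h
  rw [length_encodeUnary] at h₁
  have hrow : ∀ (q : ℕ) (row : Fin G.order → Bool) t, w.drop q = encodeFun encodeBit row ++ t →
      q + G.order = q + (encodeFun encodeBit row).length := fun q row t _ => by
    rw [length_encodeFun_bit]
  have hbit : ∀ (q : ℕ) (b : Bool) t, w.drop q = encodeBit b ++ t →
      q + 1 = q + (encodeBit b).length := fun q b t _ => rfl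
  constructor
  · have := drop_iterate_end (nx := fun q => q + G.order) hrow h₁
    rw [rec_add] at this
    rwa [graphEnd, hn]
  · intro x y
    obtain ⟨t₁, h₂⟩ := exists_drop_iterate (nx := fun q => q + G.order) hrow h₁ x
    obtain ⟨t₂, h₃⟩ := exists_drop_iterate (nx := fun q => q + 1) hbit h₂ y
    rw [rec_add, rec_add] at h₃
    rw [adjAt, hn, ← add_zero (_ + _ * 1), getElem?_of_drop h₃]
    simp [encodeBit]

theorem adjAt_iff {w t : List Bool} {p : ℕ} {G : FinGraph} (h : w.drop p = encodeGraph G ++ t)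
    {a b : ℕ} (ha : a < G.order) (hb : b < G.order) : adjAt w p a b ↔ adjN G.graph a b :=
  ((drop_graph h).2 ⟨a, ha⟩ ⟨b, hb⟩).trans (adjN_coe G.graph ⟨a, ha⟩ ⟨b, hb⟩).symm

open Classical in
/-- The code of the payoff `signOf p`. -/
noncomputable def signCode (p : Prop) : List Bool :=
  [decide ¬p, true, true, false, true, true, false]

theorem encodeRat_signOf (p : Prop) : encodeRat (signOf p) = signCode p := by
  by_cases h : p <;> simp [signOf, h, encodeRat, signCode, encodeNat, encodeBits]

/-- The code of the game of the graph whose code starts at position `p`. -/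
noncomputable def incidenceWord (team : Bool) (w : List Bool) (p : ℕ) : List Bool :=
  encodeUnary 2 ++ (encodeUnary (unaryAt w p + 1) ++
    (encodeUnary ((unaryAt w p + 2) * (unaryAt w p + 1)) ++
      (List.range ((unaryAt w p + 1) * ((unaryAt w p + 2) * (unaryAt w p + 1)))).flatMap fun k =>
        signCode (Incident (unaryAt w p) (adjAt w p) (k % (unaryAt w p + 1))
          (k / (unaryAt w p + 1))) ++
        signCode (Incident (unaryAt w p) (adjAt w p) (k % (unaryAt w p + 1))
          (k / (unaryAt w p + 1)) ↔ team = true)))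

theorem val_finPiFinEquiv_symm {m : ℕ} {n : Fin m → ℕ} (k : Fin (∏ i, n i)) (i : Fin m) :
    (finPiFinEquiv.symm k i : ℕ) = k / (∏ j : Fin i, n (Fin.castLE i.is_lt.le j)) % n i := rfl

/-- Player `0` varies fastest in the table, so profile `k` has row `k % (n + 1)` and column `k / (n
+ 1)`. -/
theorem incidenceWord_eq (team : Bool) {w t : List Bool} {p : ℕ} {G : FinGraph}
    (h : w.drop p = encodeGraph G ++ t) :
    incidenceWord team w p = encodeGame (incidenceGame team G) := by
  have hn := unaryAt_graph h
  -- The word determines adjacency only below the order, but `Incident` consults it only there.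
  have hI : ∀ x k, Incident G.order (adjAt w p) x k ↔ Incident G.order (adjN G.graph) x k := fun x k =>
    and_congr_right fun hk => by rw [adjAt_iff h hk.1 hk.2]
  have hact : encodeFun encodeUnary (incidenceGame team G).numActions =
      encodeUnary (G.order + 1) ++ encodeUnary ((G.order + 2) * (G.order + 1)) := by
    simp [encodeFun, incidenceGame]
  have hprod : ∏ i, (incidenceGame team G).numActions i =
      (G.order + 1) * ((G.order + 2) * (G.order + 1)) :=
    Fin.prod_univ_two (f := ![G.order + 1, (G.order + 2) * (G.order + 1)])
  rw [encodeGame, hact, incidenceWord, hn, List.append_assoc]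
  rw [encodeFun_eq_flatMap_range _ _ (fun k => signCode (Incident G.order (adjAt w p)
    (k % (G.order + 1)) (k / (G.order + 1))) ++ signCode (Incident G.order (adjAt w p)
      (k % (G.order + 1)) (k / (G.order + 1)) ↔ team = true)) fun k => ?_, hprod]
  · rfl
  · let s := finPiFinEquiv.symm k
    have h₀ : (s (0 : Fin 2) : ℕ) = k % (G.order + 1) := by
      have := val_finPiFinEquiv_symm (n := (incidenceGame team G).numActions) k (0 : Fin 2)
      refine this.trans ?_
      change (k : ℕ) / (∏ j : Fin 0, _) % (G.order + 1) = _
      simp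
    have h₁ : (s (1 : Fin 2) : ℕ) = k / (G.order + 1) := by
      have := val_finPiFinEquiv_symm (n := (incidenceGame team G).numActions) k (1 : Fin 2)
      refine this.trans ?_
      change (k : ℕ) / (∏ j : Fin 1, _) % ((G.order + 2) * (G.order + 1)) = _
      rw [Fin.prod_univ_one]
      change (k : ℕ) / (G.order + 1) % ((G.order + 2) * (G.order + 1)) = _
      refine Nat.mod_eq_of_lt (Nat.div_lt_of_lt_mul ?_)
      rw [← hprod]
      exact k.2
    have hpay : ∀ i : Fin 2, encodeRat ((incidenceGame team G).payoff i s) =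
        signCode (Incident G.order (adjN G.graph) (k % (G.order + 1)) (k / (G.order + 1)) ↔
          (i = 0 ∨ team = true)) := fun i => by
      rw [← encodeRat_signOf, ← h₀, ← h₁]
      rfl
    have hrow : encodeFun encodeRat (fun i => (incidenceGame team G).payoff i s) =
        encodeRat ((incidenceGame team G).payoff (0 : Fin 2) s) ++
          encodeRat ((incidenceGame team G).payoff (1 : Fin 2) s) := by
      change (List.ofFn fun i : Fin 2 => encodeRat ((incidenceGame team G).payoff i s)).flatten = _
      simp
    rw [hrow, hpay, hpay]
    simp [hI]

theorem outF_signCode {p : Env → Prop} (hp : PP p) : OutF fun e => signCode (p e) := by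
  classical
  have : (fun e => signCode (p e)) =
      fun e => [decide ¬p e] ++ ([true] ++ ([true] ++ ([false] ++ ([true] ++ ([true] ++ [false]))))) := by
    funext e
    simp [signCode]
  rw [this]
  exact (OutF.ofPP hp.not).append (.append .true (.append .true (.append .false
    (.append .true (.append .true .false)))))

theorem outF_incidenceWord (team : Bool) {f : Env → ℕ} (hf : PF f) :
    OutF fun e => incidenceWord team e.word (f e) := by
  have hn := hf.unaryAt
  have hI : PP fun e => Incident (unaryAt e.tail.word (f e.tail)) (adjAt e.tail.word (f e.tail))
      (e.val 0 % (unaryAt e.tail.word (f e.tail) + 1))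
      (e.val 0 / (unaryAt e.tail.word (f e.tail) + 1)) := by
    have hn' := hn.tail
    have hk := (PF.var 0).div hn'.succ
    have ha := hk.mod hn'.succ
    have hb := hk.div hn'.succ
    have hx := (PF.var 0).mod hn'.succ
    have hadj := PP.bitAt (((hf.tail.add hn'.succ).add (ha.mul hn')).add (hb.mul (.const 1)))
    exact ((PP.lt ha hn').and (PP.lt hb hn')).and (((PP.eq ha hb).or hadj).and
      ((PP.eq hx ha).or (PP.eq hx hb)))
  refine (OutF.unary (.const 2)).append ((OutF.unary hn.succ).append ((OutF.unary
    ((hn.add (.const 2)).mul hn.succ)).append (OutF.range (hn.succ.mul ((hn.add (.const 2)).mul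
      hn.succ)) ((outF_signCode hI).append (outF_signCode ?_)))))
  cases team
  · exact hI.not.congr fun e => by simp
  · exact hI.congr fun e => by simp

/-- The word of the pair consists of two graph codes, and the second one is found at `graphEnd`. -/
theorem graphIso_reduces (team : Bool) (C : Game → Prop) (hC : ∀ G, C (incidenceGame team G)) :
    PolyTimeReduces graphIsoProblem (gameIsoProblemOn C) := by
  refine ⟨fun x => (⟨incidenceGame team x.1, hC _⟩, ⟨incidenceGame team x.2, hC _⟩), ?_,
    fun x => incidenceGame_iso_iff team x.1 x.2⟩
  refine OutF.computableInPolyTime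
    (F := fun e => incidenceWord team e.word 0 ++ incidenceWord team e.word (graphEnd e.word 0))
    ((outF_incidenceWord team .zero).append (outF_incidenceWord team ?_)) fun x => ?_
  · exact ((PF.zero.add (PF.zero.unaryAt.succ)).add (PF.zero.unaryAt.mul PF.zero.unaryAt))
  · have h₁ : (graphIsoProblem.encode x).drop 0 = encodeGraph x.1 ++ encodeGraph x.2 := rfl
    have h₂ : (graphIsoProblem.encode x).drop (graphEnd (graphIsoProblem.encode x) 0) =
        encodeGraph x.2 ++ [] := by rw [(drop_graph h₁).1, List.append_nil]
    dsimp only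
    rw [incidenceWord_eq team h₁, incidenceWord_eq team h₂]
    rfl

/-! ### Coloured graphs as graphs -/

/-- Isomorphism of coloured graphs with the same vertices. -/
def ColouredIso {V : Type} (c c' : V → ℕ) (A A' : V → V → Prop) : Prop :=
  ∃ e : V ≃ V, (∀ v, c' (e v) = c v) ∧ ∀ u v, A' (e u) (e v) ↔ A u v

/-- Adjacency in the graph that has, for every vertex `v` of a given graph, the vertex `(v, 0)`
with `h v` pendant neighbours, and some isolated vertices. -/
def PendantAdj {V : Type} (h : V → ℕ) (A : V → V → Prop) (x y : V × ℕ) : Prop :=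
  (x.2 = 0 ∧ y.2 = 0 ∧ A x.1 y.1) ∨
    (x.1 = y.1 ∧ ((x.2 = 0 ∧ 0 < y.2 ∧ y.2 ≤ h x.1) ∨ (y.2 = 0 ∧ 0 < x.2 ∧ x.2 ≤ h x.1)))

/-- The graph with pendant vertices. -/
def pendantGraph {V : Type} (T : ℕ) (h : V → ℕ) (A : V → V → Prop) (hs : ∀ u v, A u v → A v u)
    (hi : ∀ v, ¬A v v) : SimpleGraph (V × Fin T) where
  Adj x y := PendantAdj h A (x.1, x.2) (y.1, y.2)
  symm := ⟨by
    rintro ⟨u, i⟩ ⟨v, j⟩ (⟨h₁, h₂, h₃⟩ | ⟨h₁, h₂⟩)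
    · exact .inl ⟨h₂, h₁, hs _ _ h₃⟩
    · dsimp only at h₁
      subst h₁
      exact .inr ⟨rfl, h₂.symm⟩⟩
  loopless := ⟨by
    rintro ⟨u, i⟩ (⟨-, -, h⟩ | ⟨-, h⟩)
    · exact hi _ h
    · dsimp only at h
      omega⟩

section

variable {V : Type} [Fintype V] {T : ℕ} {h : V → ℕ} {A : V → V → Prop}
  {hs : ∀ u v, A u v → A v u} {hi : ∀ v, ¬A v v}

open Classical in
theorem le_degree_pendantGraph (hT : ∀ v, h v ≤ T) (v : V) :
    h v ≤ (pendantGraph (T + 1) h A hs hi).degree (v, 0) := by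
  have : ((Finset.univ : Finset (Fin (h v))).map
      ⟨fun j : Fin (h v) => (v, (⟨j + 1, Nat.succ_lt_succ (j.2.trans_le (hT v))⟩ : Fin (T + 1))), fun i j hij => by
        have h' : (i : ℕ) + 1 = j + 1 := congrArg (fun x : V × Fin (T + 1) => (x.2 : ℕ)) hij
        exact Fin.ext (Nat.succ_injective h')⟩) ⊆ (pendantGraph (T + 1) h A hs hi).neighborFinset (v, 0) := by
    intro x hx
    obtain ⟨j, -, rfl⟩ := Finset.mem_map.1 hx
    rw [SimpleGraph.mem_neighborFinset]
    exact .inr ⟨rfl, .inl ⟨rfl, Nat.succ_pos _, j.2⟩⟩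
  simpa using Finset.card_le_card this

open Classical in
theorem degree_pendantGraph_le (v : V) :
    (pendantGraph (T + 1) h A hs hi).degree (v, 0) ≤ h v + Fintype.card V := by
  have : (pendantGraph (T + 1) h A hs hi).neighborFinset (v, 0) ⊆
      ((Finset.range (h v)).image fun j => (v, Fin.ofNat (T + 1) (j + 1))) ∪
        (Finset.univ : Finset V).image fun u => (u, 0) := by
    rintro ⟨u, j⟩ hx
    rw [SimpleGraph.mem_neighborFinset] at hx
    rw [Finset.mem_union, Finset.mem_image, Finset.mem_image]
    rcases hx with ⟨-, hj, -⟩ | ⟨hu, ⟨-, hj, hj'⟩ | ⟨hj, -⟩⟩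
    · exact .inr ⟨u, Finset.mem_univ _, Prod.ext rfl (Fin.ext hj.symm)⟩
    · refine .inl ⟨j - 1, Finset.mem_range.2 ?_, Prod.ext hu (Fin.ext ?_)⟩
      · dsimp only at hj hj'
        omega
      · dsimp only at hj hj'
        rw [Nat.sub_add_cancel hj]
        simp
    · exact .inr ⟨u, Finset.mem_univ _, Prod.ext rfl (Fin.ext hj.symm)⟩
  refine (Finset.card_le_card this).trans ((Finset.card_union_le _ _).trans (add_le_add ?_ ?_))
  · simpa using Finset.card_image_le (s := Finset.range (h v))
      (f := fun j => (v, Fin.ofNat (T + 1) (j + 1)))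
  · exact Finset.card_image_le

open Classical in
theorem degree_pendantGraph_le_one {x : V × Fin (T + 1)} (hx : x.2 ≠ 0) :
    (pendantGraph (T + 1) h A hs hi).degree x ≤ 1 := by
  have : (pendantGraph (T + 1) h A hs hi).neighborFinset x ⊆ {(x.1, 0)} := by
    intro y hy
    have hx' : (x.2 : ℕ) ≠ 0 := fun h => hx (Fin.ext h)
    rw [SimpleGraph.mem_neighborFinset] at hy
    rcases hy with ⟨h, -⟩ | ⟨hu, ⟨h, -⟩ | ⟨h, -⟩⟩
    · exact absurd h hx'
    · exact absurd h hx'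
    · exact Finset.mem_singleton.2 (Prod.ext hu.symm (Fin.ext h))
  simpa using Finset.card_le_card this

variable {A' : V → V → Prop} {hs' : ∀ u v, A' u v → A' v u} {hi' : ∀ v, ¬A' v v} {c c' : V → ℕ}

/-- With `N` vertices, an original vertex of colour `c` has degree between `(c + 1) * (N + 1)` and
that number plus `N`. These intervals are disjoint for different colours and lie above `1`, the
largest degree of an added vertex. So an isomorphism preserves the original vertices and their
colours. -/
theorem pendantGraph_iso_iff [Nonempty V] (hT : ∀ v, (c v + 1) * (Fintype.card V + 1) ≤ T)
    (hT' : ∀ v, (c' v + 1) * (Fintype.card V + 1) ≤ T) :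
    Nonempty (pendantGraph (T + 1) (fun v => (c v + 1) * (Fintype.card V + 1)) A hs hi ≃g
      pendantGraph (T + 1) (fun v => (c' v + 1) * (Fintype.card V + 1)) A' hs' hi') ↔
      ColouredIso c c' A A' := by
  classical
  have hcard : 0 < Fintype.card V := Fintype.card_pos
  -- Stated for arbitrary data so that it applies to the inverse isomorphism too.
  have key : ∀ {c c' : V → ℕ} {A A' : V → V → Prop} {hs : ∀ u v, A u v → A v u} {hi : ∀ v, ¬A v v}
      {hs' : ∀ u v, A' u v → A' v u} {hi' : ∀ v, ¬A' v v}
      (_ : ∀ v, (c v + 1) * (Fintype.card V + 1) ≤ T)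
      (_ : ∀ v, (c' v + 1) * (Fintype.card V + 1) ≤ T)
      (e : pendantGraph (T + 1) (fun v => (c v + 1) * (Fintype.card V + 1)) A hs hi ≃g
        pendantGraph (T + 1) (fun v => (c' v + 1) * (Fintype.card V + 1)) A' hs' hi') (v : V),
      ∃ u, e (v, 0) = (u, 0) ∧ c' u = c v := by
    intro c c' A A' hs hi hs' hi' hT hT' e v
    have hdeg := e.degree_eq (v, 0)
    have h₁ := le_degree_pendantGraph (h := fun v => (c v + 1) * (Fintype.card V + 1))
      (A := A) (hs := hs) (hi := hi) hT v
    have h₂ := degree_pendantGraph_le (h := fun v => (c v + 1) * (Fintype.card V + 1))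
      (A := A) (hs := hs) (hi := hi) (T := T) v
    by_cases hx : (e (v, 0)).2 = 0
    · have hx' : e (v, 0) = ((e (v, 0)).1, 0) := Prod.ext rfl hx
      refine ⟨_, hx', ?_⟩
      rw [hx'] at hdeg
      generalize (e (v, 0)).1 = u at hdeg
      have h₃ := le_degree_pendantGraph (h := fun v => (c' v + 1) * (Fintype.card V + 1))
        (A := A') (hs := hs') (hi := hi') hT' u
      have h₄ := degree_pendantGraph_le (h := fun v => (c' v + 1) * (Fintype.card V + 1))
        (A := A') (hs := hs') (hi := hi') (T := T) u
      rw [hdeg] at h₃ h₄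
      have h₅ : c' u < c v + 1 := by
        by_contra hlt
        have := Nat.mul_le_mul_right (Fintype.card V + 1) (Nat.succ_le_succ (not_lt.1 hlt))
        simp only [Nat.succ_eq_add_one, add_mul] at *
        omega
      have h₆ : c v < c' u + 1 := by
        by_contra hlt
        have := Nat.mul_le_mul_right (Fintype.card V + 1) (Nat.succ_le_succ (not_lt.1 hlt))
        simp only [Nat.succ_eq_add_one, add_mul] at *
        omega
      omega
    · have h₃ := degree_pendantGraph_le_one (h := fun v => (c' v + 1) * (Fintype.card V + 1))
        (A := A') (hs := hs') (hi := hi') hx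
      rw [hdeg] at h₃
      rw [add_mul] at h₁
      omega
  constructor
  · rintro ⟨e⟩
    have hinj : Injective fun v : V => (v, (0 : Fin (T + 1))) := fun u v h => congrArg Prod.fst h
    obtain ⟨g, hg⟩ := exists_equiv_of_forall e.toEquiv hinj hinj
      (fun v => (key hT hT' e v).imp fun u hu => hu.1)
      (fun v => by
        obtain ⟨u, hu, -⟩ := key hT' hT e.symm v
        exact ⟨u, by rw [← hu]; exact e.apply_symm_apply _⟩)
    have hg' : ∀ v, e (v, 0) = (g v, 0) := hg
    refine ⟨g, fun v => ?_, fun u v => ?_⟩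
    · obtain ⟨u, hu, hc⟩ := key hT hT' e v
      rw [← hc]
      exact congrArg c' (congrArg Prod.fst ((hg' v).symm.trans hu))
    · have h₀ := e.map_adj_iff (v := (u, 0)) (w := (v, 0))
      rw [hg', hg'] at h₀
      simpa [pendantGraph, PendantAdj] using h₀
  · rintro ⟨e, hc, hA⟩
    refine ⟨⟨e.prodCongr (Equiv.refl _), fun {x y} => ?_⟩⟩
    obtain ⟨u, i⟩ := x
    obtain ⟨v, j⟩ := y
    simp [pendantGraph, PendantAdj, hA, hc]

end

/-! ### The coloured graph of a game -/

/-- Vertices of the coloured graph of a game. -/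
inductive Vertex (Γ : Game) : Type
  | player (i : Γ.Player)
  | action (a : Γ.Action)
  | profile (s : Γ.Profile)
  | outcome (o : Γ.Player × Γ.Profile)

namespace Vertex

variable {Γ Γ' : Game}

/-- The colours: one for each kind of vertices, and one for each payoff. -/
def colour (ℓ : ℚ → ℕ) : Vertex Γ → ℕ
  | player _ => 1
  | action _ => 2
  | profile _ => 3
  | outcome o => 4 + ℓ (Γ.payoff o.1 o.2)

/-- The edges: actions are joined to their players and to the profiles in which they occur,
outcomes to their player and their profile. -/
def Rel : Vertex Γ → Vertex Γ → Prop
  | action a, player i => a.1 = i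
  | action a, profile s => s a.1 = a.2
  | outcome o, player i => o.1 = i
  | outcome o, profile s => o.2 = s
  | _, _ => False

/-- Adjacency. -/
def Adj (u v : Vertex Γ) : Prop := Rel u v ∨ Rel v u

theorem adj_action_player {a : Γ.Action} {i : Γ.Player} :
    Adj (action a) (player i) ↔ a.1 = i := or_iff_left (fun h : False => h)

theorem adj_action_profile {a : Γ.Action} {s : Γ.Profile} :
    Adj (action a) (profile s) ↔ s a.1 = a.2 := or_iff_left (fun h : False => h)

theorem adj_outcome_player {o : Γ.Player × Γ.Profile} {i : Γ.Player} :
    Adj (outcome o) (player i) ↔ o.1 = i := or_iff_left (fun h : False => h)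

theorem adj_outcome_profile {o : Γ.Player × Γ.Profile} {s : Γ.Profile} :
    Adj (outcome o) (profile s) ↔ o.2 = s := or_iff_left (fun h : False => h)

variable {ℓ : ℚ → ℕ}

theorem exists_player {e : Vertex Γ → Vertex Γ'} (hc : ∀ v, colour ℓ (e v) = colour ℓ v)
    (i : Γ.Player) : ∃ j, e (player i) = player j := by
  have h := hc (player i)
  rcases hv : e (player i) with j | a | s | o <;> rw [hv] at h
  · exact ⟨j, rfl⟩
  all_goals simp only [colour] at h; omega

theorem exists_action {e : Vertex Γ → Vertex Γ'} (hc : ∀ v, colour ℓ (e v) = colour ℓ v)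
    (a : Γ.Action) : ∃ b, e (action a) = action b := by
  have h := hc (action a)
  rcases hv : e (action a) with j | a | s | o <;> rw [hv] at h
  · simp [colour] at h
  · exact ⟨a, rfl⟩
  all_goals simp only [colour] at h; omega

theorem exists_profile {e : Vertex Γ → Vertex Γ'} (hc : ∀ v, colour ℓ (e v) = colour ℓ v)
    (s : Γ.Profile) : ∃ t, e (profile s) = profile t := by
  have h := hc (profile s)
  rcases hv : e (profile s) with j | a | s | o <;> rw [hv] at h
  · simp [colour] at h
  · simp [colour] at h
  · exact ⟨s, rfl⟩
  · simp only [colour] at h; omega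

theorem exists_outcome {e : Vertex Γ → Vertex Γ'} (hc : ∀ v, colour ℓ (e v) = colour ℓ v)
    (o : Γ.Player × Γ.Profile) : ∃ o', e (outcome o) = outcome o' := by
  have h := hc (outcome o)
  rcases hv : e (outcome o) with j | a | s | o <;> rw [hv] at h
  · simp only [colour] at h; omega
  · simp only [colour] at h; omega
  · simp only [colour] at h; omega
  · exact ⟨o, rfl⟩

/-- Colours preserve the kind of a vertex, action-player edges make the action map respect players,
and action-profile edges force the map on profiles to be the induced one. An outcome is located by
its player and profile, so its colour gives the payoff equation. Labels need only separate payoffs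
that occur. -/
theorem gameIso_of_equiv (hℓ : ∀ i s j t, ℓ (Γ.payoff i s) = ℓ (Γ'.payoff j t) →
      Γ.payoff i s = Γ'.payoff j t) (e : Vertex Γ ≃ Vertex Γ')
    (hc : ∀ v, colour ℓ (e v) = colour ℓ v) (hA : ∀ u v, Adj (e u) (e v) ↔ Adj u v) :
    Nonempty (GameIso Γ Γ') := by
  have hc' : ∀ v, colour ℓ (e.symm v) = colour ℓ v := fun v => by
    rw [← hc, e.apply_symm_apply]
  obtain ⟨π, hπ⟩ := exists_equiv_of_forall e (f := player) (f' := player)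
    (fun _ _ h => Vertex.player.inj h) (fun _ _ h => Vertex.player.inj h) (exists_player hc)
    fun i => (exists_player hc' i).imp fun j hj => by rw [← hj, e.apply_symm_apply]
  obtain ⟨α, hα⟩ := exists_equiv_of_forall e (f := action) (f' := action)
    (fun _ _ h => Vertex.action.inj h) (fun _ _ h => Vertex.action.inj h) (exists_action hc)
    fun i => (exists_action hc' i).imp fun j hj => by rw [← hj, e.apply_symm_apply]
  choose ψ hψ using exists_profile hc
  choose θ hθ using exists_outcome hc
  have hact : ∀ a, (α a).1 = π a.1 := fun a => by
    have := (hA (action a) (player a.1)).2 (adj_action_player.2 rfl)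
    rwa [hα, hπ, adj_action_player] at this
  let φ : ActionMap Γ Γ' := ⟨α, π, hact⟩
  have hprof : ∀ s, φ.profile s = ψ s := fun s => by
    funext j
    obtain ⟨i, rfl⟩ := π.surjective j
    have h := (hA (action ⟨i, s i⟩) (profile s)).2 (adj_action_profile.2 rfl)
    rw [hα, hψ, adj_action_profile] at h
    refine (φ.profile_player s i).trans (Fin.ext ?_)
    rw [φ.val_fiber]
    change ((α ⟨i, s i⟩).2 : ℕ) = _
    rw [← h]
    exact congrArg (fun j => (ψ s j : ℕ)) (hact ⟨i, s i⟩)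
  refine ⟨⟨φ, fun i s => ?_⟩⟩
  have h₁ := (hA (outcome (i, s)) (player i)).2 (adj_outcome_player.2 rfl)
  rw [hθ, hπ, adj_outcome_player] at h₁
  have h₂ := (hA (outcome (i, s)) (profile s)).2 (adj_outcome_profile.2 rfl)
  rw [hθ, hψ, adj_outcome_profile] at h₂
  have h₃ := hc (outcome (i, s))
  rw [hθ] at h₃
  simp only [colour, h₁, h₂, add_right_inj] at h₃
  rw [hprof]
  exact hℓ _ _ _ _ h₃.symm

/-- All four kinds are mapped by the isomorphism itself; the point to check is that the induced map
on profiles is bijective. -/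
theorem equiv_of_gameIso (φ : GameIso Γ Γ') :
    ∃ e : Vertex Γ ≃ Vertex Γ', (∀ v, colour ℓ (e v) = colour ℓ v) ∧
      ∀ u v, Adj (e u) (e v) ↔ Adj u v := by
  have hprof := φ.toActionMap.profile_player
  have hinj : Injective φ.toActionMap.profile := fun s t h => by
    funext i
    have := congrFun h (φ.player i)
    rw [hprof, hprof] at this
    exact (φ.toActionMap.fiber i).injective this
  have hsurj : Surjective φ.toActionMap.profile := fun t => by
    refine ⟨fun i => (φ.toActionMap.fiber i).symm (t (φ.player i)), ?_⟩
    funext j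
    obtain ⟨i, rfl⟩ := φ.player.surjective j
    rw [hprof, Equiv.apply_symm_apply]
  let f : Vertex Γ → Vertex Γ' := fun v => match v with
    | player i => player (φ.player i)
    | action a => action (φ.action a)
    | profile s => profile (φ.toActionMap.profile s)
    | outcome o => outcome (φ.player o.1, φ.toActionMap.profile o.2)
  have hf : Bijective f := by
    constructor
    · rintro (i | a | s | ⟨i, s⟩) (i' | a' | s' | ⟨i', s'⟩) h <;>
        simp only [f, player.injEq, action.injEq, profile.injEq, outcome.injEq, Prod.mk.injEq,
          reduceCtorEq, EmbeddingLike.apply_eq_iff_eq, hinj.eq_iff] at h ⊢ <;> exact h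
    · rintro (i | a | s | ⟨i, s⟩)
      · exact ⟨player (φ.player.symm i), by simp [f]⟩
      · exact ⟨action (φ.action.symm a), by simp [f]⟩
      · obtain ⟨t, rfl⟩ := hsurj s
        exact ⟨profile t, rfl⟩
      · obtain ⟨t, rfl⟩ := hsurj s
        exact ⟨outcome (φ.player.symm i, t), by simp [f]⟩
  have hrel : ∀ u v, Rel (f u) (f v) ↔ Rel u v := by
    rintro (i | a | s | ⟨i, s⟩) (i' | a' | s' | ⟨i', s'⟩) <;>
      simp only [f, Rel, φ.action_player, EmbeddingLike.apply_eq_iff_eq, hinj.eq_iff]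
    obtain ⟨i, a⟩ := a
    have h₁ : φ.action ⟨i, a⟩ = ⟨φ.player i, φ.toActionMap.fiber i a⟩ :=
      Sigma.ext (φ.action_player ⟨i, a⟩) ((Fin.heq_ext_iff (congrArg Γ'.numActions
        (φ.action_player ⟨i, a⟩))).2 rfl)
    rw [h₁]
    dsimp only
    rw [hprof, EmbeddingLike.apply_eq_iff_eq]
  refine ⟨Equiv.ofBijective f hf, ?_, fun u v => or_congr (hrel u v) (hrel v u)⟩
  rintro (i | a | s | ⟨i, s⟩)
  · rfl
  · rfl
  · rfl
  · exact congrArg (fun q => 4 + ℓ q) (φ.payoff_eq i s).symm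

end Vertex

/-! ### Placing coloured graphs on a common vertex set -/

/-- A bijection between the supports of two colourings extends to all vertices. -/
theorem colouredIso_iff {V : Type} [Finite V] {U U' : Type} {c c' : V → ℕ} {A A' : V → V → Prop}
    {f : U → V} {f' : U' → V} (hf : Injective f) (hf' : Injective f')
    (hc : ∀ v, 0 < c v ↔ ∃ u, f u = v) (hc' : ∀ v, 0 < c' v ↔ ∃ u, f' u = v)
    (hA : ∀ u v, A u v → 0 < c u ∧ 0 < c v) (hA' : ∀ u v, A' u v → 0 < c' u ∧ 0 < c' v) :
    ColouredIso c c' A A' ↔ ∃ g : U ≃ U', (∀ u, c' (f' (g u)) = c (f u)) ∧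
      ∀ u v, A' (f' (g u)) (f' (g v)) ↔ A (f u) (f v) := by
  constructor
  · rintro ⟨e, h₁, h₂⟩
    obtain ⟨g, hg⟩ := exists_equiv_of_forall e hf hf'
      (fun u => by
        obtain ⟨u', hu'⟩ := (hc' (e (f u))).1 (by rw [h₁]; exact (hc _).2 ⟨u, rfl⟩)
        exact ⟨u', hu'.symm⟩)
      (fun u' => by
        obtain ⟨u, hu⟩ := (hc (e.symm (f' u'))).1 (by
          rw [← h₁, e.apply_symm_apply]
          exact (hc' _).2 ⟨u', rfl⟩)
        exact ⟨u, by rw [hu, e.apply_symm_apply]⟩)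
    exact ⟨g, fun u => by rw [← hg, h₁], fun u v => by rw [← hg, ← hg, h₂]⟩
  · rintro ⟨g, h₁, h₂⟩
    classical
    let i : U ≃ {v // 0 < c v} := Equiv.ofBijective (fun u => ⟨f u, (hc _).2 ⟨u, rfl⟩⟩)
      ⟨fun u v h => hf (congrArg Subtype.val h), fun ⟨v, hv⟩ => by
        obtain ⟨u, rfl⟩ := (hc v).1 hv
        exact ⟨u, rfl⟩⟩
    let i' : U' ≃ {v // 0 < c' v} := Equiv.ofBijective (fun u => ⟨f' u, (hc' _).2 ⟨u, rfl⟩⟩)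
      ⟨fun u v h => hf' (congrArg Subtype.val h), fun ⟨v, hv⟩ => by
        obtain ⟨u, rfl⟩ := (hc' v).1 hv
        exact ⟨u, rfl⟩⟩
    let ε : {v // 0 < c v} ≃ {v // 0 < c' v} := i.symm.trans (g.trans i')
    -- By finiteness the complements of the supports are equinumerous; they carry colour `0` and no
    -- edges, so any matching of them will do.
    let e : V ≃ V := ε.extendSubtype
    have he : ∀ u, e (f u) = f' (g u) := fun u => by
      have h := (hc (f u)).2 ⟨u, rfl⟩
      refine (ε.extendSubtype_apply_of_mem _ h).trans ?_
      have hi : i.symm ⟨f u, h⟩ = u := i.symm_apply_apply u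
      simp only [ε, Equiv.trans_apply, hi]
      rfl
    have he' : ∀ v, 0 < c' (e v) ↔ 0 < c v := fun v =>
      ⟨fun h => by
        by_contra hv
        exact ε.extendSubtype_not_mem _ hv h, fun h => ε.extendSubtype_mem _ h⟩
    refine ⟨e, fun v => ?_, fun u v => ?_⟩
    · by_cases hv : 0 < c v
      · obtain ⟨u, rfl⟩ := (hc v).1 hv
        rw [he, h₁]
      · have := mt (he' v).1 hv
        omega
    · by_cases h : 0 < c u ∧ 0 < c v
      · obtain ⟨u, rfl⟩ := (hc u).1 h.1
        obtain ⟨v, rfl⟩ := (hc v).1 h.2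
        rw [he, he, h₂]
      · refine iff_of_false (fun ha => h ?_) fun ha => h (hA _ _ ha)
        exact ⟨(he' u).1 (hA' _ _ ha).1, (he' v).1 (hA' _ _ ha).2⟩

/-- The numbers that describe a game with labelled payoffs: players, actions, profiles, the
actions in the profile with a given number, and the label of the payoff of a player in it. -/
structure GameData where
  /-- The number of players. -/
  players : ℕ
  /-- The number of actions of a player. -/
  actions : ℕ → ℕ
  /-- The number of profiles. -/
  profiles : ℕ
  /-- The action of a player in a profile. -/
  digit : ℕ → ℕ → ℕ
  /-- The label of the payoff of a player in a profile. -/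
  label : ℕ → ℕ → ℕ

namespace GameData

/-- A vertex is given by its kind and two numbers. -/
abbrev Pos (L : ℕ) : Type := Fin 4 × Fin L × Fin L

variable (D : GameData)

/-- The colour of a vertex, with `0` for those that do not occur. -/
def colour (k i x : ℕ) : ℕ :=
  if k = 0 ∧ i < D.players ∧ x = 0 then 1
  else if k = 1 ∧ i < D.players ∧ x < D.actions i then 2
  else if k = 2 ∧ i = 0 ∧ x < D.profiles then 3
  else if k = 3 ∧ i < D.players ∧ x < D.profiles then 4 + D.label i x
  else 0

/-- The edges, in one direction. -/
def Rel (k i x k' i' x' : ℕ) : Prop :=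
  (k = 1 ∧ k' = 0 ∧ i = i') ∨ (k = 1 ∧ k' = 2 ∧ D.digit x' i = x) ∨
    (k = 3 ∧ k' = 0 ∧ i = i') ∨ (k = 3 ∧ k' = 2 ∧ x = x')

/-- Adjacency. -/
def Adj (k i x k' i' x' : ℕ) : Prop :=
  -- `Rel` does not test whether the positions are occupied; this condition removes its spurious
  -- edges.
  (0 < D.colour k i x ∧ 0 < D.colour k' i' x') ∧
    (D.Rel k i x k' i' x' ∨ D.Rel k' i' x' k i x)

/-- The data describe the game `Γ` with payoffs labelled by `ℓ`. -/
structure Describes (ℓ : ℚ → ℕ) (Γ : Game) : Prop where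
  players : D.players = Γ.numPlayers
  actions : ∀ i : Γ.Player, D.actions i = Γ.numActions i
  profiles : D.profiles = ∏ i, Γ.numActions i
  digit : ∀ (k : Fin (∏ i, Γ.numActions i)) (i : Γ.Player), D.digit k i = (finPiFinEquiv.symm k i : ℕ)
  label : ∀ (i : Γ.Player) (k : Fin (∏ i, Γ.numActions i)),
    D.label i k = ℓ (Γ.payoff i (finPiFinEquiv.symm k))

/-- All numbers are small enough. -/
structure Fits (L : ℕ) : Prop where
  players : D.players ≤ L
  actions : ∀ i < D.players, D.actions i ≤ L
  profiles : D.profiles ≤ L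
  pos : 0 < L

variable {D} {ℓ : ℚ → ℕ} {Γ : Game}

/-- The position of a vertex of a game. -/
def Describes.pos (h : D.Describes ℓ Γ) {L : ℕ} (hL : D.Fits L) : Vertex Γ → Pos L
  | .player i => (0, ⟨i, i.2.trans_le (h.players ▸ hL.players)⟩, ⟨0, hL.pos⟩)
  | .action a => (1, ⟨a.1, a.1.2.trans_le (h.players ▸ hL.players)⟩,
      ⟨a.2, a.2.2.trans_le ((h.actions a.1).symm.trans_le
        (hL.actions _ (a.1.2.trans_eq h.players.symm)))⟩)
  | .profile s => (2, ⟨0, hL.pos⟩,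
      ⟨finPiFinEquiv s, (finPiFinEquiv s).2.trans_le (h.profiles ▸ hL.profiles)⟩)
  | .outcome o => (3, ⟨o.1, o.1.2.trans_le (h.players ▸ hL.players)⟩,
      ⟨finPiFinEquiv o.2, (finPiFinEquiv o.2).2.trans_le (h.profiles ▸ hL.profiles)⟩)

theorem Describes.pos_injective (h : D.Describes ℓ Γ) {L : ℕ} (hL : D.Fits L) :
    Injective (h.pos hL) := by
  rintro (i | ⟨i, a⟩ | s | ⟨i, s⟩) (i' | ⟨i', a'⟩ | s' | ⟨i', s'⟩) heq <;>
    simp [pos, ← Fin.ext_iff] at heq ⊢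
  · exact heq
  · obtain ⟨rfl, ha⟩ := heq
    exact ⟨rfl, heq_of_eq (Fin.ext ha)⟩
  · exact heq
  · exact heq

theorem Describes.colour_pos (h : D.Describes ℓ Γ) {L : ℕ} (hL : D.Fits L) (v : Vertex Γ) :
    D.colour (h.pos hL v).1 (h.pos hL v).2.1 (h.pos hL v).2.2 = v.colour ℓ := by
  rcases v with i | ⟨i, a⟩ | s | ⟨i, s⟩
  · simp [pos, colour, Vertex.colour, h.players]
  · simp [pos, colour, Vertex.colour, h.players, h.actions]
  · have := (finPiFinEquiv s).2
    simp [pos, colour, Vertex.colour, h.profiles]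
  · have := (finPiFinEquiv s).2
    simp [pos, colour, Vertex.colour, h.profiles, h.players, h.label]

theorem Describes.exists_pos (h : D.Describes ℓ Γ) {L : ℕ} (hL : D.Fits L) (x : Pos L) :
    0 < D.colour x.1 x.2.1 x.2.2 ↔ ∃ v, h.pos hL v = x := by
  constructor
  · obtain ⟨⟨k, hk⟩, ⟨i, hi⟩, ⟨x, hx⟩⟩ := x
    intro hpos
    simp only [colour] at hpos
    split_ifs at hpos with h₁ h₂ h₃ h₄
    · obtain ⟨rfl, hi', rfl⟩ := h₁
      exact ⟨.player ⟨i, h.players ▸ hi'⟩, rfl⟩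
    · obtain ⟨rfl, hi', hx'⟩ := h₂
      exact ⟨.action ⟨⟨i, h.players ▸ hi'⟩, ⟨x, hx'.trans_eq (h.actions ⟨i, h.players ▸ hi'⟩)⟩⟩, rfl⟩
    · obtain ⟨rfl, rfl, hx'⟩ := h₃
      refine ⟨.profile (finPiFinEquiv.symm ⟨x, h.profiles ▸ hx'⟩), ?_⟩
      simp [pos]
    · obtain ⟨rfl, hi', hx'⟩ := h₄
      refine ⟨.outcome (⟨i, h.players ▸ hi'⟩, finPiFinEquiv.symm ⟨x, h.profiles ▸ hx'⟩), ?_⟩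
      simp [pos]
    · omega
  · rintro ⟨v, rfl⟩
    rw [h.colour_pos]
    rcases v with i | a | s | o <;> simp only [Vertex.colour] <;> omega

theorem Describes.adj_pos (h : D.Describes ℓ Γ) {L : ℕ} (hL : D.Fits L) (u v : Vertex Γ) :
    D.Adj (h.pos hL u).1 (h.pos hL u).2.1 (h.pos hL u).2.2
      (h.pos hL v).1 (h.pos hL v).2.1 (h.pos hL v).2.2 ↔ u.Adj v := by
  have hr : ∀ u v : Vertex Γ, D.Rel (h.pos hL u).1 (h.pos hL u).2.1 (h.pos hL u).2.2
      (h.pos hL v).1 (h.pos hL v).2.1 (h.pos hL v).2.2 ↔ u.Rel v := by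
    rintro (i | ⟨i, a⟩ | s | ⟨i, s⟩) (i' | ⟨i', a'⟩ | s' | ⟨i', s'⟩) <;>
      simp [pos, Rel, Vertex.Rel, h.digit, ← Fin.ext_iff]
  rw [Adj, and_iff_right, hr, hr]
  · rfl
  · exact ⟨(h.exists_pos hL _).2 ⟨u, rfl⟩, (h.exists_pos hL _).2 ⟨v, rfl⟩⟩

theorem colouredIso_iff_gameIso {D' : GameData} {Γ' : Game} {L : ℕ} (h : D.Describes ℓ Γ)
    (h' : D'.Describes ℓ Γ') (hL : D.Fits L) (hL' : D'.Fits L)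
    (hℓ : ∀ i s j t, ℓ (Γ.payoff i s) = ℓ (Γ'.payoff j t) → Γ.payoff i s = Γ'.payoff j t) :
    ColouredIso (fun x : Pos L => D.colour x.1 x.2.1 x.2.2)
      (fun x : Pos L => D'.colour x.1 x.2.1 x.2.2)
      (fun x y => D.Adj x.1 x.2.1 x.2.2 y.1 y.2.1 y.2.2)
      (fun x y => D'.Adj x.1 x.2.1 x.2.2 y.1 y.2.1 y.2.2) ↔ Nonempty (GameIso Γ Γ') := by
  rw [colouredIso_iff (h.pos_injective hL) (h'.pos_injective hL') (h.exists_pos hL)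
    (h'.exists_pos hL') (fun _ _ ha => ha.1) (fun _ _ ha => ha.1)]
  simp only [h.colour_pos, h'.colour_pos, h.adj_pos, h'.adj_pos]
  constructor
  · rintro ⟨e, hc, hA⟩
    exact Vertex.gameIso_of_equiv hℓ e hc hA
  · rintro ⟨φ⟩
    exact Vertex.equiv_of_gameIso φ

end GameData

/-! ### Reading games from a word -/

/-- The end of the self-delimiting code of a bit string that starts at position `q`. -/
noncomputable def bitsEnd (w : List Bool) (q : ℕ) : ℕ :=
  q + (2 * least (fun j => ¬w[q + 2 * j]? = some true) w.length + 1)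

/-- The symbols at even offsets are continuation flags, so the first flag that is not `true` stands
at twice the length of the string. -/
theorem bitsEnd_eq {w l t : List Bool} {q : ℕ} (h : w.drop q = encodeBits l ++ t) :
    bitsEnd w q = q + (encodeBits l).length := by
  have hl : (encodeBits l).length = 2 * l.length + 1 := by
    simp [encodeBits, List.length_flatMap, mul_comm]
  have hlen := length_le_of_drop h
  rw [List.length_append, hl] at hlen
  have hbit : ∀ (l t : List Bool) (j : ℕ), j ≤ l.length →
      ((encodeBits l ++ t)[2 * j]? = some true ↔ j < l.length) := fun l => by
    induction l with
    | nil =>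
      intro t j hj
      obtain rfl : j = 0 := by simpa using hj
      simp [encodeBits]
    | cons b l ih =>
      intro t j hj
      cases j with
      | zero => simp [encodeBits]
      | succ j =>
        have := ih t j (by simpa using hj)
        simpa [encodeBits, mul_add] using this
  have : least (fun j => ¬w[q + 2 * j]? = some true) w.length = l.length := by
    refine least_eq (by omega) (fun i hi => ?_) fun _ => ?_
    · rw [getElem?_of_drop h, hbit l t i hi.le]
      exact not_not.2 hi
    · rw [getElem?_of_drop h, hbit l t _ le_rfl]
      exact lt_irrefl _
  rw [bitsEnd, this, hl]

theorem bitsEnd_le (w : List Bool) (q : ℕ) : bitsEnd w q ≤ q + (2 * w.length + 1) := by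
  have := least_le (fun j => ¬w[q + 2 * j]? = some true) w.length
  rw [bitsEnd]
  omega

theorem PF.bitsEnd {f : Env → ℕ} (hf : PF f) : PF fun e => bitsEnd e.word (f e) :=
  hf.add (((PF.const 2).mul (PF.least (p := fun e j => ¬e.word[f e + 2 * j]? = some true) .length
    (PP.bitAt (hf.tail.add ((PF.const 2).mul (.var 0)))).not)).succ)

/-- The end of the code of a rational number that starts at position `q`. -/
noncomputable def ratEnd (w : List Bool) (q : ℕ) : ℕ := bitsEnd w (bitsEnd w (q + 1))

theorem ratEnd_eq {w t : List Bool} {q : ℕ} {x : ℚ} (h : w.drop q = encodeRat x ++ t) :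
    ratEnd w q = q + (encodeRat x).length := by
  have h₁ : w.drop (q + 1) = encodeNat x.num.natAbs ++ (encodeNat x.den ++ t) := by
    rw [← List.append_assoc]
    exact drop_add_of_drop (u := [decide (x.num < 0)]) h
  have h₂ := bitsEnd_eq h₁
  have h₃ : w.drop (bitsEnd w (q + 1)) = encodeNat x.den ++ t := by
    rw [h₂]
    exact drop_add_of_drop h₁
  rw [ratEnd, bitsEnd_eq h₃, h₂]
  simp only [encodeRat, encodeNat, List.length_cons, List.length_append]
  omega

theorem ratEnd_le (w : List Bool) (q : ℕ) : ratEnd w q ≤ q + (4 * w.length + 3) := by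
  have h₁ := bitsEnd_le w (q + 1)
  have h₂ := bitsEnd_le w (bitsEnd w (q + 1))
  rw [ratEnd]
  omega

theorem PF.ratEnd {f : Env → ℕ} (hf : PF f) : PF fun e => ratEnd e.word (f e) :=
  hf.succ.bitsEnd.bitsEnd

/-- The position of the number of actions of player `i` in the game code at position `p`, and the
position of the payoff table for `i` the number of players. -/
noncomputable def actionsPos (w : List Bool) (p i : ℕ) : ℕ :=
  Nat.rec (p + (unaryAt w p + 1)) (fun _ q => q + (unaryAt w q + 1)) i

/-- The number of actions of player `i`. -/
noncomputable def actionsAt (w : List Bool) (p i : ℕ) : ℕ := unaryAt w (actionsPos w p i)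

/-- The product of the numbers of actions of the players before `i`, capped by the length of the
word. -/
noncomputable def strideAt (w : List Bool) (p i : ℕ) : ℕ :=
  Nat.rec 1 (fun j a => min (a * actionsAt w p j) w.length) i

/-- The end of the row of payoffs that starts at position `q`. -/
noncomputable def rowEnd (w : List Bool) (p q : ℕ) : ℕ :=
  Nat.rec q (fun _ y => ratEnd w y) (unaryAt w p)

/-- The position of row `k` of the payoff table. -/
noncomputable def rowPos (w : List Bool) (p k : ℕ) : ℕ :=
  Nat.rec (actionsPos w p (unaryAt w p)) (fun _ q => rowEnd w p q) k

/-- The position of the payoff of player `i` in the profile with number `k`. -/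
noncomputable def payoffPos (w : List Bool) (p k i : ℕ) : ℕ :=
  Nat.rec (rowPos w p k) (fun _ y => ratEnd w y) i

/-- The end of the game code at position `p`. -/
noncomputable def gameEnd (w : List Bool) (p : ℕ) : ℕ := rowPos w p (strideAt w p (unaryAt w p))

namespace PF

variable {f g h : Env → ℕ}

theorem actionsPos (hf : PF f) (hg : PF g) : PF fun e => actionsPos e.word (f e) (g e) :=
  iterate_add (f := fun e _ q => q + (GameIsoGI.unaryAt e.word q + 1))
    (b := fun e => e.word.length + 1) hg (hf.add hf.unaryAt.succ)
    ((PF.var 0).add (PF.var 0).unaryAt.succ) PF.length.succ fun _ _ _ =>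
      Nat.add_le_add_left (Nat.succ_le_succ (unaryAt_le _ _)) _

theorem actionsAt (hf : PF f) (hg : PF g) : PF fun e => actionsAt e.word (f e) (g e) :=
  (hf.actionsPos hg).unaryAt

theorem strideAt (hf : PF f) (hg : PF g) : PF fun e => strideAt e.word (f e) (g e) :=
  -- The cap keeps the iteration bounded on every word; the extra `1` covers the starting value,
  -- which exceeds the cap for the empty word.
  iterate (f := fun e j a => Min.min (a * GameIsoGI.actionsAt e.word (f e) j) e.word.length)
    (g := fun e => e.word.length + 1) hg (.const 1)
    (((PF.var 0).mul (hf.tail.tail.actionsAt (.var 1))).min .length) PF.length.succ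
    fun e i _ => by
      cases i with
      | zero => exact Nat.succ_le_succ (Nat.zero_le _)
      | succ i => exact (min_le_right _ _).trans (Nat.le_succ _)

theorem rowEnd (hf : PF f) (hg : PF g) : PF fun e => rowEnd e.word (f e) (g e) :=
  iterate_add (f := fun e _ q => GameIsoGI.ratEnd e.word q) (b := fun e => 4 * e.word.length + 3)
    hf.unaryAt hg (PF.var 0).ratEnd (((PF.const 4).mul .length).add (.const 3))
    fun _ _ _ => ratEnd_le _ _

theorem rowPos (hf : PF f) (hg : PF g) : PF fun e => rowPos e.word (f e) (g e) :=
  iterate_add (f := fun e _ q => GameIsoGI.rowEnd e.word (f e) q)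
    (b := fun e => e.word.length * (4 * e.word.length + 3))
    hg (hf.actionsPos hf.unaryAt) (hf.tail.tail.rowEnd (.var 0))
    (PF.length.mul (((PF.const 4).mul .length).add (.const 3)))
    fun e _ _ => (iterate_le_add (fun _ => ratEnd_le e.word) le_rfl).trans
      (Nat.add_le_add_left (Nat.mul_le_mul_right _ (unaryAt_le _ _)) _)

theorem payoffPos (hf : PF f) (hg : PF g) (hh : PF h) :
    PF fun e => payoffPos e.word (f e) (g e) (h e) :=
  iterate_add (f := fun e _ q => GameIsoGI.ratEnd e.word q) (b := fun e => 4 * e.word.length + 3)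
    hh (hf.rowPos hg) (PF.var 0).ratEnd (((PF.const 4).mul .length).add (.const 3))
    fun _ _ _ => ratEnd_le _ _

theorem gameEnd (hf : PF f) : PF fun e => gameEnd e.word (f e) :=
  hf.rowPos (hf.strideAt hf.unaryAt)

end PF

/-! ### Labelling payoffs by positions in the input -/

/-- The first occurrence of the code of a rational number in a word. -/
noncomputable def occurrence (w : List Bool) (x : ℚ) : ℕ :=
  least (fun q => encodeRat x <+: w.drop q) w.length

/-- The first occurrence of the rational code that starts at position `a`. -/
noncomputable def labelAt (w : List Bool) (a : ℕ) : ℕ :=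
  least (fun q => q + (ratEnd w a - a) ≤ w.length ∧
    ∀ j < ratEnd w a - a, (w[q + j]? = some true ↔ w[a + j]? = some true)) w.length

/-- Comparing two stretches of the word bit by bit amounts to searching for the code of `x`. The
occurrence found need not be an entry of a table; only its dependence on `x` alone matters. -/
theorem labelAt_eq {w t : List Bool} {a : ℕ} {x : ℚ} (h : w.drop a = encodeRat x ++ t) :
    labelAt w a = occurrence w x := by
  have hr : ratEnd w a - a = (encodeRat x).length := by
    rw [ratEnd_eq h]
    omega
  unfold labelAt occurrence
  congr 1
  funext q
  rw [hr]
  refine propext ⟨fun ⟨h₁, h₂⟩ => ?_, fun ⟨u, hu⟩ => ⟨?_, fun j hj => ?_⟩⟩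
  · rw [List.prefix_iff_getElem?]
    intro j hj
    have h₃ := h₂ j hj
    rw [getElem?_of_drop h, List.getElem?_append_left hj, List.getElem?_eq_getElem hj,
      List.getElem?_eq_getElem (by omega : q + j < w.length)] at h₃
    rw [List.getElem?_drop, List.getElem?_eq_getElem (by omega : q + j < w.length)]
    simp only [Option.some.injEq] at h₃ ⊢
    exact Bool.eq_iff_iff.2 h₃
  · have h₁ := congrArg List.length hu
    have h₂ : 0 < (encodeRat x).length := Nat.succ_pos _
    rw [List.length_append, List.length_drop] at h₁
    omega
  · rw [getElem?_of_drop h, getElem?_of_drop hu.symm, List.getElem?_append_left hj,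
      List.getElem?_append_left hj]

/-- Two codes that begin at the same place of a word coincide, since the code of rationals is
prefix-free and in lowest terms. -/
theorem occurrence_injective {w t t' : List Bool} {a a' : ℕ} {x x' : ℚ}
    (h : w.drop a = encodeRat x ++ t) (h' : w.drop a' = encodeRat x' ++ t')
    (heq : occurrence w x = occurrence w x') : x = x' := by
  have hlt : ∀ {t a x}, w.drop a = encodeRat x ++ t → encodeRat x <+: w.drop (occurrence w x) :=
    fun {t a x} h => (least_spec (p := fun q => encodeRat x <+: w.drop q) ⟨a, by
      by_contra hn
      rw [List.drop_of_length_le (not_lt.1 hn)] at h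
      exact absurd h (by simp [encodeRat]), ⟨t, h.symm⟩⟩).1
  obtain ⟨u, hu⟩ := hlt h
  obtain ⟨u', hu'⟩ := hlt h'
  rw [heq] at hu
  exact (prefixDecodable_rat _ _ _ _ (hu.trans hu'.symm)).1

theorem PF.labelAt {f : Env → ℕ} (hf : PF f) : PF fun e => labelAt e.word (f e) := by
  have hl : PF fun e => GameIsoGI.ratEnd e.word (f e) - f e := hf.ratEnd.sub hf
  refine PF.least .length ((PP.le ((PF.var 0).add hl.tail) .length).and (PP.forall_lt hl.tail ?_))
  exact (PP.bitAt ((PF.var 1).add (.var 0))).iff (PP.bitAt (hf.tail.tail.add (.var 0)))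

/-- The description of the game whose code starts at position `p`. -/
noncomputable def gameDataAt (w : List Bool) (p : ℕ) : GameData where
  players := unaryAt w p
  actions := actionsAt w p
  profiles := strideAt w p (unaryAt w p)
  digit k i := k / strideAt w p i % actionsAt w p i
  label i k := labelAt w (payoffPos w p k i)

theorem le_length_encodeFun {α : Type} {c : α → List Bool} (hc : ∀ x, 0 < (c x).length) {n : ℕ}
    (f : Fin n → α) : n ≤ (encodeFun c f).length := by
  rw [encodeFun, List.length_flatten, List.map_ofFn, List.sum_ofFn]
  calc n = ∑ _i : Fin n, 1 := by simp
    _ ≤ _ := Finset.sum_le_sum fun i _ => hc _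

/-- Gives the position itself and not only the remaining word, as is needed to use a parsed row as
one jump of the next iteration. -/
theorem iterate_end_eq {α : Type} {c : α → List Bool} {nx : ℕ → ℕ} {w t : List Bool} {n q : ℕ}
    {f : Fin n → α} (hnx : ∀ q x t, w.drop q = c x ++ t → nx q = q + (c x).length)
    (h : w.drop q = encodeFun c f ++ t) :
    Nat.rec q (fun _ y => nx y) n = q + (encodeFun c f).length := by
  have : ∀ i ≤ n, Nat.rec q (fun _ y => nx y) i =
      q + ((List.ofFn fun i => c (f i)).take i).flatten.length := fun i hi => by
    induction i with
    | zero => simp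
    | succ i ih =>
      obtain ⟨t', h'⟩ := exists_drop_iterate hnx h ⟨i, hi⟩
      have h₁ := hnx _ _ _ h'
      dsimp only at h₁ ⊢
      rw [h₁, ih (Nat.le_of_succ_le hi), List.take_succ_eq_append_getElem (by simpa using hi),
        List.flatten_append, List.length_append, List.getElem_ofFn]
      simp [add_assoc]
  rw [this n le_rfl, List.take_of_length_le (by simp)]
  rfl

/-- Partial products divide the full product of positive numbers, which is at most the length of the
word, so the cap never takes effect. -/
theorem strideAt_eq {w : List Bool} {p n : ℕ} {m : Fin n → ℕ}
    (hm : ∀ i : Fin n, actionsAt w p i = m i) (hpos : ∀ i, 0 < m i) (hle : ∏ i, m i ≤ w.length)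
    {i : ℕ} (hi : i ≤ n) : strideAt w p i = ∏ j : Fin i, m (Fin.castLE hi j) := by
  have hdvd : ∀ i (hi : i ≤ n), ∏ j : Fin i, m (Fin.castLE hi j) ≤ w.length := fun i hi => by
    refine (Nat.le_of_dvd (Finset.prod_pos fun i _ => hpos i) ?_).trans hle
    have := Finset.prod_dvd_prod_of_subset _ _ m
      (Finset.subset_univ (Finset.univ.map (Fin.castLEEmb hi)))
    rwa [Finset.prod_map] at this
  induction i with
  | zero => rfl
  | succ i ih =>
    change min (strideAt w p i * actionsAt w p i) w.length = _
    have h := hdvd (i + 1) hi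
    rw [Fin.prod_univ_castSucc] at h ⊢
    rw [ih (Nat.le_of_succ_le hi), hm ⟨i, hi⟩]
    exact min_eq_left h

theorem drop_game {w t : List Bool} {p : ℕ} {Γ : Game} (h : w.drop p = encodeGame Γ ++ t) :
    w.drop (gameEnd w p) = t ∧ (gameDataAt w p).Describes (occurrence w) Γ ∧
      (gameDataAt w p).Fits w.length ∧
      ∀ i s, ∃ a u, w.drop a = encodeRat (Γ.payoff i s) ++ u := by
  rw [encodeGame, List.append_assoc, List.append_assoc] at h
  have hn := unaryAt_eq h
  have h₁ := drop_add_of_drop h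
  rw [show (encodeUnary Γ.numPlayers).length = unaryAt w p + 1 by rw [hn, length_encodeUnary]] at h₁
  have hnu : ∀ (q x : ℕ) t, w.drop q = encodeUnary x ++ t →
      q + (unaryAt w q + 1) = q + (encodeUnary x).length := fun q x t h => by
    rw [unaryAt_eq h, length_encodeUnary]
  have hact : ∀ i : Γ.Player, actionsAt w p i = Γ.numActions i := fun i => by
    obtain ⟨t', h'⟩ := exists_drop_iterate (nx := fun q => q + (unaryAt w q + 1)) hnu h₁ i
    exact unaryAt_eq h'
  have h₂ := (congrArg (fun i => w.drop (actionsPos w p i)) hn).trans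
    (drop_iterate_end (nx := fun q => q + (unaryAt w q + 1)) hnu h₁)
  have hnr : ∀ (q : ℕ) (x : ℚ) t, w.drop q = encodeRat x ++ t →
      ratEnd w q = q + (encodeRat x).length := fun q x t h => ratEnd_eq h
  have hrow : ∀ (q : ℕ) (row : Γ.Player → ℚ) t, w.drop q = encodeFun encodeRat row ++ t →
      rowEnd w p q = q + (encodeFun encodeRat row).length := fun q row t h => by
    rw [← iterate_end_eq hnr h, rowEnd, hn]
  have hpay : ∀ (i : Γ.Player) (k : Fin (∏ i, Γ.numActions i)), ∃ u,
      w.drop (payoffPos w p k i) = encodeRat (Γ.payoff i (finPiFinEquiv.symm k)) ++ u :=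
    fun i k => by
      obtain ⟨t', h'⟩ := exists_drop_iterate hrow h₂ k
      exact exists_drop_iterate hnr h' i
  -- The table has one row per profile, and a row is nonempty because there is at least one player.
  have hle : ∏ i, Γ.numActions i ≤ w.length := by
    have h₃ := length_le_of_drop h₂
    rw [List.length_append] at h₃
    refine (le_length_encodeFun (fun row => ?_) _).trans (Nat.le_of_add_right_le h₃)
    exact Γ.numPlayers_pos.trans_le (le_length_encodeFun (c := encodeRat) (fun x => Nat.succ_pos _) row)
  have hstride : ∀ {i : ℕ} (hi : i ≤ Γ.numPlayers), _ :=
    fun {i} hi => strideAt_eq hact Γ.numActions_pos hle hi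
  have hprof : strideAt w p (unaryAt w p) = ∏ i, Γ.numActions i := by
    rw [hn, hstride le_rfl]
    rfl
  refine ⟨?_, ⟨hn, hact, hprof, fun k i => ?_, fun i k => ?_⟩,
    ⟨unaryAt_le _ _, fun i _ => unaryAt_le _ _, hprof.trans_le hle,
      (Finset.prod_pos fun i _ => Γ.numActions_pos i).trans_le hle⟩, fun i s => ?_⟩
  · rw [gameEnd, hprof]
    exact drop_iterate_end hrow h₂
  · rw [val_finPiFinEquiv_symm, ← hstride i.2.le, ← hact]
    rfl
  · obtain ⟨u, hu⟩ := hpay i k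
    exact labelAt_eq hu
  · obtain ⟨u, hu⟩ := hpay i (finPiFinEquiv s)
    rw [Equiv.symm_apply_apply] at hu
    exact ⟨_, u, hu⟩

/-! ### Isomorphism of games reduces to graph isomorphism -/

namespace GameData

variable (D : GameData) (L : ℕ)

/-- The number of positions. -/
abbrev card : ℕ := 4 * (L * L)

/-- The number of pendant vertices of a vertex. -/
def pendants (k i x : ℕ) : ℕ := (D.colour k i x + 1) * (card L + 1)

/-- A bound for the number of pendant vertices. -/
abbrev maxPendants : ℕ := (L + 5) * (card L + 1)

/-- The largest colour is `4 + L`, which explains the factor `L + 5`. -/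
theorem pendants_le (h : ∀ i x, D.label i x ≤ L) (k i x : ℕ) : D.pendants L k i x ≤ maxPendants L := by
  refine Nat.mul_le_mul_right _ ?_
  have := h i x
  rw [colour]
  split_ifs <;> omega

theorem adj_symm (k i x k' i' x' : ℕ) (h : D.Adj k i x k' i' x') : D.Adj k' i' x' k i x :=
  ⟨h.1.symm, h.2.symm⟩

theorem not_adj_self (k i x : ℕ) : ¬D.Adj k i x k i x := by
  rintro ⟨-, h⟩
  rw [or_self, Rel] at h
  omega

/-- The numbering of the vertices. -/
def vertexEquiv : Pos L × Fin (maxPendants L + 1) ≃ Fin (card L * (maxPendants L + 1)) :=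
  ((((Equiv.refl (Fin 4)).prodCongr finProdFinEquiv).trans finProdFinEquiv).prodCongr
    (Equiv.refl _)).trans finProdFinEquiv

/-- The graph with pendant vertices. -/
def posGraph : SimpleGraph (Pos L × Fin (maxPendants L + 1)) :=
  pendantGraph (maxPendants L + 1) (fun x : Pos L => D.pendants L x.1 x.2.1 x.2.2)
    (fun x y => D.Adj x.1 x.2.1 x.2.2 y.1 y.2.1 y.2.2) (fun _ _ h => D.adj_symm _ _ _ _ _ _ h)
    fun _ => D.not_adj_self _ _ _

/-- The graph of the data, with numbered vertices. -/
def finGraph : FinGraph := ⟨_, (D.posGraph L).comap (vertexEquiv L).symm⟩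

/-- Adjacency in `finGraph`. -/
def GraphAdj (y z : ℕ) : Prop :=
  (y % (maxPendants L + 1) = 0 ∧ z % (maxPendants L + 1) = 0 ∧
      D.Adj (y / (maxPendants L + 1) / (L * L)) (y / (maxPendants L + 1) % (L * L) / L)
        (y / (maxPendants L + 1) % (L * L) % L) (z / (maxPendants L + 1) / (L * L))
        (z / (maxPendants L + 1) % (L * L) / L) (z / (maxPendants L + 1) % (L * L) % L)) ∨
    (y / (maxPendants L + 1) = z / (maxPendants L + 1) ∧
      ((y % (maxPendants L + 1) = 0 ∧ 0 < z % (maxPendants L + 1) ∧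
          z % (maxPendants L + 1) ≤ D.pendants L (y / (maxPendants L + 1) / (L * L))
            (y / (maxPendants L + 1) % (L * L) / L) (y / (maxPendants L + 1) % (L * L) % L)) ∨
        (z % (maxPendants L + 1) = 0 ∧ 0 < y % (maxPendants L + 1) ∧
          y % (maxPendants L + 1) ≤ D.pendants L (y / (maxPendants L + 1) / (L * L))
            (y / (maxPendants L + 1) % (L * L) / L) (y / (maxPendants L + 1) % (L * L) % L))))

/-- The numbering is mixed-radix, so the coordinates of a vertex are quotients and remainders of its
number by definition. Only the equality of first components needs an argument. -/
theorem finGraph_adj (y z : Fin (card L * (maxPendants L + 1))) :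
    (D.finGraph L).graph.Adj y z ↔ D.GraphAdj L y z := by
  have : ((vertexEquiv L).symm y).1 = ((vertexEquiv L).symm z).1 ↔
      (y : ℕ) / (maxPendants L + 1) = z / (maxPendants L + 1) := by
    change ((((Equiv.refl (Fin 4)).prodCongr finProdFinEquiv).trans finProdFinEquiv).symm
      (y.divNat)) = ((((Equiv.refl (Fin 4)).prodCongr finProdFinEquiv).trans finProdFinEquiv).symm
      (z.divNat)) ↔ _
    rw [EmbeddingLike.apply_eq_iff_eq, Fin.ext_iff]
    rfl
  refine or_congr Iff.rfl (and_congr this Iff.rfl)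

variable {D L}

theorem finGraph_iso_iff {D' : GameData} (h0 : 0 < L) (h : ∀ i x, D.label i x ≤ L)
    (h' : ∀ i x, D'.label i x ≤ L) :
    Nonempty ((D.finGraph L).graph ≃g (D'.finGraph L).graph) ↔
      ColouredIso (fun x : Pos L => D.colour x.1 x.2.1 x.2.2)
        (fun x : Pos L => D'.colour x.1 x.2.1 x.2.2)
        (fun x y => D.Adj x.1 x.2.1 x.2.2 y.1 y.2.1 y.2.2)
        (fun x y => D'.Adj x.1 x.2.1 x.2.2 y.1 y.2.1 y.2.2) := by
  have : Nonempty (Pos L) := ⟨(0, ⟨0, h0⟩, ⟨0, h0⟩)⟩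
  have hcard : Fintype.card (Pos L) = card L := by simp
  have hiso : Nonempty ((D.finGraph L).graph ≃g (D'.finGraph L).graph) ↔
      Nonempty (D.posGraph L ≃g D'.posGraph L) :=
    ⟨fun ⟨e⟩ => ⟨((SimpleGraph.Iso.comap (vertexEquiv L).symm (D.posGraph L)).symm.trans e).trans
        (SimpleGraph.Iso.comap (vertexEquiv L).symm (D'.posGraph L))⟩,
      fun ⟨e⟩ => ⟨((SimpleGraph.Iso.comap (vertexEquiv L).symm (D.posGraph L)).trans e).trans
        (SimpleGraph.Iso.comap (vertexEquiv L).symm (D'.posGraph L)).symm⟩⟩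
  have := pendantGraph_iso_iff (V := Pos L) (T := maxPendants L)
    (c := fun x : Pos L => D.colour x.1 x.2.1 x.2.2)
    (c' := fun x : Pos L => D'.colour x.1 x.2.1 x.2.2)
    (A := fun x y => D.Adj x.1 x.2.1 x.2.2 y.1 y.2.1 y.2.2)
    (A' := fun x y => D'.Adj x.1 x.2.1 x.2.2 y.1 y.2.1 y.2.2)
    (hs := fun _ _ h => D.adj_symm _ _ _ _ _ _ h) (hs' := fun _ _ h => D'.adj_symm _ _ _ _ _ _ h)
    (hi := fun _ => D.not_adj_self _ _ _) (hi' := fun _ => D'.not_adj_self _ _ _)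
  simp only [hcard] at this
  exact hiso.trans (this (fun v => D.pendants_le L h _ _ _) fun v => D'.pendants_le L h' _ _ _)

end GameData

/-- The code of the graph of the game whose code starts at position `p`. -/
noncomputable def graphWord (w : List Bool) (p : ℕ) : List Bool :=
  open Classical in
  encodeUnary (GameData.card w.length * (GameData.maxPendants w.length + 1)) ++
    (List.range (GameData.card w.length * (GameData.maxPendants w.length + 1))).flatMap fun y =>
      (List.range (GameData.card w.length * (GameData.maxPendants w.length + 1))).flatMap fun z =>
        [decide ((gameDataAt w p).GraphAdj w.length y z)]

theorem graphWord_eq (w : List Bool) (p : ℕ) :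
    graphWord w p = encodeGraph ((gameDataAt w p).finGraph w.length) := by
  classical
  rw [graphWord, encodeGraph, encodeFun_eq_flatMap_range _ _ (fun y => (List.range
    (GameData.card w.length * (GameData.maxPendants w.length + 1))).flatMap fun z =>
        [decide ((gameDataAt w p).GraphAdj w.length y z)])]
  · rfl
  · intro y
    refine encodeFun_eq_flatMap_range _ _ _ fun z => ?_
    simp only [encodeBit, List.cons.injEq, and_true, decide_eq_decide]
    exact GameData.finGraph_adj _ _ _ _

theorem PF.colour {f k i x : Env → ℕ} (hf : PF f) (hk : PF k) (hi : PF i) (hx : PF x) :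
    PF fun e => (gameDataAt e.word (f e)).colour (k e) (i e) (x e) := by
  have hp := hf.unaryAt
  have hN := hf.strideAt hp
  have hm := hf.actionsAt hi
  have hl := (hf.payoffPos hx hi).labelAt
  exact PP.ite ((PP.eq hk .zero).and ((PP.lt hi hp).and (PP.eq hx .zero))) (.const 1)
    (PP.ite ((PP.eq hk (.const 1)).and ((PP.lt hi hp).and (PP.lt hx hm))) (.const 2)
      (PP.ite ((PP.eq hk (.const 2)).and ((PP.eq hi .zero).and (PP.lt hx hN))) (.const 3)
        (PP.ite ((PP.eq hk (.const 3)).and ((PP.lt hi hp).and (PP.lt hx hN)))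
          ((PF.const 4).add hl) .zero)))

theorem PP.rel {f k i x k' i' x' : Env → ℕ} (hf : PF f) (hk : PF k) (hi : PF i) (hx : PF x)
    (hk' : PF k') (hi' : PF i') (hx' : PF x') :
    PP fun e => (gameDataAt e.word (f e)).Rel (k e) (i e) (x e) (k' e) (i' e) (x' e) := by
  have hd := (hx'.div (hf.strideAt hi)).mod (hf.actionsAt hi)
  exact ((PP.eq hk (.const 1)).and ((PP.eq hk' .zero).and (PP.eq hi hi'))).or
    (((PP.eq hk (.const 1)).and ((PP.eq hk' (.const 2)).and (PP.eq hd hx))).or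
      (((PP.eq hk (.const 3)).and ((PP.eq hk' .zero).and (PP.eq hi hi'))).or
        ((PP.eq hk (.const 3)).and ((PP.eq hk' (.const 2)).and (PP.eq hx hx')))))

theorem PP.graphAdj {f y z : Env → ℕ} (hf : PF f) (hy : PF y) (hz : PF z) :
    PP fun e => (gameDataAt e.word (f e)).GraphAdj e.word.length (y e) (z e) := by
  have hL2 := PF.length.mul .length
  have hM := ((PF.const 4).mul hL2).succ
  have hT := ((PF.length.add (.const 5)).mul hM).succ
  have hy₀ := hy.mod hT
  have hz₀ := hz.mod hT
  have hy₁ := hy.div hT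
  have hz₁ := hz.div hT
  have hyk := hy₁.div hL2
  have hyi := (hy₁.mod hL2).div .length
  have hyx := (hy₁.mod hL2).mod .length
  have hzk := hz₁.div hL2
  have hzi := (hz₁.mod hL2).div .length
  have hzx := (hz₁.mod hL2).mod .length
  have hyc := hf.colour hyk hyi hyx
  have hzc := hf.colour hzk hzi hzx
  have hyh := hyc.succ.mul hM
  have hadj := ((PP.of_pos hyc).and (PP.of_pos hzc)).and
    ((PP.rel hf hyk hyi hyx hzk hzi hzx).or (PP.rel hf hzk hzi hzx hyk hyi hyx))
  exact ((PP.eq hy₀ .zero).and ((PP.eq hz₀ .zero).and hadj)).or ((PP.eq hy₁ hz₁).and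
    (((PP.eq hy₀ .zero).and ((PP.lt .zero hz₀).and (PP.le hz₀ hyh))).or
      ((PP.eq hz₀ .zero).and ((PP.lt .zero hy₀).and (PP.le hy₀ hyh)))))

theorem outF_graphWord {f : Env → ℕ} (hf : PF f) : OutF fun e => graphWord e.word (f e) := by
  classical
  have hM := (PF.const 4).mul (PF.length.mul .length)
  have hT := ((PF.length.add (.const 5)).mul hM.succ).succ
  have hn := hM.mul hT
  exact (OutF.unary hn).append (OutF.range hn (OutF.range hn.tail
    (OutF.ofPP (PP.graphAdj hf.tail.tail (.var 1) (.var 0)))))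

/-- Both descriptions are read from the same word, with its length as the common size `L`. Thus both
graphs have the same order and their payoff colours are comparable. The class `C` plays no part,
since membership in GI passes to restricted inputs. -/
theorem gameIso_reduces (C : Game → Prop) :
    PolyTimeReduces (gameIsoProblemOn C) graphIsoProblem := by
  let w := (gameIsoProblemOn C).encode
  refine ⟨fun x => ((gameDataAt (w x) 0).finGraph (w x).length,
    (gameDataAt (w x) (gameEnd (w x) 0)).finGraph (w x).length), ?_, fun x => ?_⟩
  · refine OutF.computableInPolyTime
      (F := fun e => graphWord e.word 0 ++ graphWord e.word (gameEnd e.word 0))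
      ((outF_graphWord .zero).append (outF_graphWord PF.zero.gameEnd)) fun x => ?_
    dsimp only
    rw [graphWord_eq, graphWord_eq]
    rfl
  · have h₁ : (w x).drop 0 = encodeGame x.1.1 ++ encodeGame x.2.1 := rfl
    obtain ⟨h₂, hd, hL, ho⟩ := drop_game h₁
    obtain ⟨-, hd', hL', ho'⟩ := drop_game (h₂.trans (List.append_nil _).symm)
    refine Iff.trans ?_ (GameData.finGraph_iso_iff hL.pos (fun _ _ => least_le _ _)
      fun _ _ => least_le _ _).symm
    refine (GameData.colouredIso_iff_gameIso hd hd' hL hL' fun i s j t heq => ?_).symm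
    obtain ⟨a, u, hu⟩ := ho i s
    obtain ⟨a', u', hu'⟩ := ho' j t
    exact occurrence_injective hu hu' heq

theorem gIComplete_gameIsoProblemOn (team : Bool) {C : Game → Prop}
    (hC : ∀ G, C (incidenceGame team G)) : GIComplete (gameIsoProblemOn C) :=
  ⟨gameIso_reduces C, fun _ hQ => hQ.trans (graphIso_reduces team C hC)⟩

end GameIsoGI

theorem mainTheorem2 :
    GameIsoGI.GIComplete GameIsoGI.gameIsoProblem ∧
      GameIsoGI.GIComplete
        (GameIsoGI.gameIsoProblemOn GameIsoGI.Game.IsTwoPlayerZeroSum) ∧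
      GameIsoGI.GIComplete
        (GameIsoGI.gameIsoProblemOn GameIsoGI.Game.IsTwoPlayerTeam) :=
  ⟨GameIsoGI.gIComplete_gameIsoProblemOn true fun _ => trivial,
    GameIsoGI.gIComplete_gameIsoProblemOn false GameIsoGI.incidenceGame_zeroSum,
    GameIsoGI.gIComplete_gameIsoProblemOn true GameIsoGI.incidenceGame_team⟩
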